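/- Let $c\in L^\infty(\mathbb R)$ be real, a.e. nonnegative, compactly supported and not a.e. zero. Let $K=\sum_{i=1}^N k_i^2\langle\cdot,\mathcal P_i\rangle\mathcal P_i$ in $L^2(-1,1)$, where $k_i>0$ and the $\mathcal P_i$ are real polynomials, orthonormal in $L^2(-1,1)$, and assume that the constant function is an eigenfunction of $K$ with a nonzero eigenvalue. (Inner products are linear in the first argument, $\ln$ is the principal branch, cut along the negative half-axis, and $\mathbb C_+=\{\operatorname{Im}z>0\}$.) In $H=L^2(\mathbb R\times[-1,1])$ let $L_0=i\mu\partial_x$ be the self-adjoint operator whose domain consists of the $f\in H$ such that $f(\cdot,\mu)$ is (locally) absolutely continuous for a.e. $\mu$ and $\mu\partial_xf\in H$. Put $V=c(x)K\ge 0$, $L=L_0-iV$, $T=L^*$, $E=\overline{\operatorname{Ran}V}$, and for $z\in\mathbb C_+$ $$S(z)=I+2i\sqrt V(T^*-z)^{-1}\sqrt V\big|_E,\qquad Q(z)=i\sqrt V(L_0-z)^{-1}\sqrt V\big|_E ;$$ $S$ is the characteristic function of $T$. Let $\ell\in E$, $\ell(x,\mu)=\sqrt{c(x)}\sum_i k_i\mathcal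 P_i(0)\mathcal P_i(\mu)$, and let $\mathcal O=\mathbb C\setminus\{-it:t\ge0\}$. Then the following holds. (0) The norm limit $B=\lim_{z\to0,\,z\in\mathbb C_+}\big(Q(z)-\ln(-iz)\langle\cdot,\ell\rangle\ell\big)$ exists. With $\widetilde Q(z)=\ln(-iz)\langle\cdot,\ell\rangle\ell+B$ one has $Q(z)=\widetilde Q(z)+\Theta(z)$ for $z\in\mathbb C_+$, where $\Theta$ is an analytic operator function in $\mathcal O$ with $\|\Theta(z)\|\le C|z\ln z|$ for $z\in\mathcal O$, $|z|\le 1/2$. There is a $\delta>0$ such that $I-\widetilde Q(i\delta)$ is boundedly invertible. (1) The function $S$ is analytic on the real axis except at the point $0$ (that is, it continues analytically to a neighbourhood of every real $k\ne0$), extends to a norm-continuous function on $\overline{\mathbb C_+}$, and admits an analytic continuation from $\mathbb C_+$ to $\Pi=\{z\ne0:\arg z\ne-\pi/2,\ |z|\le\delta_0\}$ for some $\delta_0>0$. These extensions are denoted by $S$ again. (2) For every $\delta>0$ such that $I-\widetilde Q(i\delta)$ is boundedly invertible, put $$\alpha(z)=-\ln\left(-\frac{iz}\delta\right),\qquad \vartheta_c=\left\langle(I-\widetilde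 Q(i\delta))^{-1}\ell,\ell\right\rangle .$$ Then $\vartheta_c\ne0$, $$S(0)=\frac{I+\widetilde Q(i\delta)}{I-\widetilde Q(i\delta)}-\frac2{\vartheta_c}\left\langle\cdot,(I-\widetilde Q^*(i\delta))^{-1}\ell\right\rangle(I-\widetilde Q(i\delta))^{-1}\ell ,$$ and in the operator norm, uniformly in $\arg z$, $$S(z)=S(0)+\frac2{\vartheta_c(1+\alpha(z)\vartheta_c)}\left\langle\cdot,(I-\widetilde Q^*(i\delta))^{-1}\ell\right\rangle(I-\widetilde Q(i\delta))^{-1}\ell+O(|z\ln z|),\qquad z\in\Pi,\ z\to0 .$$ -/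

import Mathlib

open MeasureTheory Set Filter Topology
open scoped ENNReal InnerProductSpace

namespace SlabTransport
noncomputable section

section Abstract
variable {H : Type*} [NormedAddCommGroup H] [InnerProductSpace ℂ H]

/-- `R = (A - z)⁻¹` as a bounded operator, for an unbounded operator `A`. -/
def IsResolventAt (A : H →ₗ.[ℂ] H) (z : ℂ) (R : H →L[ℂ] H) : Prop :=
  (∀ f : H, ∃ h : R f ∈ A.domain, A ⟨R f, h⟩ - z • R f = f) ∧
    ∀ u : A.domain, R (A u - z • (u : H)) = u

open Classical in
/-- The resolvent `(A - z)⁻¹` at a point `z` of the resolvent set (and `0` elsewhere). -/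
def resolventOp (A : H →ₗ.[ℂ] H) (z : ℂ) : H →L[ℂ] H :=
  if h : ∃ R, IsResolventAt A z R then h.choose else 0

theorem IsResolventAt.resolventOp_eq {A : H →ₗ.[ℂ] H} {z : ℂ} {R : H →L[ℂ] H}
    (hR : IsResolventAt A z R) : resolventOp A z = R := by
  have h : ∃ R, IsResolventAt A z R := ⟨R, hR⟩
  rw [resolventOp, dif_pos h]
  ext f
  obtain ⟨hf, e⟩ := hR.1 f
  conv_lhs => rw [← e]
  exact h.choose_spec.2 ⟨R f, hf⟩

variable [CompleteSpace H]

/-- The closure of the range of `V`. -/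
abbrev rangeClosure (V : H →L[ℂ] H) : Submodule ℂ H :=
  (LinearMap.range (V : H →ₗ[ℂ] H)).topologicalClosure

theorem sqrt_apply_mem_rangeClosure (V : H →L[ℂ] H) (f : H) :
    CFC.sqrt V f ∈ rangeClosure V := by
  by_cases hV : 0 ≤ V
  · have hsa : ContinuousLinearMap.adjoint (CFC.sqrt V) = CFC.sqrt V :=
      (CFC.sqrt_nonneg V).isSelfAdjoint
    have hcl : IsClosed (rangeClosure V : Set H) := Submodule.isClosed_topologicalClosure _
    rw [← Submodule.orthogonal_orthogonal (rangeClosure V)]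
    rw [Submodule.mem_orthogonal]
    intro u hu
    have h1 : ⟪V u, u⟫_ℂ = 0 :=
      (Submodule.mem_orthogonal _ _).1 hu _ (Submodule.le_topologicalClosure _ ⟨u, rfl⟩)
    have h2 : CFC.sqrt V u = 0 := by
      rw [← CFC.sqrt_mul_sqrt_self V hV] at h1
      rw [mul_apply_eq_comp, ← ContinuousLinearMap.adjoint_inner_right, hsa] at h1
      exact inner_self_eq_zero.1 h1
    rw [← ContinuousLinearMap.adjoint_inner_left, hsa, h2, inner_zero_left]
  · rw [CFC.sqrt_of_not_nonneg hV]
    exact zero_mem _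

/-- `√V`, viewed as an operator into `closure (Ran V)`. -/
def sqrtTo (V : H →L[ℂ] H) : H →L[ℂ] rangeClosure V :=
  (CFC.sqrt V).codRestrict (rangeClosure V) (sqrt_apply_mem_rangeClosure V)

/-- `√V`, restricted to `closure (Ran V)`. -/
def sqrtFrom (V : H →L[ℂ] H) : rangeClosure V →L[ℂ] H :=
  CFC.sqrt V ∘L (rangeClosure V).subtypeL

/-- `i √V (A₀ - z)⁻¹ √V`, restricted to `closure (Ran V)`. -/
def borderedResolvent (A₀ : H →ₗ.[ℂ] H) (V : H →L[ℂ] H) (z : ℂ) :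
    rangeClosure V →L[ℂ] rangeClosure V :=
  Complex.I • (sqrtTo V ∘L resolventOp A₀ z ∘L sqrtFrom V)

/-- The characteristic function `I + 2 i √V (A* - z)⁻¹ √V` on `closure (Ran V)` of a maximal
dissipative operator `A` with bounded imaginary part `V`. -/
def characteristicFunction (A : H →ₗ.[ℂ] H) (V : H →L[ℂ] H) (z : ℂ) :
    rangeClosure V →L[ℂ] rangeClosure V :=
  1 + (2 * Complex.I) • (sqrtTo V ∘L resolventOp A.adjoint z ∘L sqrtFrom V)

end Abstract

/-- Lebesgue measure on `[-1, 1]`. -/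
abbrev angleMeasure : Measure ℝ := volume.restrict (Icc (-1) 1)
abbrev phaseMeasure : Measure (ℝ × ℝ) := (volume : Measure ℝ).prod angleMeasure
/-- The space `L²(ℝ × [-1, 1])`. -/
abbrev PhaseSpace : Type := Lp ℂ 2 phaseMeasure

/-- `f` has a representative that is (locally) absolutely continuous in `x` for a.e. `μ`, and
`g = i μ ∂ₓ f` almost everywhere (so that `μ ∂ₓ f` is square integrable). -/
def IsStreamingPair (f g : PhaseSpace) : Prop :=
  ∃ F : ℝ × ℝ → ℂ, f =ᵐ[phaseMeasure] F ∧
    (∀ᵐ μ ∂angleMeasure, ∀ a b : ℝ,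
      AbsolutelyContinuousOnInterval (fun x => F (x, μ)) a b) ∧
    ∀ᵐ p ∂phaseMeasure, DifferentiableAt ℝ (fun x => F (x, p.2)) p.1 ∧
      g p = Complex.I * p.2 * deriv (fun x => F (x, p.2)) p.1

/-- The graph of `i μ ∂ₓ`. -/
def streamingGraph : Submodule ℂ (PhaseSpace × PhaseSpace) where
  carrier := {fg | IsStreamingPair fg.1 fg.2}
  zero_mem' := by
    refine ⟨0, Lp.coeFn_zero _ _ _, ?_, ?_⟩
    · refine Eventually.of_forall fun μ a b => ?_
      rw [absolutelyContinuousOnInterval_iff]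
      intro ε hε
      exact ⟨1, one_pos, fun E _ _ => by simpa using hε⟩
    · filter_upwards [Lp.coeFn_zero ℂ 2 phaseMeasure] with p hp
      have e : (fun x : ℝ => (0 : ℝ × ℝ → ℂ) (x, p.2)) = fun _ => 0 := rfl
      rw [e]
      refine ⟨differentiableAt_const _, ?_⟩
      simpa using hp
  add_mem' := by
    rintro ⟨f, g⟩ ⟨f', g'⟩ ⟨F, hF, hac, hd⟩ ⟨F', hF', hac', hd'⟩
    refine ⟨F + F', ?_, ?_, ?_⟩
    · exact (Lp.coeFn_add _ _).trans (hF.add hF')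
    · filter_upwards [hac, hac'] with μ h h' a b
      exact (h a b).add (h' a b)
    · filter_upwards [hd, hd', Lp.coeFn_add g g'] with p h h' hg
      have e : (fun x : ℝ => (F + F') (x, p.2)) =
        (fun x : ℝ => F (x, p.2)) + fun x : ℝ => F' (x, p.2) := rfl
      rw [e]
      refine ⟨h.1.add h'.1, ?_⟩
      rw [deriv_add h.1 h'.1, mul_add, ← h.2, ← h'.2]
      exact hg
  smul_mem' := by
    rintro a ⟨f, g⟩ ⟨F, hF, hac, hd⟩
    refine ⟨a • F, ?_, ?_, ?_⟩
    · exact (Lp.coeFn_smul _ _).trans (hF.const_smul a)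
    · filter_upwards [hac] with μ h b b'
      exact (h b b').const_smul a
    · filter_upwards [hd, Lp.coeFn_smul a g] with p h hg
      have e : (fun x : ℝ => (a • F) (x, p.2)) = a • fun x : ℝ => F (x, p.2) := rfl
      rw [e]
      refine ⟨h.1.const_smul a, ?_⟩
      rw [deriv_const_smul _ h.1]
      refine hg.trans ?_
      simp only [Pi.smul_apply, smul_eq_mul, h.2]
      ring

/-- The graph is single valued: the absolutely continuous representative, and hence its derivative,
is determined by the class `f`. -/
theorem streamingGraph_functional (fg : PhaseSpace × PhaseSpace) (h : fg ∈ streamingGraph)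
    (h0 : fg.1 = 0) : fg.2 = 0 := by
  obtain ⟨f, g⟩ := fg
  obtain ⟨F, hF, hac, hd⟩ := h
  simp only at h0 hF hd ⊢
  subst h0
  have h1 : ∀ᵐ p ∂phaseMeasure, F p = 0 := by
    filter_upwards [hF, Lp.coeFn_zero ℂ 2 phaseMeasure] with p h h'
    rw [← h, h']; rfl
  have h2 : ∀ᵐ μ ∂angleMeasure, ∀ᵐ x : ℝ, F (x, μ) = 0 :=
    Measure.ae_ae_of_ae_prod 
      (Measure.measurePreserving_swap.quasiMeasurePreserving.ae h1)
  have h3 : ∀ᵐ μ ∂angleMeasure, ∀ x : ℝ, F (x, μ) = 0 := by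
    filter_upwards [h2, hac] with μ h hc x
    have hcont : Continuous fun x => F (x, μ) := by
      rw [continuous_iff_continuousAt]
      intro y
      refine ((hc (y-1) (y+1)).continuousOn).continuousAt ?_
      rw [uIcc_of_le (by linarith)]
      exact Icc_mem_nhds (by linarith) (by linarith)
    exact congrFun ((hcont.ae_eq_iff_eq volume continuous_const).1 h) x
  have h4 : ∀ᵐ p ∂phaseMeasure, ∀ x : ℝ, F (x, p.2) = 0 :=
    Measure.quasiMeasurePreserving_snd.ae h3
  rw [Lp.eq_zero_iff_ae_eq_zero]
  filter_upwards [h4, hd] with p h h'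
  have e : (fun x : ℝ => F (x, p.2)) = fun _ => 0 := funext h
  rw [h'.2, e]; simp

/-- The self-adjoint operator `L₀ = i μ ∂ₓ` in `L²(ℝ × [-1, 1])`, with the domain of those `f` which
are absolutely continuous in `x` for a.e. `μ` and have `μ ∂ₓ f` in `L²`. -/
def streamingOp : PhaseSpace →ₗ.[ℂ] PhaseSpace := streamingGraph.toLinearPMap


/-- The function `x ↦ ∫_{-1}^{1} f(x, μ) p(μ) dμ`. -/
def angleAverage (p : Polynomial ℝ) (f : ℝ × ℝ → ℂ) (x : ℝ) : ℂ :=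
  ∫ μ, f (x, μ) * ((p.eval μ : ℝ) : ℂ) ∂angleMeasure

theorem exists_eval_bound (p : Polynomial ℝ) :
    ∃ M : NNReal, ∀ μ ∈ Icc (-1 : ℝ) 1, ‖((p.eval μ : ℝ) : ℂ)‖ₑ ≤ M := by
  obtain ⟨C, hC⟩ := (isCompact_Icc (a := (-1 : ℝ)) (b := 1)).exists_bound_of_continuousOn
    p.continuous.continuousOn
  refine ⟨C.toNNReal, fun μ hμ => ?_⟩
  have h := hC μ hμ
  rw [← ofReal_norm, Complex.norm_real]
  exact ENNReal.ofReal_le_ofReal h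

theorem angleMeasure_univ : angleMeasure univ = 2 := by
  simp [angleMeasure]; norm_num

theorem sq_lintegral_le {g : ℝ → ℝ≥0∞} (hg : AEMeasurable g angleMeasure) :
    (∫⁻ μ, g μ ∂angleMeasure) ^ 2 ≤ 2 * ∫⁻ μ, g μ ^ 2 ∂angleMeasure := by
  have h := ENNReal.lintegral_mul_le_Lp_mul_Lq angleMeasure Real.HolderConjugate.two_two hg
    (aemeasurable_const (b := (1 : ℝ≥0∞)))
  simp only [Pi.mul_apply, mul_one, ENNReal.one_rpow, lintegral_const, one_mul,
    angleMeasure_univ] at h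
  calc _ ≤ _ := pow_le_pow_left' h 2
    _ = _ := by
      rw [mul_pow, ← ENNReal.rpow_natCast, ← ENNReal.rpow_mul, ← ENNReal.rpow_natCast,
        ← ENNReal.rpow_mul]
      norm_num [mul_comm]

theorem aestronglyMeasurable_angleAverage (p : Polynomial ℝ) {f : ℝ × ℝ → ℂ}
    (hf : AEStronglyMeasurable f phaseMeasure) :
    AEStronglyMeasurable (angleAverage p f) volume := by
  refine AEStronglyMeasurable.integral_prod_right' (f := fun q : ℝ × ℝ => f q * ((p.eval q.2 : ℝ) : ℂ)) ?_
  refine hf.mul (Continuous.aestronglyMeasurable ?_)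
  exact Complex.continuous_ofReal.comp (p.continuous.comp continuous_snd)

theorem eLpNorm_angleAverage_le (p : Polynomial ℝ) :
    ∃ C : NNReal, ∀ f : ℝ × ℝ → ℂ, AEStronglyMeasurable f phaseMeasure →
      eLpNorm (fun q : ℝ × ℝ => angleAverage p f q.1 * ((p.eval q.2 : ℝ) : ℂ)) 2 phaseMeasure ≤
        C * eLpNorm f 2 phaseMeasure := by
  obtain ⟨M, hM⟩ := exists_eval_bound p
  refine ⟨2 * M ^ 2, fun f hf => ?_⟩
  have key : ∀ g : ℝ × ℝ → ℂ, eLpNorm g 2 phaseMeasure =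
      (∫⁻ q, ‖g q‖ₑ ^ 2 ∂phaseMeasure) ^ (1 / 2 : ℝ) := by
    intro g
    rw [eLpNorm_eq_lintegral_rpow_enorm_toReal (by norm_num) (by norm_num)]
    simp
  have hslice : ∀ᵐ x : ℝ, AEStronglyMeasurable (fun μ => f (x, μ)) angleMeasure :=
    hf.prodMk_left
  have hmeas : AEMeasurable
      (fun q : ℝ × ℝ => ‖angleAverage p f q.1 * ((p.eval q.2 : ℝ) : ℂ)‖ₑ ^ 2) phaseMeasure := by
    refine AEMeasurable.pow_const (AEStronglyMeasurable.enorm ?_) 2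
    refine (aestronglyMeasurable_angleAverage p hf).comp_fst.mul
      (Continuous.aestronglyMeasurable ?_)
    exact Complex.continuous_ofReal.comp (p.continuous.comp continuous_snd)
  have main : ∫⁻ q, ‖angleAverage p f q.1 * ((p.eval q.2 : ℝ) : ℂ)‖ₑ ^ 2 ∂phaseMeasure ≤
      (2 * (M : ℝ≥0∞) ^ 2) ^ 2 * ∫⁻ q, ‖f q‖ₑ ^ 2 ∂phaseMeasure := by
    rw [lintegral_prod _ hmeas, lintegral_prod _ (hf.enorm.pow_const 2),
      ← lintegral_const_mul' _ _ (by finiteness)]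
    refine lintegral_mono_ae ?_
    filter_upwards [hslice] with x hx
    have h1 : ‖angleAverage p f x‖ₑ ≤ M * ∫⁻ μ, ‖f (x, μ)‖ₑ ∂angleMeasure := by
      rw [← lintegral_const_mul' _ _ (by simp)]
      refine (enorm_integral_le_lintegral_enorm _).trans (lintegral_mono_ae ?_)
      filter_upwards [ae_restrict_mem measurableSet_Icc] with μ hμ
      rw [enorm_mul, mul_comm]
      gcongr
      exact hM μ hμ
    have h2 := sq_lintegral_le hx.enorm
    calc ∫⁻ μ, ‖angleAverage p f x * ((p.eval μ : ℝ) : ℂ)‖ₑ ^ 2 ∂angleMeasure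
        ≤ ∫⁻ _μ, ((M * ∫⁻ μ, ‖f (x, μ)‖ₑ ∂angleMeasure) * M) ^ 2 ∂angleMeasure := by
          refine lintegral_mono_ae ?_
          filter_upwards [ae_restrict_mem measurableSet_Icc] with μ hμ
          rw [enorm_mul]
          gcongr
          exact hM μ hμ
      _ = 2 * M ^ 4 * (∫⁻ μ, ‖f (x, μ)‖ₑ ∂angleMeasure) ^ 2 := by
          rw [lintegral_const, angleMeasure_univ]; ring
      _ ≤ 2 * M ^ 4 * (2 * ∫⁻ μ, ‖f (x, μ)‖ₑ ^ 2 ∂angleMeasure) := by gcongr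
      _ = (2 * (M : ℝ≥0∞) ^ 2) ^ 2 * ∫⁻ μ, ‖f (x, μ)‖ₑ ^ 2 ∂angleMeasure := by ring
  rw [key, key]
  calc _ ≤ ((2 * (M : ℝ≥0∞) ^ 2) ^ 2 * ∫⁻ q, ‖f q‖ₑ ^ 2 ∂phaseMeasure) ^ (1 / 2 : ℝ) := by
        gcongr
    _ = _ := by
        rw [ENNReal.mul_rpow_of_nonneg _ _ (by norm_num), ← ENNReal.rpow_natCast,
          ← ENNReal.rpow_mul]
        norm_num

theorem memLp_angleAverage_mul (p : Polynomial ℝ) {f : ℝ × ℝ → ℂ} (hf : MemLp f 2 phaseMeasure) :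
    MemLp (fun q : ℝ × ℝ => angleAverage p f q.1 * ((p.eval q.2 : ℝ) : ℂ)) 2 phaseMeasure := by
  obtain ⟨C, hC⟩ := eLpNorm_angleAverage_le p
  refine ⟨?_, (hC f hf.1).trans_lt (ENNReal.mul_lt_top (by simp) hf.2)⟩
  refine (aestronglyMeasurable_angleAverage p hf.1).comp_fst.mul
    (Continuous.aestronglyMeasurable ?_)
  exact Complex.continuous_ofReal.comp (p.continuous.comp continuous_snd)

theorem ae_integrable_slice (p : Polynomial ℝ) {f : ℝ × ℝ → ℂ} (hf : MemLp f 2 phaseMeasure) :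
    ∀ᵐ x : ℝ, Integrable (fun μ => f (x, μ) * ((p.eval μ : ℝ) : ℂ)) angleMeasure := by
  obtain ⟨M, hM⟩ := exists_eval_bound p
  have h1 : Integrable (fun q => ‖f q‖ ^ 2) phaseMeasure := hf.integrable_norm_pow (by norm_num)
  filter_upwards [h1.prod_right_ae, hf.1.prodMk_left] with x h2 h3
  have h4 : MemLp (fun μ => f (x, μ)) 2 angleMeasure :=
    (memLp_two_iff_integrable_sq_norm h3).2 h2
  refine (h4.integrable (by norm_num)).mul_bdd (c := M) ?_ ?_
  · exact (Complex.continuous_ofReal.comp p.continuous).aestronglyMeasurable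
  · filter_upwards [ae_restrict_mem measurableSet_Icc] with μ hμ
    have := hM μ hμ
    rwa [enorm_le_coe] at this

theorem angleAverage_congr (p : Polynomial ℝ) {f g : ℝ × ℝ → ℂ} (h : f =ᵐ[phaseMeasure] g) :
    angleAverage p f =ᵐ[volume] angleAverage p g := by
  filter_upwards [Measure.ae_ae_of_ae_prod h] with x hx
  refine integral_congr_ae ?_
  filter_upwards [hx] with μ hμ
  rw [hμ]

/-- The operator `f ↦ (∫_{-1}^{1} f(x, μ') p(μ') dμ') p(μ)` in `L²(ℝ × [-1, 1])`. -/
def angleProjection (p : Polynomial ℝ) : PhaseSpace →L[ℂ] PhaseSpace :=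
  LinearMap.mkContinuousOfExistsBound
    { toFun := fun f => (memLp_angleAverage_mul p (Lp.memLp f)).toLp
        (fun q : ℝ × ℝ => angleAverage p f q.1 * ((p.eval q.2 : ℝ) : ℂ))
      map_add' := by
        intro f g
        rw [← MemLp.toLp_add]
        refine MemLp.toLp_congr _ _ ?_
        have h1 : ∀ᵐ x : ℝ, angleAverage p (f + g : PhaseSpace) x =
            angleAverage p f x + angleAverage p g x := by
          filter_upwards [angleAverage_congr p (Lp.coeFn_add f g),
            ae_integrable_slice p (Lp.memLp f), ae_integrable_slice p (Lp.memLp g)] with x h hf hg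
          rw [h]
          simp only [angleAverage, Pi.add_apply, add_mul]
          exact integral_add hf hg
        filter_upwards [Measure.quasiMeasurePreserving_fst.ae h1] with q hq
        simp only [Pi.add_apply, hq, add_mul]
      map_smul' := by
        intro a f
        rw [RingHom.id_apply, ← MemLp.toLp_const_smul]
        refine MemLp.toLp_congr _ _ ?_
        have h1 : ∀ᵐ x : ℝ, angleAverage p (a • f : PhaseSpace) x = a * angleAverage p f x := by
          filter_upwards [angleAverage_congr p (Lp.coeFn_smul a f)] with x h
          rw [h]
          simp only [angleAverage, Pi.smul_apply, smul_eq_mul, mul_assoc]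
          exact integral_const_mul _ _
        filter_upwards [Measure.quasiMeasurePreserving_fst.ae h1] with q hq
        simp only [Pi.smul_apply, smul_eq_mul, hq, mul_assoc] }
    (by
      obtain ⟨C, hC⟩ := eLpNorm_angleAverage_le p
      refine ⟨C, fun f => ?_⟩
      simp only [LinearMap.coe_mk, AddHom.coe_mk]
      rw [Lp.norm_toLp, Lp.norm_def]
      have := ENNReal.toReal_mono (ENNReal.mul_ne_top (by simp) (Lp.eLpNorm_ne_top f))
        (hC f (Lp.aestronglyMeasurable f))
      simpa using this)

theorem coeFn_angleProjection (p : Polynomial ℝ) (f : PhaseSpace) :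
    angleProjection p f =ᵐ[phaseMeasure]
      fun q : ℝ × ℝ => angleAverage p f q.1 * ((p.eval q.2 : ℝ) : ℂ) :=
  MemLp.coeFn_toLp (memLp_angleAverage_mul p (Lp.memLp f))

/-- The data of the slab transport problem: the multiplication coefficient `c`, and the collision
operator `K = ∑ᵢ kᵢ² ⟨·, 𝒫ᵢ⟩ 𝒫ᵢ` with polynomial orthonormal eigenfunctions `𝒫ᵢ`, such that the
constant function is an eigenfunction of `K` (with a nonzero eigenvalue). -/
structure Medium where
  c : ℝ → ℝ
  memLp_c : MemLp c ∞ volume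
  c_nonneg : ∀ᵐ x, 0 ≤ c x
  c_support : ∃ R : ℝ, ∀ᵐ x, R < |x| → c x = 0
  N : ℕ
  k : Fin N → ℝ
  k_pos : ∀ i, 0 < k i
  P : Fin N → Polynomial ℝ
  orthonormal : ∀ i j, ∫ μ, (P i).eval μ * (P j).eval μ ∂angleMeasure = if i = j then 1 else 0
  const_eigen : ∃ κ : ℝ, κ ≠ 0 ∧ ∀ μ ∈ Icc (-1 : ℝ) 1,
    ∑ i, k i ^ 2 * (∫ μ', (P i).eval μ' ∂angleMeasure) * (P i).eval μ = κ

namespace Medium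
variable (d : Medium)

theorem memLp_c_fst : MemLp (fun q : ℝ × ℝ => (d.c q.1 : ℂ)) ∞ phaseMeasure := by
  obtain ⟨h, h'⟩ := d.memLp_c
  refine memLp_top_of_bound (Complex.continuous_ofReal.comp_aestronglyMeasurable h.comp_fst)
    (eLpNorm d.c ∞ volume).toReal ?_
  have h1 : ∀ᵐ x : ℝ, ‖d.c x‖ ≤ (eLpNorm d.c ∞ volume).toReal := by
    filter_upwards [ae_le_eLpNormEssSup (f := d.c) (μ := volume)] with x hx
    have := ENNReal.toReal_mono h'.ne (by simpa [eLpNorm_exponent_top] using hx)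
    simpa using this
  filter_upwards [Measure.quasiMeasurePreserving_fst.ae h1] with q hq
  simpa using hq

/-- `K` (that is, `I ⊗ K`) in `L²(ℝ × [-1, 1])`. -/
def collisionOp : PhaseSpace →L[ℂ] PhaseSpace :=
  ∑ i, ((d.k i ^ 2 : ℝ) : ℂ) • angleProjection (d.P i)

/-- Multiplication by `c(x)`. -/
def mulC : PhaseSpace →L[ℂ] PhaseSpace :=
  (ContinuousLinearMap.mul ℂ ℂ).holderL phaseMeasure ∞ 2 2 (d.memLp_c_fst.toLp _)

/-- `V = c K`, the imaginary part of `T`. -/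
def V : PhaseSpace →L[ℂ] PhaseSpace := d.mulC ∘L d.collisionOp

theorem coeFn_V (f : PhaseSpace) : d.V f =ᵐ[phaseMeasure] fun q => (d.c q.1 : ℂ) *
    ∑ i, ((d.k i ^ 2 : ℝ) : ℂ) * (angleAverage (d.P i) f q.1 * ((d.P i).eval q.2 : ℝ)) := by
  have h1 : d.V f =ᵐ[phaseMeasure] fun q => (d.c q.1 : ℂ) * d.collisionOp f q := by
    refine ((ContinuousLinearMap.mul ℂ ℂ).coeFn_holder (r := 2) (d.memLp_c_fst.toLp _)
      (d.collisionOp f)).trans ?_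
    filter_upwards [d.memLp_c_fst.coeFn_toLp] with q hq
    rw [hq]; rfl
  have h2 : d.collisionOp f =ᵐ[phaseMeasure] fun q =>
      ∑ i, ((d.k i ^ 2 : ℝ) : ℂ) * (angleAverage (d.P i) f q.1 * ((d.P i).eval q.2 : ℝ)) := by
    have e : d.collisionOp f = ∑ i, ((d.k i ^ 2 : ℝ) : ℂ) • angleProjection (d.P i) f := by
      simp [collisionOp]
    rw [e]
    refine (Lp.coeFn_finsetSum _ _).trans ?_
    have h3 : ∀ᵐ q ∂phaseMeasure, ∀ i,
        (((d.k i ^ 2 : ℝ) : ℂ) • angleProjection (d.P i) f : PhaseSpace) q =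
        ((d.k i ^ 2 : ℝ) : ℂ) * (angleAverage (d.P i) f q.1 * ((d.P i).eval q.2 : ℝ)) := by
      rw [ae_all_iff]
      intro i
      filter_upwards [coeFn_angleProjection (d.P i) f,
        Lp.coeFn_smul ((d.k i ^ 2 : ℝ) : ℂ) (angleProjection (d.P i) f)] with q h h'
      rw [h', Pi.smul_apply, h, smul_eq_mul]
    filter_upwards [h3] with q hq
    rw [Finset.sum_apply]
    exact Finset.sum_congr rfl fun i _ => hq i
  filter_upwards [h1, h2] with q h h'
  rw [h, h']

/-- The function `ℓ(x, μ) = √c(x) ∑ᵢ kᵢ 𝒫ᵢ(0) 𝒫ᵢ(μ)`; in the basis `(𝒫ᵢ)` it is the vector function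
`√c(x) (k₁ 𝒫₁(0), …, k_N 𝒫_N(0))`. -/
def ellFun (q : ℝ × ℝ) : ℂ :=
  ((√(d.c q.1) * ∑ i, d.k i * (d.P i).eval 0 * (d.P i).eval q.2 : ℝ) : ℂ)

theorem memLp_ellFun : MemLp d.ellFun 2 phaseMeasure := by
  obtain ⟨R, hR⟩ := d.c_support
  obtain ⟨h, h'⟩ := d.memLp_c
  obtain ⟨C, hC⟩ := (isCompact_Icc (a := (-1 : ℝ)) (b := 1)).exists_bound_of_continuousOn
    (f := fun μ => ∑ i, d.k i * (d.P i).eval 0 * (d.P i).eval μ) (by fun_prop)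
  have hs : MeasurableSet (Icc (-R) R ×ˢ (univ : Set ℝ)) := measurableSet_Icc.prod .univ
  have hfin : phaseMeasure (Icc (-R) R ×ˢ (univ : Set ℝ)) ≠ ∞ := by
    rw [Measure.prod_prod, angleMeasure_univ]
    exact ENNReal.mul_ne_top (by simp) (by simp)
  refine (memLp_indicator_const 2 hs (√(eLpNorm d.c ∞ volume).toReal * C) (Or.inr hfin)).mono' ?_ ?_
  · refine Complex.continuous_ofReal.comp_aestronglyMeasurable ?_
    refine (Real.continuous_sqrt.comp_aestronglyMeasurable h).comp_fst.mul
      (Continuous.aestronglyMeasurable ?_)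
    fun_prop
  · have h1 : ∀ᵐ x : ℝ, ‖d.c x‖ ≤ (eLpNorm d.c ∞ volume).toReal := by
      filter_upwards [ae_le_eLpNormEssSup (f := d.c) (μ := volume)] with x hx
      have := ENNReal.toReal_mono h'.ne (by simpa [eLpNorm_exponent_top] using hx)
      simpa using this
    filter_upwards [Measure.quasiMeasurePreserving_fst.ae h1,
      Measure.quasiMeasurePreserving_fst.ae hR,
      Measure.quasiMeasurePreserving_snd.ae (ae_restrict_mem (μ := volume)
        (measurableSet_Icc (a := (-1 : ℝ)) (b := 1)))] with q hq hq' hq2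
    rw [ellFun, Complex.norm_real, norm_mul]
    by_cases hx : q.1 ∈ Icc (-R) R
    · rw [indicator_of_mem (by exact ⟨hx, mem_univ _⟩), Real.norm_of_nonneg (Real.sqrt_nonneg _)]
      have := hC _ hq2
      gcongr
      exact (le_abs_self _).trans hq
    · rw [hq' (by rw [mem_Icc, ← abs_le] at hx; exact not_le.1 hx)]
      simp only [Real.sqrt_zero, norm_zero, zero_mul]
      exact indicator_nonneg (fun _ _ => by
        have : 0 ≤ C := (norm_nonneg _).trans (hC 0 (by simp))
        positivity) _

/-- The quadratic form of `V`: `⟨V u, u⟩ = ∫ c(x) ∑ᵢ kᵢ² |∫ u(x, μ) 𝒫ᵢ(μ) dμ|² dx`. -/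
theorem inner_V_self (u : PhaseSpace) : Integrable (fun x => d.c x *
      ∑ i, d.k i ^ 2 * ‖angleAverage (d.P i) u x‖ ^ 2) ∧
    ⟪d.V u, u⟫_ℂ = ((∫ x, d.c x * ∑ i, d.k i ^ 2 * ‖angleAverage (d.P i) u x‖ ^ 2 : ℝ) : ℂ) := by
  have hint := L2.integrable_inner (𝕜 := ℂ) (d.V u) u
  have hsl : ∀ᵐ x : ℝ, ∀ i,
      Integrable (fun μ => u (x, μ) * (((d.P i).eval μ : ℝ) : ℂ)) angleMeasure := by
    rw [ae_all_iff]
    exact fun i => ae_integrable_slice (d.P i) (Lp.memLp u)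
  have key : ∀ᵐ x : ℝ, ∫ μ, ⟪d.V u (x, μ), u (x, μ)⟫_ℂ ∂angleMeasure =
      ((d.c x * ∑ i, d.k i ^ 2 * ‖angleAverage (d.P i) u x‖ ^ 2 : ℝ) : ℂ) := by
    filter_upwards [hsl, Measure.ae_ae_of_ae_prod (d.coeFn_V u)] with x hx hV
    have e : ∀ᵐ μ ∂angleMeasure, ⟪d.V u (x, μ), u (x, μ)⟫_ℂ =
        ∑ i, ((d.c x * d.k i ^ 2 : ℝ) : ℂ) * (starRingEnd ℂ) (angleAverage (d.P i) u x) *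
          (u (x, μ) * (((d.P i).eval μ : ℝ) : ℂ)) := by
      filter_upwards [hV] with μ hμ
      rw [hμ]
      simp only [RCLike.inner_apply, map_mul, map_sum, Complex.conj_ofReal, Finset.mul_sum]
      refine Finset.sum_congr rfl fun i _ => ?_
      push_cast; ring
    rw [integral_congr_ae e, integral_finsetSum _ (fun i _ => (hx i).const_mul _)]
    push_cast
    rw [Finset.mul_sum]
    refine Finset.sum_congr rfl fun i _ => ?_
    rw [integral_const_mul, ← Complex.conj_mul']
    change _ * _ * angleAverage (d.P i) u x = _
    ring
  have hint2 := (hint.integral_prod_left).congr key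
  refine ⟨hint2.re, ?_⟩
  rw [L2.inner_def, integral_prod _ hint, integral_congr_ae key]
  exact integral_complex_ofReal

theorem ellFun_mem : d.memLp_ellFun.toLp d.ellFun ∈ rangeClosure d.V := by
  have hcl : IsClosed (rangeClosure d.V : Set PhaseSpace) := Submodule.isClosed_topologicalClosure _
  rw [← Submodule.orthogonal_orthogonal (rangeClosure d.V), Submodule.mem_orthogonal']
  intro u hu
  have h1 : ⟪d.V u, u⟫_ℂ = 0 :=
    (Submodule.mem_orthogonal _ _).1 hu _ (Submodule.le_topologicalClosure _ ⟨u, rfl⟩)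
  obtain ⟨hi, hV⟩ := d.inner_V_self u
  rw [hV, Complex.ofReal_eq_zero, integral_eq_zero_iff_of_nonneg_ae ?_ hi] at h1
  swap
  · filter_upwards [d.c_nonneg] with x hx
    exact mul_nonneg hx (Finset.sum_nonneg fun i _ => by positivity)
  have hsl : ∀ᵐ x : ℝ, ∀ i,
      Integrable (fun μ => u (x, μ) * (((d.P i).eval μ : ℝ) : ℂ)) angleMeasure := by
    rw [ae_all_iff]
    exact fun i => ae_integrable_slice (d.P i) (Lp.memLp u)
  have hint := L2.integrable_inner (𝕜 := ℂ) (d.memLp_ellFun.toLp d.ellFun) u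
  rw [L2.inner_def, integral_prod _ hint]
  refine integral_eq_zero_of_ae ?_
  filter_upwards [h1, hsl, d.c_nonneg,
    Measure.ae_ae_of_ae_prod d.memLp_ellFun.coeFn_toLp] with x hx hs hc hl
  have e : ∀ᵐ μ ∂angleMeasure, ⟪d.memLp_ellFun.toLp d.ellFun (x, μ), u (x, μ)⟫_ℂ =
      ∑ i, ((√(d.c x) * d.k i * (d.P i).eval 0 : ℝ) : ℂ) *
        (u (x, μ) * (((d.P i).eval μ : ℝ) : ℂ)) := by
    filter_upwards [hl] with μ hμ
    rw [hμ, ellFun, RCLike.inner_apply, Complex.conj_ofReal]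
    push_cast
    rw [Finset.mul_sum, Finset.mul_sum]
    refine Finset.sum_congr rfl fun i _ => ?_
    ring
  rw [integral_congr_ae e, integral_finsetSum _ (fun i _ => (hs i).const_mul _)]
  refine Finset.sum_eq_zero fun i _ => ?_
  rw [integral_const_mul]
  change _ * angleAverage (d.P i) u x = 0
  rcases mul_eq_zero.1 hx with h0 | h0
  · simp [h0]
  · have h2 := (Finset.sum_eq_zero_iff_of_nonneg (fun i _ => by positivity)).1 h0 i
      (Finset.mem_univ i)
    have h3 : angleAverage (d.P i) u x = 0 := by
      have := (d.k_pos i).ne'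
      simpa [this] using h2
    rw [h3, mul_zero]

/-- `E = closure (Ran V)`. -/
abbrev E : Submodule ℂ PhaseSpace := rangeClosure d.V

/-- The vector `ℓ` as an element of `E`. -/
def ell : d.E := ⟨d.memLp_ellFun.toLp d.ellFun, d.ellFun_mem⟩

/-- The transport operator `L = i μ ∂ₓ - i c K`. -/
def L : PhaseSpace →ₗ.[ℂ] PhaseSpace :=
  ((-Complex.I) • (d.V : PhaseSpace →ₗ[ℂ] PhaseSpace)) +ᵥ streamingOp

/-- The dissipative operator `T = L*`. -/
def T : PhaseSpace →ₗ.[ℂ] PhaseSpace := d.L.adjoint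

/-- The characteristic function of `T`. -/
def S (z : ℂ) : d.E →L[ℂ] d.E := characteristicFunction d.T d.V z

/-- `Q(z) = i √V (L₀ - z)⁻¹ √V` on `E`. -/
def Q (z : ℂ) : d.E →L[ℂ] d.E := borderedResolvent streamingOp d.V z

/-- `ln(-iz) ⟨·, ℓ⟩ ℓ`. -/
def logTerm (z : ℂ) : d.E →L[ℂ] d.E :=
  Complex.log (-Complex.I * z) • InnerProductSpace.rankOne ℂ d.ell d.ell

/-- The constant term `B = lim (Q(z) - ln(-iz) ⟨·, ℓ⟩ ℓ)` for `z → 0` in the upper half-plane. -/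
def B : d.E →L[ℂ] d.E :=
  limUnder (𝓝[{z : ℂ | 0 < z.im}] 0) fun z => d.Q z - d.logTerm z

/-- `Q̃(z) = ln(-iz) ⟨·, ℓ⟩ ℓ + B`. -/
def Qtilde (z : ℂ) : d.E →L[ℂ] d.E := d.logTerm z + d.B

/-- `(I - Q̃(iδ))⁻¹`, if `I - Q̃(iδ)` is boundedly invertible. -/
def qInv (δ : ℝ) : d.E →L[ℂ] d.E := Ring.inverse (1 - d.Qtilde (Complex.I * δ))

/-- `(I - Q̃*(iδ))⁻¹`, if `I - Q̃*(iδ)` is boundedly invertible. -/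
def qAdjInv (δ : ℝ) : d.E →L[ℂ] d.E :=
  Ring.inverse (1 - ContinuousLinearMap.adjoint (d.Qtilde (Complex.I * δ)))

/-- `ϑ_c = ⟨(I - Q̃(iδ))⁻¹ ℓ, ℓ⟩`, the product being linear in its first argument. -/
def theta (δ : ℝ) : ℂ := inner ℂ d.ell (d.qInv δ d.ell)

/-- The rank one operator `⟨·, (I - Q̃*(iδ))⁻¹ ℓ⟩ (I - Q̃(iδ))⁻¹ ℓ`. -/
def rankOneTerm (δ : ℝ) : d.E →L[ℂ] d.E :=
  InnerProductSpace.rankOne ℂ (d.qInv δ d.ell) (d.qAdjInv δ d.ell)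

end Medium

/-- `α(z) = - ln(-iz/δ)`. -/
def alpha (δ : ℝ) (z : ℂ) : ℂ := -Complex.log (-(Complex.I * z) / δ)

/-- The plane cut along the half-line `{-it : t ≥ 0}`. -/
def cutPlane : Set ℂ := {z | z ≠ 0 ∧ z.arg ≠ -(Real.pi / 2)}

/-- The slit disc `Π` of radius `δ₀`. -/
def slitDisc (δ₀ : ℝ) : Set ℂ := {z | z ∈ cutPlane ∧ ‖z‖ ≤ δ₀}

end
end SlabTransport

/-!
The group of free streaming is `e^{-itL₀} f(x, μ) = f(x + tμ, μ)`, so `-Q` is the Laplace transform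
of `√V e^{-itL₀} √V`. Once `t` exceeds the diameter of the support of `c`, the substitution
`y = x + tμ` in the angular integrals turns the polynomials `𝒫ⱼ 𝒫ᵢ` of `μ` into polynomials of
`(y - x) / t`, whence `√V e^{-itL₀} √V = ∑ t^(-m-1) Aₘ`, a finite sum with `A₀ = ⟨·, ℓ⟩ ℓ`. The
Laplace transform of the tail of `t^(-m-1)` is entire up to a multiple of `z^m ln(-iz)`, and that of
a compact time interval is entire; this is the expansion of `Q` at the origin.

The operator `S(z)` is the Cayley transform of `Q(z)`, which is dissipative in the closed upper
half-plane away from `0`, so `I - Q(z)` is invertible there. Near the origin the logarithm only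
multiplies a rank one operator: the Sherman-Morrison formula inverts `I - Q̃(z)` in terms of
`I - Q̃(iδ)`, with inverses that stay bounded as `α(z) → ∞`, and `Θ` is a small perturbation.
-/

namespace SlabTransport
noncomputable section

section Dissipative
variable {𝕜 H : Type*} [RCLike 𝕜] [NormedAddCommGroup H] [InnerProductSpace 𝕜 H]

/-- Dissipativity in the sense of semigroup theory: the numerical range of `T` lies in the closed
left half-plane. (For unbounded operators such as `Medium.T` the half-plane is the upper one, and
the two notions correspond under multiplication by `i`.) -/
def IsDissipative (T : H →L[𝕜] H) : Prop :=
  ∀ x, RCLike.re ⟪x, T x⟫_𝕜 ≤ 0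

theorem continuous_re_inner_apply (x : H) :
    Continuous fun T : H →L[𝕜] H => RCLike.re ⟪x, T x⟫_𝕜 := by
  fun_prop

theorem isClosed_isDissipative : IsClosed {T : H →L[𝕜] H | IsDissipative T} := by
  simp only [IsDissipative, ofPred_forall]
  exact isClosed_iInter fun x => isClosed_le (continuous_re_inner_apply x) continuous_const

variable [CompleteSpace H]

theorem isUnit_of_le_re_inner {T : H →L[𝕜] H} {c : ℝ} (hc : 0 < c)
    (h : ∀ x, c * ‖x‖ ^ 2 ≤ RCLike.re ⟪x, T x⟫_𝕜) : IsUnit T := by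
  refine T.isUnit_of_forall_le_norm_inner_map (c := ⟨c, hc.le⟩) hc fun x => ?_
  rw [norm_inner_symm]
  calc ‖x‖ ^ 2 * c = c * ‖x‖ ^ 2 := mul_comm _ _
    _ ≤ RCLike.re ⟪x, T x⟫_𝕜 := h x
    _ ≤ ‖⟪x, T x⟫_𝕜‖ := RCLike.re_le_norm _

theorem IsDissipative.isUnit_one_sub_of_add {T R : H →L[𝕜] H} (hT : IsDissipative (T + R))
    (hR : ‖R‖ < 1) : IsUnit (1 - T) := by
  refine isUnit_of_le_re_inner (sub_pos.2 hR) fun x => ?_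
  have hTR : RCLike.re ⟪x, T x⟫_𝕜 + RCLike.re ⟪x, R x⟫_𝕜 ≤ 0 := by
    simpa only [_root_.add_apply, inner_add_right, map_add] using hT x
  have hRx : |RCLike.re ⟪x, R x⟫_𝕜| ≤ ‖R‖ * ‖x‖ ^ 2 :=
    calc |RCLike.re ⟪x, R x⟫_𝕜| ≤ ‖x‖ * ‖R x‖ :=
          (RCLike.abs_re_le_norm _).trans (norm_inner_le_norm _ _)
      _ ≤ ‖x‖ * (‖R‖ * ‖x‖) := by gcongr; exact R.le_opNorm x
      _ = ‖R‖ * ‖x‖ ^ 2 := by ring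
  rw [_root_.sub_apply, one_apply_eq_self, inner_sub_right, map_sub, inner_self_eq_norm_sq]
  linarith [neg_abs_le (RCLike.re ⟪x, R x⟫_𝕜)]

theorem IsDissipative.isUnit_one_sub {T : H →L[𝕜] H} (hT : IsDissipative T) : IsUnit (1 - T) :=
  IsDissipative.isUnit_one_sub_of_add (R := 0) (by rwa [add_zero]) (by simp)

end Dissipative

section Cayley
variable {R : Type*} [Ring R] {X Y : R}

/-- The Cayley transform `(1 + X) (1 - X)⁻¹` in a ring (with the value `0` when `1 - X` is not
invertible). -/
def cayleyTransform (X : R) : R := (1 + X) * Ring.inverse (1 - X)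

theorem cayleyTransform_eq_two_nsmul_inverse_sub_one (hX : IsUnit (1 - X)) :
    cayleyTransform X = 2 • Ring.inverse (1 - X) - 1 := by
  have h : 1 + X = 2 - (1 - X) := by rw [← one_add_one_eq_two]; abel
  rw [cayleyTransform, h, sub_mul, Ring.mul_inverse_cancel _ hX, nsmul_eq_mul, Nat.cast_ofNat]

theorem eq_cayleyTransform (hX : IsUnit (1 - X)) (hY : Y = X + X * Y) :
    1 + 2 • Y = cayleyTransform X := by
  have h : (1 - X) * (1 + Y) = 1 := by
    rw [mul_add, mul_one, sub_mul, one_mul, sub_add_eq_add_sub, sub_eq_iff_eq_add]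
    nth_rw 1 [hY]
    abel
  have h' : Ring.inverse (1 - X) = 1 + Y := by
    rw [← Ring.inverse_mul_cancel_left (1 - X) (1 + Y) hX, h, mul_one]
  rw [cayleyTransform_eq_two_nsmul_inverse_sub_one hX, h']
  abel

theorem isUnit_one_sub_mul_comm {a b : R} (h : IsUnit (1 - a * b)) : IsUnit (1 - b * a) := by
  obtain ⟨⟨_, c, hc, hc'⟩, rfl⟩ := h
  refine ⟨⟨1 - b * a, 1 + b * c * a, ?_, ?_⟩, rfl⟩
  · calc (1 - b * a) * (1 + b * c * a) = 1 - b * a + b * ((1 - a * b) * c) * a := by noncomm_ring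
      _ = 1 := by rw [hc, mul_one, sub_add_cancel]
  · calc (1 + b * c * a) * (1 - b * a) = 1 - b * a + b * (c * (1 - a * b)) * a := by noncomm_ring
      _ = 1 := by rw [hc', mul_one, sub_add_cancel]

end Cayley

namespace IsResolventAt
variable {H : Type*} [NormedAddCommGroup H] [InnerProductSpace ℂ H]
  {A : H →ₗ.[ℂ] H} {z : ℂ} {R : H →L[ℂ] H}

theorem bounded_vadd (hR : IsResolventAt A z R) (W : H →L[ℂ] H) (hW : IsUnit (1 + R * W)) :
    IsResolventAt ((W : H →ₗ[ℂ] H) +ᵥ A) z (Ring.inverse (1 + R * W) * R) := by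
  have left_inv (x : H) : Ring.inverse (1 + R * W) (x + R (W x)) = x :=
    DFunLike.congr_fun (Ring.inverse_mul_cancel (1 + R * W) hW) x
  have right_inv (x : H) :
      Ring.inverse (1 + R * W) x + R (W (Ring.inverse (1 + R * W) x)) = x :=
    DFunLike.congr_fun (Ring.mul_inverse_cancel (1 + R * W) hW) x
  refine ⟨fun f => ?_, fun u => ?_⟩
  · have hu : (Ring.inverse (1 + R * W) * R) f =
        R (f - W ((Ring.inverse (1 + R * W) * R) f)) := by
      rw [map_sub]
      exact eq_sub_of_add_eq (right_inv (R f))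
    generalize (Ring.inverse (1 + R * W) * R) f = u at hu
    obtain ⟨hdom, hA⟩ := hR.1 (f - W u)
    simp only [← hu] at hdom hA
    refine ⟨hdom, ?_⟩
    change W u + A ⟨u, hdom⟩ - z • u = f
    rw [add_sub_assoc, hA, add_sub_cancel]
  · change Ring.inverse (1 + R * W) (R (W u + A u - z • (u : H))) = u
    rw [add_sub_assoc, map_add, hR.2 u, add_comm (R (W u))]
    exact left_inv u

theorem injective (hR : IsResolventAt A z R) : Function.Injective R := by
  rw [injective_iff_map_eq_zero]
  intro f hf
  obtain ⟨hdom, hA⟩ := hR.1 f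
  have h0 : (⟨R f, hdom⟩ : A.domain) = 0 := Subtype.ext hf
  rw [← hA, h0, LinearPMap.map_zero, hf, smul_zero, sub_zero]

variable [CompleteSpace H]

protected theorem adjoint (hA : Dense (A.domain : Set H)) (hR : IsResolventAt A z R) :
    IsResolventAt A.adjoint ((starRingEnd ℂ) z) (ContinuousLinearMap.adjoint R) := by
  have inner_eq (f : H) (u : A.domain) :
      ⟪f + (starRingEnd ℂ) z • ContinuousLinearMap.adjoint R f, (u : H)⟫_ℂ =
        ⟪ContinuousLinearMap.adjoint R f, A u⟫_ℂ := by
    have h := hR.2 u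
    rw [map_sub, map_smul, sub_eq_iff_eq_add] at h
    rw [ContinuousLinearMap.adjoint_inner_left, h, inner_add_left, inner_add_right,
      inner_smul_left, inner_smul_right, ContinuousLinearMap.adjoint_inner_left, Complex.conj_conj]
  refine ⟨fun f => ?_, fun u => ?_⟩
  · have hdom : ContinuousLinearMap.adjoint R f ∈ A.adjoint.domain :=
      LinearPMap.mem_adjoint_domain_of_exists _ ⟨_, inner_eq f⟩
    refine ⟨hdom, ?_⟩
    rw [LinearPMap.adjoint_apply_eq hA ⟨_, hdom⟩ (inner_eq f), add_sub_cancel_right]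
  · refine ext_inner_right ℂ fun f => ?_
    obtain ⟨hf, hAf⟩ := hR.1 f
    rw [ContinuousLinearMap.adjoint_inner_left, inner_sub_left,
      LinearPMap.adjoint_isFormalAdjoint hA u ⟨R f, hf⟩, inner_smul_left, Complex.conj_conj,
      ← inner_smul_right, ← inner_sub_right, hAf]

theorem dense_adjoint_domain (hA : Dense (A.domain : Set H)) (hR : IsResolventAt A z R) :
    Dense (A.adjoint.domain : Set H) := by
  rw [Submodule.dense_iff_topologicalClosure_eq_top, Submodule.topologicalClosure_eq_top_iff,
    Submodule.eq_bot_iff]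
  intro x hx
  refine hR.injective ?_
  rw [map_zero, ← inner_self_eq_zero (𝕜 := ℂ), ← ContinuousLinearMap.adjoint_inner_left]
  exact (Submodule.mem_orthogonal _ _).1 hx _ ((hR.adjoint hA).1 (R x)).choose

theorem adjoint_adjoint (hA : Dense (A.domain : Set H)) (hR : IsResolventAt A z R) :
    IsResolventAt A.adjoint.adjoint z R := by
  have h := (hR.adjoint hA).adjoint (hR.dense_adjoint_domain hA)
  rwa [Complex.conj_conj, ContinuousLinearMap.adjoint_adjoint] at h

end IsResolventAt

section Compress
variable {H : Type*} [NormedAddCommGroup H] [InnerProductSpace ℂ H] [CompleteSpace H]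
  {A : H →ₗ.[ℂ] H} {z : ℂ} {R V X Y : H →L[ℂ] H}

/-- The operator `√V X √V` on the closure of the range of `V`, in terms of which both
`borderedResolvent` and `characteristicFunction` are expressed. -/
def compress (V : H →L[ℂ] H) : (H →L[ℂ] H) →L[ℂ] (rangeClosure V →L[ℂ] rangeClosure V) :=
  (ContinuousLinearMap.compL ℂ (rangeClosure V) H (rangeClosure V) (sqrtTo V)) ∘L
    (ContinuousLinearMap.compL ℂ (rangeClosure V) H H).flip (sqrtFrom V)

theorem adjoint_sqrt (V : H →L[ℂ] H) : ContinuousLinearMap.adjoint (CFC.sqrt V) = CFC.sqrt V :=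
  (CFC.sqrt_nonneg V).isSelfAdjoint

theorem inner_sqrt_left (V : H →L[ℂ] H) (x y : H) :
    ⟪CFC.sqrt V x, y⟫_ℂ = ⟪x, CFC.sqrt V y⟫_ℂ := by
  rw [← ContinuousLinearMap.adjoint_inner_left, adjoint_sqrt]

theorem inner_compress (V X : H →L[ℂ] H) (e e' : rangeClosure V) :
    ⟪e, compress V X e'⟫_ℂ = ⟪sqrtFrom V e, X (sqrtFrom V e')⟫_ℂ :=
  (inner_sqrt_left V e (X (sqrtFrom V e'))).symm

theorem compress_mul_compress (hV : 0 ≤ V) (X Y : H →L[ℂ] H) :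
    compress V X * compress V Y = compress V (X * V * Y) := by
  ext1 e
  exact congrArg (fun T : H →L[ℂ] H => sqrtTo V (X (T (Y (sqrtFrom V e)))))
    (CFC.sqrt_mul_sqrt_self V hV)

theorem IsDissipative.compress (hX : IsDissipative X) (V : H →L[ℂ] H) :
    IsDissipative (compress V X) := fun e => by
  rw [inner_compress]
  exact hX (sqrtFrom V e)

theorem IsDissipative.isUnit_one_sub_mul (hX : IsDissipative X) (hV : 0 ≤ V) :
    IsUnit (1 - X * V) := by
  have h : IsDissipative (CFC.sqrt V * (X * CFC.sqrt V)) := fun x => by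
    have := hX (CFC.sqrt V x)
    rwa [inner_sqrt_left] at this
  have h' := isUnit_one_sub_mul_comm h.isUnit_one_sub
  rwa [mul_assoc, CFC.sqrt_mul_sqrt_self V hV] at h'

theorem IsResolventAt.borderedResolvent_eq (hR : IsResolventAt A z R) (V : H →L[ℂ] H) :
    borderedResolvent A V z = compress V (Complex.I • R) := by
  rw [map_smul, borderedResolvent, hR.resolventOp_eq]
  rfl

theorem IsResolventAt.characteristicFunction_eq (hR : IsResolventAt A.adjoint z R)
    (V : H →L[ℂ] H) :
    characteristicFunction A V z = 1 + 2 • compress V (Complex.I • R) := by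
  rw [map_smul, ← ofNat_smul_eq_nsmul ℂ 2, smul_smul, characteristicFunction, hR.resolventOp_eq]
  rfl

theorem characteristicFunction_eq_cayleyTransform (hA : Dense (A.domain : Set H))
    (hR : IsResolventAt A z R) (hdiss : IsDissipative (Complex.I • R)) (hV : 0 ≤ V) :
    characteristicFunction (((-Complex.I) • (V : H →ₗ[ℂ] H)) +ᵥ A).adjoint V z =
      cayleyTransform (borderedResolvent A V z) := by
  have hunit : IsUnit (1 + R * ((-Complex.I) • V)) := by
    rw [mul_smul_comm, neg_smul, ← sub_eq_add_neg, ← smul_mul_assoc]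
    exact hdiss.isUnit_one_sub_mul hV
  have hRL := IsResolventAt.adjoint_adjoint
    (A := ((-Complex.I) • (V : H →ₗ[ℂ] H)) +ᵥ A) hA (hR.bounded_vadd ((-Complex.I) • V) hunit)
  generalize hY : Ring.inverse (1 + R * ((-Complex.I) • V)) * R = RL at hRL
  have resolvent_identity : RL = R + Complex.I • R * V * RL := by
    have h : (1 + R * ((-Complex.I) • V)) * RL = R := by
      rw [← hY, ← mul_assoc, Ring.mul_inverse_cancel _ hunit, one_mul]
    rw [mul_smul_comm, neg_smul, ← sub_eq_add_neg, sub_mul, one_mul, sub_eq_iff_eq_add,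
      ← smul_mul_assoc] at h
    exact h
  rw [hR.borderedResolvent_eq, hRL.characteristicFunction_eq]
  refine eq_cayleyTransform (hdiss.compress V).isUnit_one_sub ?_
  rw [compress_mul_compress hV, ← map_add, mul_smul_comm, ← smul_add, ← resolvent_identity]

end Compress

section CutPlane

theorem mem_cutPlane_iff {z : ℂ} : z ∈ cutPlane ↔ -Complex.I * z ∈ Complex.slitPlane := by
  change (z ≠ 0 ∧ z.arg ≠ -(Real.pi / 2)) ↔ _
  rw [Complex.mem_slitPlane_iff, Ne, Ne, Complex.arg_eq_neg_pi_div_two_iff]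
  simp only [Complex.ext_iff, Complex.zero_re, Complex.zero_im, neg_mul, Complex.neg_re,
    Complex.neg_im, Complex.I_mul_re, Complex.I_mul_im, neg_neg]
  grind

theorem mem_cutPlane_of_im_nonneg {z : ℂ} (hz : 0 ≤ z.im) (h0 : z ≠ 0) : z ∈ cutPlane := by
  refine ⟨h0, fun h => ?_⟩
  rw [Complex.arg_eq_neg_pi_div_two_iff] at h
  exact h.2.not_ge hz

theorem mem_cutPlane_of_im_pos {z : ℂ} (hz : 0 < z.im) : z ∈ cutPlane :=
  mem_cutPlane_of_im_nonneg hz.le fun h => by simp [h] at hz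

theorem nhdsWithin_cutPlane_le : 𝓝[cutPlane] (0 : ℂ) ≤ 𝓝[≠] 0 :=
  nhdsWithin_mono _ fun _ hz => hz.1

theorem nhdsWithin_upperHalf_le : 𝓝[{z : ℂ | 0 < z.im}] (0 : ℂ) ≤ 𝓝[cutPlane] 0 :=
  nhdsWithin_mono _ fun _ => mem_cutPlane_of_im_pos

instance nhdsWithin_upperHalf_neBot : NeBot (𝓝[{z : ℂ | 0 < z.im}] 0) := by
  rw [← mem_closure_iff_nhdsWithin_neBot, Complex.closure_setOfPred_lt_im]
  exact le_refl (0 : ℝ)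

instance nhdsWithin_cutPlane_neBot : NeBot (𝓝[cutPlane] (0 : ℂ)) :=
  nhdsWithin_upperHalf_neBot.mono nhdsWithin_upperHalf_le

theorem tendsto_I_mul_ofReal_nhdsGT_zero :
    Tendsto (fun δ : ℝ => Complex.I * δ) (𝓝[>] 0) (𝓝[cutPlane] 0) := by
  refine tendsto_nhdsWithin_iff.2 ⟨?_, ?_⟩
  · have h : Continuous fun δ : ℝ => Complex.I * δ := by fun_prop
    simpa using (h.tendsto 0).mono_left nhdsWithin_le_nhds
  · filter_upwards [self_mem_nhdsWithin] with δ hδ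
    exact mem_cutPlane_of_im_pos (by simpa using hδ)

end CutPlane

section LogEstimates

theorem norm_log_le (z : ℂ) : ‖Complex.log z‖ ≤ |Real.log ‖z‖| + Real.pi := by
  refine (Complex.norm_le_abs_re_add_abs_im _).trans ?_
  rw [Complex.log_re, Complex.log_im]
  gcongr
  exact Complex.abs_arg_le_pi z

theorem abs_log_norm_le (z : ℂ) : |Real.log ‖z‖| ≤ ‖Complex.log z‖ := by
  rw [← Complex.log_re]
  exact Complex.abs_re_le_norm _

theorem tendsto_mul_log_zero : Tendsto (fun z : ℂ => z * Complex.log z) (𝓝 0) (𝓝 0) := by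
  rw [tendsto_zero_iff_norm_tendsto_zero]
  have h_bound : Tendsto (fun z : ℂ => |‖z‖ * Real.log ‖z‖| + ‖z‖ * Real.pi) (𝓝 0) (𝓝 0) := by
    have h : Continuous fun z : ℂ => |‖z‖ * Real.log ‖z‖| + ‖z‖ * Real.pi :=
      (Real.continuous_mul_log.comp continuous_norm).abs.add (by fun_prop)
    simpa using h.tendsto 0
  refine squeeze_zero (fun _ => norm_nonneg _) (fun z => ?_) h_bound
  rw [norm_mul, abs_mul, abs_norm, ← mul_add]
  exact mul_le_mul_of_nonneg_left (norm_log_le z) (norm_nonneg z)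

theorem one_le_two_mul_norm_log {z : ℂ} (h0 : z ≠ 0) (hz : ‖z‖ ≤ 1 / 2) :
    1 ≤ 2 * ‖Complex.log z‖ := by
  have h : Real.log ‖z‖ ≤ Real.log (1 / 2) := Real.log_le_log (norm_pos_iff.2 h0) hz
  rw [one_div, Real.log_inv] at h
  linarith [neg_abs_le (Real.log ‖z‖), abs_log_norm_le z, Real.log_two_gt_d9]

theorem norm_log_neg_I_mul_le {z : ℂ} (h0 : z ≠ 0) (hz : ‖z‖ ≤ 1 / 2) :
    ‖Complex.log (-Complex.I * z)‖ ≤ 9 * ‖Complex.log z‖ := by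
  have h := norm_log_le (-Complex.I * z)
  rw [norm_mul, norm_neg, Complex.norm_I, one_mul] at h
  linarith [abs_log_norm_le z, one_le_two_mul_norm_log h0 hz, Real.pi_lt_four]

theorem analyticAt_log_neg_I_mul {z : ℂ} (hz : z ∈ cutPlane) :
    AnalyticAt ℂ (fun z => Complex.log (-Complex.I * z)) z :=
  AnalyticAt.clog (by fun_prop) (mem_cutPlane_iff.1 hz)

theorem log_neg_I_mul_eq {δ : ℝ} (hδ : 0 < δ) {z : ℂ} (hz : z ≠ 0) :
    Complex.log (-Complex.I * z) = Complex.log (-Complex.I * (Complex.I * δ)) - alpha δ z := by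
  have hδ' : (δ : ℂ) ≠ 0 := by exact_mod_cast hδ.ne'
  have h_rotate : -Complex.I * (Complex.I * δ) = (δ : ℂ) := by
    rw [← mul_assoc, neg_mul, Complex.I_mul_I, neg_neg, one_mul]
  have h_scale : -Complex.I * z = (δ : ℂ) * (-(Complex.I * z) / δ) := by field_simp
  have h_ne : -(Complex.I * z) / δ ≠ 0 :=
    div_ne_zero (neg_ne_zero.2 (mul_ne_zero Complex.I_ne_zero hz)) hδ'
  rw [h_rotate, alpha, sub_neg_eq_add, h_scale, Complex.log_ofReal_mul hδ h_ne,
    Complex.ofReal_log hδ.le]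

theorem tendsto_alpha {δ : ℝ} (hδ : 0 < δ) :
    Tendsto (alpha δ) (𝓝[≠] 0) (Bornology.cobounded ℂ) := by
  rw [← tendsto_norm_atTop_iff_cobounded]
  have h : Tendsto (fun z : ℂ => ‖z‖ / δ) (𝓝[≠] 0) (𝓝[≠] 0) := by
    refine tendsto_nhdsWithin_iff.2 ⟨?_, ?_⟩
    · have h : Continuous fun z : ℂ => ‖z‖ / δ := by fun_prop
      simpa using (h.tendsto 0).mono_left nhdsWithin_le_nhds
    · filter_upwards [self_mem_nhdsWithin] with z hz
      exact div_ne_zero (norm_ne_zero_iff.2 hz) hδ.ne'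
  refine tendsto_atTop_mono (fun z => ?_)
    (tendsto_abs_atBot_atTop.comp (Real.tendsto_log_nhdsNE_zero.comp h))
  have h_norm : ‖-(Complex.I * z) / δ‖ = ‖z‖ / δ := by
    rw [norm_div, norm_neg, norm_mul, Complex.norm_I, one_mul, Complex.norm_real,
      Real.norm_of_nonneg hδ.le]
  rw [alpha, norm_neg, Function.comp_apply, Function.comp_apply, ← h_norm]
  exact abs_log_norm_le _

end LogEstimates

section LogRemainder
variable {W : Type*} [NormedAddCommGroup W] [NormedSpace ℂ W]

/-- The sum `∑_{m ≤ M} z ^ m ln(-iz) A m + F z`, without the terms `ln(-iz) A 0` and `F 0` which do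
not vanish at the origin. -/
def logRemainder (M : ℕ) (A : ℕ → W) (F : ℂ → W) (z : ℂ) : W :=
  ∑ m ∈ Finset.range M, (z ^ (m + 1) * Complex.log (-Complex.I * z)) • A (m + 1) + (F z - F 0)

theorem sum_log_smul_eq (M : ℕ) (A : ℕ → W) (F : ℂ → W) (z : ℂ) :
    ∑ m ∈ Finset.range (M + 1), (z ^ m * Complex.log (-Complex.I * z)) • A m + F z =
      Complex.log (-Complex.I * z) • A 0 + F 0 + logRemainder M A F z := by
  rw [Finset.sum_range_succ', logRemainder, pow_zero, one_mul]
  abel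

variable [CompleteSpace W]

theorem analyticOnNhd_logRemainder (M : ℕ) (A : ℕ → W) {F : ℂ → W}
    (hF : Differentiable ℂ F) : AnalyticOnNhd ℂ (logRemainder M A F) cutPlane := fun z hz =>
  (Finset.analyticAt_fun_sum _ fun m _ => ((by fun_prop : AnalyticAt ℂ (fun z => z ^ (m + 1)) z).mul
    (analyticAt_log_neg_I_mul hz)).smul analyticAt_const).add
      ((hF.analyticAt z).sub analyticAt_const)

theorem exists_norm_sub_le_mul_norm_sub {F : ℂ → W} (hF : Differentiable ℂ F) (c : ℂ) (r : ℝ) :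
    ∃ C, 0 ≤ C ∧ ∀ z ∈ Metric.closedBall c r, ‖F z - F c‖ ≤ C * ‖z - c‖ := by
  have h_slope : DifferentiableOn ℂ (dslope F c) univ :=
    (Complex.differentiableOn_dslope univ_mem).2 hF.differentiableOn
  obtain ⟨C, hC⟩ := (isCompact_closedBall c r).exists_bound_of_continuousOn
    (h_slope.continuousOn.mono (subset_univ _))
  refine ⟨max C 0, le_max_right _ _, fun z hz => ?_⟩
  rw [← sub_smul_dslope, norm_smul, mul_comm]
  gcongr
  exact (hC z hz).trans (le_max_left _ _)

theorem exists_norm_logRemainder_le (M : ℕ) (A : ℕ → W) {F : ℂ → W} (hF : Differentiable ℂ F) :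
    ∃ C : ℝ, ∀ z ∈ cutPlane, ‖z‖ ≤ 1 / 2 → ‖logRemainder M A F z‖ ≤ C * ‖z * Complex.log z‖ := by
  obtain ⟨K, hK0, hK⟩ := exists_norm_sub_le_mul_norm_sub hF 0 (1 / 2)
  refine ⟨∑ m ∈ Finset.range M, 9 * ‖A (m + 1)‖ + 2 * K, fun z hz hz2 => ?_⟩
  rw [norm_mul, add_mul, Finset.sum_mul]
  refine (norm_add_le _ _).trans (add_le_add ((norm_sum_le _ _).trans
    (Finset.sum_le_sum fun m _ => ?_)) ?_)
  · have h_pow : ‖z‖ ^ m ≤ 1 := pow_le_one₀ (norm_nonneg _) (by linarith)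
    rw [norm_smul, norm_mul, norm_pow, pow_succ]
    calc ‖z‖ ^ m * ‖z‖ * ‖Complex.log (-Complex.I * z)‖ * ‖A (m + 1)‖
        ≤ 1 * ‖z‖ * (9 * ‖Complex.log z‖) * ‖A (m + 1)‖ := by
          gcongr; exact norm_log_neg_I_mul_le hz.1 hz2
      _ = 9 * ‖A (m + 1)‖ * (‖z‖ * ‖Complex.log z‖) := by ring
  · calc ‖F z - F 0‖ ≤ K * ‖z‖ * 1 := by
          simpa using hK z (mem_closedBall_zero_iff.2 hz2)
      _ ≤ K * ‖z‖ * (2 * ‖Complex.log z‖) := by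
          gcongr; exact one_le_two_mul_norm_log hz.1 hz2
      _ = 2 * K * (‖z‖ * ‖Complex.log z‖) := by ring

end LogRemainder

section ShermanMorrison
variable {k R : Type*} [Field k] [Ring R] [Algebra k R]

theorem one_add_smul_mul_one_sub_smul {N : R} {θ a : k} (hN : N * N = θ • N)
    (ha : 1 + a * θ ≠ 0) :
    (1 + a • N) * (1 - (a / (1 + a * θ)) • N) = 1 := by
  generalize hb : a / (1 + a * θ) = b
  have hab : a - b - a * b * θ = 0 := by
    rw [← hb]; field_simp; ring
  calc (1 + a • N) * (1 - b • N) = 1 + (a - b - a * b * θ) • N := by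
        rw [add_mul, one_mul, mul_sub, mul_one, smul_mul_smul_comm, hN]; module
    _ = 1 := by rw [hab, zero_smul, add_zero]

theorem isUnit_and_inverse_add_smul {D P : R} {θ a : k} (hD : IsUnit D)
    (hP : P * Ring.inverse D * P = θ • P) (ha : 1 + a * θ ≠ 0) :
    IsUnit (D + a • P) ∧ Ring.inverse (D + a • P) =
      Ring.inverse D - (a / (1 + a * θ)) • (Ring.inverse D * P * Ring.inverse D) := by
  have hN : Ring.inverse D * P * (Ring.inverse D * P) = θ • (Ring.inverse D * P) := by
    rw [mul_assoc, ← mul_assoc P, hP, mul_smul_comm]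
  have h_right := one_add_smul_mul_one_sub_smul hN ha
  have h_left : (1 - (a / (1 + a * θ)) • (Ring.inverse D * P)) *
      (1 + a • (Ring.inverse D * P)) = 1 := by
    have h_comm : Commute (Ring.inverse D * P) (1 + a • (Ring.inverse D * P)) :=
      (Commute.one_right _).add_right ((Commute.refl _).smul_right a)
    exact ((Commute.one_left _).sub_left (h_comm.smul_left (a / (1 + a * θ)))).eq.trans h_right
  have h_factor : D + a • P = D * (1 + a • (Ring.inverse D * P)) := by
    rw [mul_add, mul_one, mul_smul_comm, Ring.mul_inverse_cancel_left _ _ hD]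
  let U : Rˣ := ⟨_, _, h_right, h_left⟩
  have hU : Ring.inverse (1 + a • (Ring.inverse D * P)) = _ := Ring.inverse_unit U
  refine ⟨h_factor ▸ hD.mul U.isUnit, ?_⟩
  rw [h_factor, Ring.inverse_mul (Or.inl hD), hU]
  change (1 - (a / (1 + a * θ)) • (Ring.inverse D * P)) * Ring.inverse D = _
  rw [sub_mul, one_mul, smul_mul_assoc]

end ShermanMorrison

section Perturbation

theorem sub_eq_mul_one_sub_inverse_mul {R : Type*} [Ring R] {x θ : R} (hx : IsUnit x) :
    x - θ = x * (1 - Ring.inverse x * θ) := by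
  rw [mul_sub, mul_one, Ring.mul_inverse_cancel_left _ _ hx]

variable {𝔸 : Type*} [NormedRing 𝔸] {ι : Type*} {l : Filter ι} {X Θ : ι → 𝔸}

theorem tendsto_one_sub_inverse_mul (hX : (fun z => Ring.inverse (X z)) =O[l] fun _ => (1 : ℝ))
    (hΘ : Tendsto Θ l (𝓝 0)) : Tendsto (fun z => 1 - Ring.inverse (X z) * Θ z) l (𝓝 1) := by
  have h : Tendsto (fun z => Ring.inverse (X z) * Θ z) l (𝓝 0) :=
    (hX.mul (Asymptotics.isBigO_refl Θ l).norm_right).trans_tendsto (by simpa using hΘ.norm)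
  simpa using h.const_sub 1

variable [HasSummableGeomSeries 𝔸]

theorem eventually_isUnit_sub (hX : ∀ᶠ z in l, IsUnit (X z))
    (hX' : (fun z => Ring.inverse (X z)) =O[l] fun _ => (1 : ℝ)) (hΘ : Tendsto Θ l (𝓝 0)) :
    ∀ᶠ z in l, IsUnit (X z - Θ z) := by
  filter_upwards [hX, (tendsto_one_sub_inverse_mul hX' hΘ).eventually
    (Units.isOpen.mem_nhds isUnit_one)] with z hz hu
  rw [sub_eq_mul_one_sub_inverse_mul hz]
  exact hz.mul hu

theorem isBigO_inverse_sub_sub_inverse (hX : ∀ᶠ z in l, IsUnit (X z))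
    (hX' : (fun z => Ring.inverse (X z)) =O[l] fun _ => (1 : ℝ)) (hΘ : Tendsto Θ l (𝓝 0)) :
    (fun z => Ring.inverse (X z - Θ z) - Ring.inverse (X z)) =O[l] Θ := by
  have h_inv : (fun z => Ring.inverse (X z - Θ z)) =O[l] fun _ => (1 : ℝ) := by
    have h := (NormedRing.inverse_continuousAt (1 : 𝔸ˣ)).tendsto.comp
      (tendsto_one_sub_inverse_mul hX' hΘ)
    refine (((h.isBigO_one ℝ).mul hX').congr_right fun _ => one_mul 1).congr' ?_ .rfl
    filter_upwards [hX] with z hz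
    rw [sub_eq_mul_one_sub_inverse_mul hz, Ring.inverse_mul (Or.inl hz)]
    rfl
  have h_diff : (fun z => Ring.inverse (X z - Θ z) * Θ z * Ring.inverse (X z)) =ᶠ[l]
      fun z => Ring.inverse (X z - Θ z) - Ring.inverse (X z) := by
    filter_upwards [hX, eventually_isUnit_sub hX hX' hΘ] with z h_unit h_unit_sub
    rw [Ring.inverse_sub_inverse (iff_of_true h_unit_sub h_unit), sub_sub_cancel]
  refine EventuallyEq.trans_isBigO h_diff.symm ?_
  simpa using (h_inv.mul (Asymptotics.isBigO_refl Θ l).norm_right).mul hX'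

end Perturbation

section LogLeading
variable {W : Type*} [NormedAddCommGroup W] [InnerProductSpace ℂ W] {ℓ : W} {B : W →L[ℂ] W} {δ : ℝ}

/-- The operator function `ln(-iz) ⟨·, ℓ⟩ ℓ + B`, which is the leading part at the origin of an
operator function with a rank one logarithmic singularity. -/
def logLeading (ℓ : W) (B : W →L[ℂ] W) (z : ℂ) : W →L[ℂ] W :=
  Complex.log (-Complex.I * z) • InnerProductSpace.rankOne ℂ ℓ ℓ + B

/-- The inverse of `I - Q̃(iδ)` for `Q̃ = logLeading ℓ B` (with the value `0` when `I - Q̃(iδ)` is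
not invertible); this is `Medium.qInv` for general `ℓ` and `B`. -/
def leadingInverse (ℓ : W) (B : W →L[ℂ] W) (δ : ℝ) : W →L[ℂ] W :=
  Ring.inverse (1 - logLeading ℓ B (Complex.I * δ))

/-- The number `⟨(I - Q̃(iδ))⁻¹ ℓ, ℓ⟩` for `Q̃ = logLeading ℓ B`, the product being linear in its
first argument; this is `Medium.theta` for general `ℓ` and `B`. -/
def leadingTheta (ℓ : W) (B : W →L[ℂ] W) (δ : ℝ) : ℂ := ⟪ℓ, leadingInverse ℓ B δ ℓ⟫_ℂ

/-- The rank one operator `⟨·, (I - Q̃*(iδ))⁻¹ ℓ⟩ (I - Q̃(iδ))⁻¹ ℓ` for `Q̃ = logLeading ℓ B`,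
written as a product with `⟨·, ℓ⟩ ℓ`; this is `Medium.rankOneTerm` for general `ℓ` and `B`. -/
def leadingRankOne (ℓ : W) (B : W →L[ℂ] W) (δ : ℝ) : W →L[ℂ] W :=
  leadingInverse ℓ B δ * InnerProductSpace.rankOne ℂ ℓ ℓ * leadingInverse ℓ B δ

/-- The limit at the origin of the Cayley transform of `logLeading ℓ B`; in spite of its definition
it does not depend on `δ`. -/
def cayleyLimit (ℓ : W) (B : W →L[ℂ] W) (δ : ℝ) : W →L[ℂ] W :=
  cayleyTransform (logLeading ℓ B (Complex.I * δ)) -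
    (2 / leadingTheta ℓ B δ) • leadingRankOne ℓ B δ

theorem inner_logLeading (ℓ : W) (B : W →L[ℂ] W) (z : ℂ) (u : W) :
    ⟪u, logLeading ℓ B z u⟫_ℂ =
      Complex.log (-Complex.I * z) * (⟪ℓ, u⟫_ℂ * ⟪u, ℓ⟫_ℂ) + ⟪u, B u⟫_ℂ := by
  simp only [logLeading, _root_.add_apply, _root_.smul_apply, InnerProductSpace.rankOne_apply,
    inner_add_right, inner_smul_right]

theorem one_sub_logLeading (ℓ : W) (B : W →L[ℂ] W) (hδ : 0 < δ) {z : ℂ} (hz : z ≠ 0) :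
    1 - logLeading ℓ B z = 1 - logLeading ℓ B (Complex.I * δ) +
      alpha δ z • InnerProductSpace.rankOne ℂ ℓ ℓ := by
  rw [logLeading, logLeading, log_neg_I_mul_eq hδ hz]
  module

theorem analyticOnNhd_logLeading (ℓ : W) (B : W →L[ℂ] W) :
    AnalyticOnNhd ℂ (logLeading ℓ B) cutPlane := fun _ hz =>
  ((analyticAt_log_neg_I_mul hz).smul analyticAt_const).add analyticAt_const

theorem rankOne_mul_leadingInverse_mul_rankOne (ℓ : W) (B : W →L[ℂ] W) (δ : ℝ) :
    InnerProductSpace.rankOne ℂ ℓ ℓ * leadingInverse ℓ B δ * InnerProductSpace.rankOne ℂ ℓ ℓ =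
      leadingTheta ℓ B δ • InnerProductSpace.rankOne ℂ ℓ ℓ := by
  rw [mul_assoc, ContinuousLinearMap.mul_def (leadingInverse ℓ B δ),
    InnerProductSpace.comp_rankOne]
  exact InnerProductSpace.rankOne_comp_rankOne ..

theorem leadingRankOne_eq [CompleteSpace W] (ℓ : W) (B : W →L[ℂ] W) (δ : ℝ) :
    leadingRankOne ℓ B δ = InnerProductSpace.rankOne ℂ (leadingInverse ℓ B δ ℓ)
      (Ring.inverse (1 - ContinuousLinearMap.adjoint (logLeading ℓ B (Complex.I * δ))) ℓ) := by
  have h_adj : Ring.inverse (1 - ContinuousLinearMap.adjoint (logLeading ℓ B (Complex.I * δ))) =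
      ContinuousLinearMap.adjoint (leadingInverse ℓ B δ) := by
    simp only [← ContinuousLinearMap.star_eq_adjoint, leadingInverse, ← Ring.inverse_star,
      star_sub, star_one]
  rw [h_adj, leadingRankOne, ContinuousLinearMap.mul_def, ContinuousLinearMap.mul_def,
    InnerProductSpace.comp_rankOne, InnerProductSpace.rankOne_comp]

theorem isUnit_and_cayleyTransform_logLeading (hδ : 0 < δ)
    (hu : IsUnit (1 - logLeading ℓ B (Complex.I * δ))) (hθ : leadingTheta ℓ B δ ≠ 0) {z : ℂ}
    (hz : z ≠ 0) (hα : 1 + alpha δ z * leadingTheta ℓ B δ ≠ 0) :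
    IsUnit (1 - logLeading ℓ B z) ∧ cayleyTransform (logLeading ℓ B z) = cayleyLimit ℓ B δ +
      (2 / (leadingTheta ℓ B δ * (1 + alpha δ z * leadingTheta ℓ B δ))) •
        leadingRankOne ℓ B δ := by
  have h := isUnit_and_inverse_add_smul hu (rankOne_mul_leadingInverse_mul_rankOne ℓ B δ) hα
  rw [← one_sub_logLeading ℓ B hδ hz] at h
  refine ⟨h.1, ?_⟩
  have h_coeff : 2 * (alpha δ z / (1 + alpha δ z * leadingTheta ℓ B δ)) = 2 / leadingTheta ℓ B δ -
      2 / (leadingTheta ℓ B δ * (1 + alpha δ z * leadingTheta ℓ B δ)) := by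
    field_simp; ring
  rw [cayleyLimit, cayleyTransform_eq_two_nsmul_inverse_sub_one h.1,
    cayleyTransform_eq_two_nsmul_inverse_sub_one hu, h.2, smul_sub,
    ← ofNat_smul_eq_nsmul ℂ 2 (_ • _), smul_smul, h_coeff, leadingRankOne, leadingInverse]
  module

theorem tendsto_one_add_alpha_mul (hδ : 0 < δ) {θ : ℂ} (hθ : θ ≠ 0) :
    Tendsto (fun z => 1 + alpha δ z * θ) (𝓝[≠] 0) (Bornology.cobounded ℂ) :=
  (tendsto_const_add_cobounded 1).comp
    ((tendsto_mul_right_cobounded hθ).comp (tendsto_alpha hδ))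

theorem eventually_isUnit_and_cayleyTransform_logLeading (hδ : 0 < δ)
    (hu : IsUnit (1 - logLeading ℓ B (Complex.I * δ))) (hθ : leadingTheta ℓ B δ ≠ 0) :
    ∀ᶠ z in 𝓝[≠] 0, IsUnit (1 - logLeading ℓ B z) ∧
      cayleyTransform (logLeading ℓ B z) = cayleyLimit ℓ B δ +
        (2 / (leadingTheta ℓ B δ * (1 + alpha δ z * leadingTheta ℓ B δ))) •
          leadingRankOne ℓ B δ := by
  filter_upwards [self_mem_nhdsWithin,
    (tendsto_one_add_alpha_mul hδ hθ).eventually_ne_cobounded 0] with z hz hα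
  exact isUnit_and_cayleyTransform_logLeading hδ hu hθ hz hα

theorem tendsto_cayleyTransform_logLeading (hδ : 0 < δ)
    (hu : IsUnit (1 - logLeading ℓ B (Complex.I * δ))) (hθ : leadingTheta ℓ B δ ≠ 0) :
    Tendsto (fun z => cayleyTransform (logLeading ℓ B z)) (𝓝[≠] 0) (𝓝 (cayleyLimit ℓ B δ)) := by
  have h_coeff : Tendsto (fun z => 2 / (leadingTheta ℓ B δ * (1 + alpha δ z * leadingTheta ℓ B δ)))
      (𝓝[≠] 0) (𝓝 0) := by
    have h := (tendsto_inv₀_cobounded.comp (tendsto_one_add_alpha_mul hδ hθ)).const_mul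
      (2 / leadingTheta ℓ B δ)
    rw [mul_zero] at h
    exact h.congr fun z => by rw [Function.comp_apply, ← div_eq_mul_inv, div_div]
  have h := (h_coeff.smul_const (leadingRankOne ℓ B δ)).const_add (cayleyLimit ℓ B δ)
  rw [zero_smul, add_zero] at h
  refine h.congr' ?_
  filter_upwards [eventually_isUnit_and_cayleyTransform_logLeading hδ hu hθ] with z hz
  exact hz.2.symm

theorem isBigO_inverse_one_sub_logLeading (hδ : 0 < δ)
    (hu : IsUnit (1 - logLeading ℓ B (Complex.I * δ))) (hθ : leadingTheta ℓ B δ ≠ 0) :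
    (fun z => Ring.inverse (1 - logLeading ℓ B z)) =O[𝓝[≠] 0] fun _ => (1 : ℝ) := by
  have h_bdd := ((tendsto_cayleyTransform_logLeading hδ hu hθ).add_const 1).isBigO_one ℝ
  refine (Asymptotics.isBigO_const_smul_left (two_ne_zero (α := ℂ))).1 (h_bdd.congr' ?_ .rfl)
  filter_upwards [eventually_isUnit_and_cayleyTransform_logLeading hδ hu hθ] with z hz
  rw [cayleyTransform_eq_two_nsmul_inverse_sub_one hz.1, sub_add_cancel,
    ofNat_smul_eq_nsmul ℂ 2]

end LogLeading

section LogDissipative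
variable {W : Type*} [NormedAddCommGroup W] [InnerProductSpace ℂ W] {ℓ : W} {B : W →L[ℂ] W}
  {Θ : ℂ → W →L[ℂ] W} {δ : ℝ}

/-- The function `ln(-iz) ⟨·, ℓ⟩ ℓ + B + Θ(z)` has a genuine logarithmic singularity at the origin,
with a remainder `Θ` of the size `O(z ln z)` in the cut plane, and its values in the upper
half-plane are dissipative. -/
structure IsLogDissipative (ℓ : W) (B : W →L[ℂ] W) (Θ : ℂ → W →L[ℂ] W) : Prop where
  ne_zero : ℓ ≠ 0
  analyticOnNhd : AnalyticOnNhd ℂ Θ cutPlane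
  norm_le : ∃ C : ℝ, ∀ z ∈ cutPlane, ‖z‖ ≤ 1 / 2 → ‖Θ z‖ ≤ C * ‖z * Complex.log z‖
  dissipative : ∀ z : ℂ, 0 < z.im → IsDissipative (logLeading ℓ B z + Θ z)

/-- The continuation to the cut plane and to the origin of the Cayley transform of
`ln(-iz) ⟨·, ℓ⟩ ℓ + B + Θ(z)`. The value at the origin is the limit there. -/
def cayleyExtension (ℓ : W) (B : W →L[ℂ] W) (Θ : ℂ → W →L[ℂ] W) : ℂ → W →L[ℂ] W :=
  Function.update (fun z => cayleyTransform (logLeading ℓ B z + Θ z)) 0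
    (limUnder (𝓝[cutPlane] 0) fun z => cayleyTransform (logLeading ℓ B z + Θ z))

theorem isBigO_mul_log_of_norm_le
    (hΘ : ∃ C : ℝ, ∀ z ∈ cutPlane, ‖z‖ ≤ 1 / 2 → ‖Θ z‖ ≤ C * ‖z * Complex.log z‖) :
    Θ =O[𝓝[cutPlane] 0] fun z => z * Complex.log z := by
  obtain ⟨C, hC⟩ := hΘ
  refine Asymptotics.IsBigO.of_bound C ?_
  filter_upwards [self_mem_nhdsWithin, mem_nhdsWithin_of_mem_nhds
    (Metric.closedBall_mem_nhds (0 : ℂ) one_half_pos)] with z hz hz2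
  exact hC z hz (mem_closedBall_zero_iff.1 hz2)

theorem tendsto_zero_of_norm_le
    (hΘ : ∃ C : ℝ, ∀ z ∈ cutPlane, ‖z‖ ≤ 1 / 2 → ‖Θ z‖ ≤ C * ‖z * Complex.log z‖) :
    Tendsto Θ (𝓝[cutPlane] 0) (𝓝 0) :=
  (isBigO_mul_log_of_norm_le hΘ).trans_tendsto (tendsto_mul_log_zero.mono_left nhdsWithin_le_nhds)

theorem cayleyExtension_of_ne_zero {z : ℂ} (hz : z ≠ 0) :
    cayleyExtension ℓ B Θ z = cayleyTransform (logLeading ℓ B z + Θ z) :=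
  Function.update_of_ne hz ..

namespace IsLogDissipative

theorem dissipative_of_im_nonneg (h : IsLogDissipative ℓ B Θ) {z : ℂ} (hz : 0 ≤ z.im)
    (h0 : z ≠ 0) : IsDissipative (logLeading ℓ B z + Θ z) := by
  have hc : z ∈ cutPlane := mem_cutPlane_of_im_nonneg hz h0
  have h_cont : ContinuousAt (fun z => logLeading ℓ B z + Θ z) z :=
    ((analyticOnNhd_logLeading ℓ B z hc).add (h.analyticOnNhd z hc)).continuousAt
  have h_closure : z ∈ closure {z : ℂ | 0 < z.im} := by
    rwa [Complex.closure_setOfPred_lt_im]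
  have := mem_closure_iff_nhdsWithin_neBot.1 h_closure
  exact isClosed_isDissipative.mem_of_tendsto (b := 𝓝[{z : ℂ | 0 < z.im}] z)
    (h_cont.tendsto.mono_left nhdsWithin_le_nhds) (eventually_nhdsWithin_of_forall h.dissipative)

/-- The logarithm only acts along `ℓ`, so it drops out of the quadratic form on the orthogonal
complement of `ℓ`, and the limit `z → 0` can be taken there. -/
theorem re_inner_nonpos_of_inner_eq_zero (h : IsLogDissipative ℓ B Θ) {u : W}
    (hu : ⟪ℓ, u⟫_ℂ = 0) : (⟪u, B u⟫_ℂ).re ≤ 0 := by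
  have h_lim : Tendsto (fun z => B + Θ z) (𝓝[{z : ℂ | 0 < z.im}] 0) (𝓝 B) := by
    simpa using ((tendsto_zero_of_norm_le h.norm_le).mono_left nhdsWithin_upperHalf_le).const_add B
  refine le_of_tendsto (((continuous_re_inner_apply u).tendsto B).comp h_lim) ?_
  filter_upwards [self_mem_nhdsWithin] with z hz
  have h_re := h.dissipative z hz u
  rwa [_root_.add_apply, inner_add_right, inner_logLeading, hu, zero_mul, mul_zero, zero_add,
    ← inner_add_right] at h_re

theorem leadingTheta_ne_zero (h : IsLogDissipative ℓ B Θ)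
    (hu : IsUnit (1 - logLeading ℓ B (Complex.I * δ))) : leadingTheta ℓ B δ ≠ 0 := by
  intro hθ
  have hD : (1 - logLeading ℓ B (Complex.I * δ)) (leadingInverse ℓ B δ ℓ) = ℓ :=
    congrArg (fun T : W →L[ℂ] W => T ℓ) (Ring.mul_inverse_cancel _ hu)
  change ⟪ℓ, leadingInverse ℓ B δ ℓ⟫_ℂ = 0 at hθ
  generalize leadingInverse ℓ B δ ℓ = u at hD hθ
  have h_inner : ⟪u, u⟫_ℂ = ⟪u, B u⟫_ℂ := by
    have h_orth : ⟪u, (1 - logLeading ℓ B (Complex.I * δ)) u⟫_ℂ = 0 := by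
      rw [hD, inner_eq_zero_symm, hθ]
    rwa [_root_.sub_apply, one_apply_eq_self, inner_sub_right, inner_logLeading, hθ, zero_mul,
      mul_zero, zero_add, sub_eq_zero] at h_orth
  have h_re := h.re_inner_nonpos_of_inner_eq_zero hθ
  rw [← h_inner] at h_re
  have hu0 : u = 0 := (re_inner_self_nonpos (𝕜 := ℂ)).1 h_re
  exact h.ne_zero (by rw [← hD, hu0, map_zero])

variable [CompleteSpace W]

theorem exists_isUnit (h : IsLogDissipative ℓ B Θ) :
    ∃ δ : ℝ, 0 < δ ∧ IsUnit (1 - logLeading ℓ B (Complex.I * δ)) := by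
  have h_small : ∀ᶠ δ : ℝ in 𝓝[>] 0, ‖Θ (Complex.I * δ)‖ < 1 :=
    ((tendsto_zero_of_norm_le h.norm_le).comp tendsto_I_mul_ofReal_nhdsGT_zero).norm
      |>.eventually_lt_const (by simp)
  obtain ⟨δ, hΘ, hδ⟩ := (h_small.and self_mem_nhdsWithin).exists
  exact ⟨δ, hδ, (h.dissipative _ (by simpa using hδ)).isUnit_one_sub_of_add hΘ⟩

theorem eventually_isUnit (h : IsLogDissipative ℓ B Θ) :
    ∀ᶠ z in 𝓝[cutPlane] 0, IsUnit (1 - (logLeading ℓ B z + Θ z)) := by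
  obtain ⟨δ, hδ, hu⟩ := h.exists_isUnit
  have hθ := h.leadingTheta_ne_zero hu
  simp only [← sub_sub]
  exact eventually_isUnit_sub
    (((eventually_isUnit_and_cayleyTransform_logLeading hδ hu hθ).filter_mono
      nhdsWithin_cutPlane_le).mono fun _ hz => hz.1)
    ((isBigO_inverse_one_sub_logLeading hδ hu hθ).mono nhdsWithin_cutPlane_le)
    (tendsto_zero_of_norm_le h.norm_le)

theorem isBigO_cayleyTransform_sub (h : IsLogDissipative ℓ B Θ) (hδ : 0 < δ)
    (hu : IsUnit (1 - logLeading ℓ B (Complex.I * δ))) :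
    (fun z => cayleyTransform (logLeading ℓ B z + Θ z) - cayleyTransform (logLeading ℓ B z))
      =O[𝓝[cutPlane] 0] Θ := by
  have hθ := h.leadingTheta_ne_zero hu
  have h_unit := ((eventually_isUnit_and_cayleyTransform_logLeading hδ hu hθ).filter_mono
    nhdsWithin_cutPlane_le).mono fun _ hz => hz.1
  refine EventuallyEq.trans_isBigO ?_ ((isBigO_inverse_sub_sub_inverse h_unit
    ((isBigO_inverse_one_sub_logLeading hδ hu hθ).mono nhdsWithin_cutPlane_le)
    (tendsto_zero_of_norm_le h.norm_le)).const_smul_left (2 : ℂ))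
  filter_upwards [h_unit, h.eventually_isUnit] with z hz_leading hz_full
  rw [cayleyTransform_eq_two_nsmul_inverse_sub_one hz_leading,
    cayleyTransform_eq_two_nsmul_inverse_sub_one hz_full, sub_sub_sub_cancel_right, ← smul_sub,
    Pi.smul_apply, ofNat_smul_eq_nsmul ℂ 2, sub_sub]

theorem tendsto_cayleyTransform (h : IsLogDissipative ℓ B Θ) (hδ : 0 < δ)
    (hu : IsUnit (1 - logLeading ℓ B (Complex.I * δ))) :
    Tendsto (fun z => cayleyTransform (logLeading ℓ B z + Θ z)) (𝓝[cutPlane] 0)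
      (𝓝 (cayleyLimit ℓ B δ)) := by
  have h_diff := (h.isBigO_cayleyTransform_sub hδ hu).trans_tendsto
    (tendsto_zero_of_norm_le h.norm_le)
  simpa using h_diff.add ((tendsto_cayleyTransform_logLeading hδ hu
    (h.leadingTheta_ne_zero hu)).mono_left nhdsWithin_cutPlane_le)

theorem cayleyExtension_zero (h : IsLogDissipative ℓ B Θ) (hδ : 0 < δ)
    (hu : IsUnit (1 - logLeading ℓ B (Complex.I * δ))) :
    cayleyExtension ℓ B Θ 0 = cayleyLimit ℓ B δ := by
  rw [cayleyExtension, Function.update_self, (h.tendsto_cayleyTransform hδ hu).limUnder_eq]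

theorem analyticAt_cayleyExtension (h : IsLogDissipative ℓ B Θ) {z : ℂ} (hz : z ∈ cutPlane)
    (hu : IsUnit (1 - (logLeading ℓ B z + Θ z))) : AnalyticAt ℂ (cayleyExtension ℓ B Θ) z := by
  have h_sum : AnalyticAt ℂ (fun z => logLeading ℓ B z + Θ z) z :=
    (analyticOnNhd_logLeading ℓ B z hz).add (h.analyticOnNhd z hz)
  have h_inv : AnalyticAt ℂ (fun z => Ring.inverse (1 - (logLeading ℓ B z + Θ z))) z :=
    AnalyticAt.fun_comp (g := Ring.inverse) (hu.unit_spec ▸ analyticAt_inverse hu.unit)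
      (analyticAt_const.sub h_sum)
  have h_cayley : AnalyticAt ℂ (fun z => cayleyTransform (logLeading ℓ B z + Θ z)) z :=
    (analyticAt_const.add h_sum).mul h_inv
  refine h_cayley.congr ?_
  filter_upwards [isOpen_ne.mem_nhds hz.1] with w hw
  exact (cayleyExtension_of_ne_zero hw).symm

theorem analyticAt_cayleyExtension_of_im_nonneg (h : IsLogDissipative ℓ B Θ) {z : ℂ}
    (hz : 0 ≤ z.im) (h0 : z ≠ 0) : AnalyticAt ℂ (cayleyExtension ℓ B Θ) z :=
  h.analyticAt_cayleyExtension (mem_cutPlane_of_im_nonneg hz h0)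
    (h.dissipative_of_im_nonneg hz h0).isUnit_one_sub

theorem exists_analyticOnNhd_cayleyExtension (h : IsLogDissipative ℓ B Θ) :
    ∃ δ₀ : ℝ, 0 < δ₀ ∧ AnalyticOnNhd ℂ (cayleyExtension ℓ B Θ)
      ({z | 0 < z.im} ∪ {z | z.im = 0 ∧ z ≠ 0} ∪ slitDisc δ₀) := by
  obtain ⟨ε, hε, hunit⟩ := Metric.mem_nhdsWithin_iff.1 h.eventually_isUnit
  refine ⟨ε / 2, half_pos hε, ?_⟩
  rintro z ((hz | hz) | hz)
  · exact h.analyticAt_cayleyExtension_of_im_nonneg (le_of_lt hz) (mem_cutPlane_of_im_pos hz).1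
  · exact h.analyticAt_cayleyExtension_of_im_nonneg hz.1.ge hz.2
  · have hzε : z ∈ Metric.ball 0 ε := mem_ball_zero_iff.2 (hz.2.trans_lt (half_lt_self hε))
    exact h.analyticAt_cayleyExtension hz.1 (hunit ⟨hzε, hz.1⟩)

theorem continuousOn_cayleyExtension (h : IsLogDissipative ℓ B Θ) :
    ContinuousOn (cayleyExtension ℓ B Θ) {z | 0 ≤ z.im} := by
  intro z hz
  rcases eq_or_ne z 0 with rfl | h0
  · obtain ⟨δ, hδ, hu⟩ := h.exists_isUnit
    rw [cayleyExtension, continuousWithinAt_update_same,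
      (h.tendsto_cayleyTransform hδ hu).limUnder_eq]
    exact (h.tendsto_cayleyTransform hδ hu).mono_left
      (nhdsWithin_mono _ fun w hw => mem_cutPlane_of_im_nonneg hw.1 hw.2)
  · exact (h.analyticAt_cayleyExtension_of_im_nonneg hz h0).continuousAt.continuousWithinAt

theorem isBigO_cayleyExtension_sub (h : IsLogDissipative ℓ B Θ) (hδ : 0 < δ)
    (hu : IsUnit (1 - logLeading ℓ B (Complex.I * δ))) :
    (fun z => cayleyExtension ℓ B Θ z - (cayleyExtension ℓ B Θ 0 +
        (2 / (leadingTheta ℓ B δ * (1 + alpha δ z * leadingTheta ℓ B δ))) •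
          leadingRankOne ℓ B δ))
      =O[𝓝[cutPlane] 0] fun z => z * Complex.log z := by
  refine EventuallyEq.trans_isBigO ?_ ((h.isBigO_cayleyTransform_sub hδ hu).trans
    (isBigO_mul_log_of_norm_le h.norm_le))
  filter_upwards [self_mem_nhdsWithin, (eventually_isUnit_and_cayleyTransform_logLeading hδ hu
    (h.leadingTheta_ne_zero hu)).filter_mono nhdsWithin_cutPlane_le] with z hz hlead
  rw [cayleyExtension_of_ne_zero hz.1, h.cayleyExtension_zero hδ hu, hlead.2]

end IsLogDissipative

variable {Q F : ℂ → W →L[ℂ] W} {M : ℕ} {A : ℕ → W →L[ℂ] W}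

theorem eq_logLeading_add_logRemainder (hA : A 0 = InnerProductSpace.rankOne ℂ ℓ ℓ) {z : ℂ}
    (hQ : Q z = ∑ m ∈ Finset.range (M + 1), (z ^ m * Complex.log (-Complex.I * z)) • A m + F z) :
    Q z = logLeading ℓ (F 0) z + logRemainder M A F z := by
  rw [logLeading, ← hA]
  exact hQ.trans (sum_log_smul_eq M A F z)

variable [CompleteSpace W]

theorem limUnder_sub_log_smul_rankOne (hF : Differentiable ℂ F)
    (hA : A 0 = InnerProductSpace.rankOne ℂ ℓ ℓ)
    (hQ : ∀ z : ℂ, 0 < z.im → Q z =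
      ∑ m ∈ Finset.range (M + 1), (z ^ m * Complex.log (-Complex.I * z)) • A m + F z) :
    (limUnder (𝓝[{z : ℂ | 0 < z.im}] 0) fun z =>
      Q z - Complex.log (-Complex.I * z) • InnerProductSpace.rankOne ℂ ℓ ℓ) = F 0 := by
  have h_lim : Tendsto (fun z => F 0 + logRemainder M A F z) (𝓝[{z : ℂ | 0 < z.im}] 0)
      (𝓝 (F 0)) := by
    simpa using ((tendsto_zero_of_norm_le (exists_norm_logRemainder_le M A hF)).mono_left
      nhdsWithin_upperHalf_le).const_add (F 0)
  refine (h_lim.congr' ?_).limUnder_eq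
  filter_upwards [self_mem_nhdsWithin] with z hz
  rw [eq_logLeading_add_logRemainder hA (hQ z hz), logLeading]
  abel

theorem exists_isLogDissipative_of_expansion (hℓ : ℓ ≠ 0) (hF : Differentiable ℂ F)
    (hA : A 0 = InnerProductSpace.rankOne ℂ ℓ ℓ)
    (hQ : ∀ z : ℂ, 0 < z.im → Q z =
      ∑ m ∈ Finset.range (M + 1), (z ^ m * Complex.log (-Complex.I * z)) • A m + F z)
    (hdiss : ∀ z : ℂ, 0 < z.im → IsDissipative (Q z)) :
    let B := limUnder (𝓝[{z : ℂ | 0 < z.im}] 0) fun z =>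
      Q z - Complex.log (-Complex.I * z) • InnerProductSpace.rankOne ℂ ℓ ℓ
    ∃ Θ : ℂ → W →L[ℂ] W, IsLogDissipative ℓ B Θ ∧
      ∀ z : ℂ, 0 < z.im → Q z = logLeading ℓ B z + Θ z := by
  have h_eq : ∀ z : ℂ, 0 < z.im → Q z = logLeading ℓ (F 0) z + logRemainder M A F z :=
    fun z hz => eq_logLeading_add_logRemainder hA (hQ z hz)
  simp only [limUnder_sub_log_smul_rankOne hF hA hQ]
  exact ⟨logRemainder M A F, ⟨hℓ, analyticOnNhd_logRemainder M A hF,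
    exists_norm_logRemainder_le M A hF, fun z hz => h_eq z hz ▸ hdiss z hz⟩, h_eq⟩

end LogDissipative

section ExpTail

theorem norm_cexp_I_mul (z : ℂ) (t : ℝ) :
    ‖Complex.exp (Complex.I * z * t)‖ = Real.exp (-z.im * t) := by
  rw [Complex.norm_exp]
  simp

/-- The generalized exponential integral `∫ₐ^∞ exp(izt) t⁻⁽ᵐ⁺¹⁾ dt`, meaningful for `0 < a` and
`0 < Im z`. -/
def expTail (a : ℝ) (m : ℕ) (z : ℂ) : ℂ :=
  ∫ t in Ioi a, Complex.exp (Complex.I * z * t) * ((t : ℂ) ^ (m + 1))⁻¹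

theorem aestronglyMeasurable_cexp_mul_inv_pow (a : ℝ) (m : ℕ) (z : ℂ) :
    AEStronglyMeasurable (fun t : ℝ => Complex.exp (Complex.I * z * t) * ((t : ℂ) ^ m)⁻¹)
      (volume.restrict (Ioi a)) :=
  Measurable.aestronglyMeasurable (by fun_prop)

variable {a : ℝ} {z : ℂ}

theorem norm_cexp_mul_inv_pow_le (ha : 0 < a) (m : ℕ) (z : ℂ) {t : ℝ} (ht : a ≤ t) :
    ‖Complex.exp (Complex.I * z * t) * ((t : ℂ) ^ m)⁻¹‖ ≤ Real.exp (-z.im * t) * (a ^ m)⁻¹ := by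
  rw [norm_mul, norm_cexp_I_mul, norm_inv, norm_pow, Complex.norm_real,
    Real.norm_of_nonneg (ha.le.trans ht)]
  gcongr

theorem integrableOn_cexp_mul_inv_pow (ha : 0 < a) (m : ℕ) (hz : 0 < z.im) :
    IntegrableOn (fun t : ℝ => Complex.exp (Complex.I * z * t) * ((t : ℂ) ^ m)⁻¹) (Ioi a) := by
  refine Integrable.mono' ((integrableOn_exp_mul_Ioi (neg_lt_zero.2 hz) a).mul_const (a ^ m)⁻¹)
    (aestronglyMeasurable_cexp_mul_inv_pow a m z) ?_
  filter_upwards [ae_restrict_mem measurableSet_Ioi] with t ht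
  exact norm_cexp_mul_inv_pow_le ha m z (le_of_lt ht)

theorem tendsto_cexp_mul_inv_pow (ha : 0 < a) (m : ℕ) (hz : 0 < z.im) :
    Tendsto (fun t : ℝ => Complex.exp (Complex.I * z * t) * ((t : ℂ) ^ m)⁻¹) atTop (𝓝 0) := by
  have hbound : Tendsto (fun t : ℝ => Real.exp (-z.im * t) * (a ^ m)⁻¹) atTop (𝓝 0) := by
    rw [← zero_mul (a ^ m)⁻¹]
    exact (Real.tendsto_exp_atBot.comp
      (tendsto_id.const_mul_atTop_of_neg (neg_lt_zero.2 hz))).mul_const _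
  refine squeeze_zero_norm' ?_ hbound
  filter_upwards [eventually_ge_atTop a] with t ht
  exact norm_cexp_mul_inv_pow_le ha m z ht

theorem hasDerivAt_cexp_mul_inv_pow (m : ℕ) (z : ℂ) {t : ℝ} (ht : t ≠ 0) :
    HasDerivAt (fun t : ℝ => Complex.exp (Complex.I * z * t) * ((t : ℂ) ^ (m + 1))⁻¹)
      (Complex.I * z * (Complex.exp (Complex.I * z * t) * ((t : ℂ) ^ (m + 1))⁻¹) -
        ((m : ℂ) + 1) * (Complex.exp (Complex.I * z * t) * ((t : ℂ) ^ (m + 1 + 1))⁻¹)) t := by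
  have ht' : (t : ℂ) ≠ 0 := Complex.ofReal_ne_zero.2 ht
  have hofReal : HasDerivAt (fun t : ℝ => (t : ℂ)) 1 t := (hasDerivAt_id t).ofReal_comp
  refine ((hofReal.const_mul (Complex.I * z)).cexp.mul
    ((hofReal.pow (m + 1)).inv (pow_ne_zero _ ht'))).congr_deriv ?_
  simp only [Pi.pow_apply, Pi.inv_apply]
  field_simp
  push_cast
  ring

theorem expTail_succ (ha : 0 < a) (m : ℕ) (hz : 0 < z.im) :
    expTail a (m + 1) z = (Complex.exp (Complex.I * z * a) * ((a : ℂ) ^ (m + 1))⁻¹ +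
      Complex.I * z * expTail a m z) / ((m : ℂ) + 1) := by
  have hint := (integrableOn_cexp_mul_inv_pow ha (m + 1) hz).const_mul (Complex.I * z)
  have hint' := (integrableOn_cexp_mul_inv_pow ha (m + 1 + 1) hz).const_mul ((m : ℂ) + 1)
  have hparts := integral_Ioi_of_hasDerivAt_of_tendsto'
    (fun t ht => hasDerivAt_cexp_mul_inv_pow m z (ha.trans_le ht).ne')
    (hint.sub hint') (tendsto_cexp_mul_inv_pow ha (m + 1) hz)
  rw [integral_sub hint hint', integral_const_mul, integral_const_mul] at hparts
  change Complex.I * z * expTail a m z - ((m : ℂ) + 1) * expTail a (m + 1) z = _ at hparts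
  rw [eq_div_iff (Nat.cast_add_one_ne_zero m)]
  linear_combination -hparts

theorem hasDerivAt_expTail_zero (ha : 0 < a) (hz : 0 < z.im) :
    HasDerivAt (expTail a 0) (-(Complex.exp (Complex.I * z * a) / z)) z := by
  have hnhds : {w : ℂ | z.im / 2 < w.im} ∈ 𝓝 z :=
    (isOpen_lt continuous_const Complex.continuous_im).mem_nhds (half_lt_self hz)
  have hderiv := hasDerivAt_integral_of_dominated_loc_of_deriv_le (μ := volume.restrict (Ioi a))
    (F := fun (w : ℂ) (t : ℝ) => Complex.exp (Complex.I * w * t) * ((t : ℂ) ^ (0 + 1))⁻¹)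
    (F' := fun (w : ℂ) (t : ℝ) => Complex.I * Complex.exp (Complex.I * w * t))
    (bound := fun t => Real.exp (-(z.im / 2) * t)) (x₀ := z) hnhds
    (Eventually.of_forall fun w => aestronglyMeasurable_cexp_mul_inv_pow a _ w)
    (integrableOn_cexp_mul_inv_pow ha _ hz)
    (Continuous.aestronglyMeasurable (by fun_prop)) ?_
    (integrableOn_exp_mul_Ioi (by linarith) a) ?_
  · refine hderiv.2.congr_deriv ?_
    have hz0 : z ≠ 0 := fun h => by simp [h] at hz
    rw [integral_const_mul, integral_exp_mul_complex_Ioi (by simpa using hz)]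
    field_simp
  · filter_upwards [ae_restrict_mem measurableSet_Ioi] with t ht w (hw : z.im / 2 < w.im)
    have ht0 : 0 < t := ha.trans ht
    rw [norm_mul, norm_cexp_I_mul, Complex.norm_I, one_mul]
    gcongr
  · filter_upwards [ae_restrict_mem measurableSet_Ioi] with t ht w _
    have ht0 : (t : ℂ) ≠ 0 := Complex.ofReal_ne_zero.2 (ha.trans ht).ne'
    have hlin : HasDerivAt (fun w : ℂ => Complex.I * w * t) (Complex.I * t) w := by
      simpa using ((hasDerivAt_id w).const_mul Complex.I).mul_const (t : ℂ)
    refine (hlin.cexp.mul_const _).congr_deriv ?_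
    rw [zero_add, pow_one]
    field_simp

theorem hasDerivAt_log_neg_I_mul (hz : z ∈ cutPlane) :
    HasDerivAt (fun w : ℂ => Complex.log (-Complex.I * w)) z⁻¹ z := by
  have hlin : HasDerivAt (fun w : ℂ => -Complex.I * w) (-Complex.I) z := by
    simpa using (hasDerivAt_id z).const_mul (-Complex.I)
  refine (hlin.clog (mem_cutPlane_iff.1 hz)).congr_deriv ?_
  rw [div_mul_cancel_left₀ (neg_ne_zero.2 Complex.I_ne_zero)]

/- By `hasDerivAt_expTail_zero` the derivative of `expTail a 0 + log (-I z)` is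
`(1 - exp (I z a)) / z`, whose singularity at `0` is removable. -/
theorem exists_expTail_zero_eq (ha : 0 < a) : ∃ h : ℂ → ℂ, Differentiable ℂ h ∧
    ∀ z : ℂ, 0 < z.im → expTail a 0 z = h z - Complex.log (-Complex.I * z) := by
  have hslope : Differentiable ℂ (dslope (fun z : ℂ => -Complex.exp (Complex.I * z * a)) 0) := by
    rw [← differentiableOn_univ, Complex.differentiableOn_dslope univ_mem]
    exact Differentiable.differentiableOn (by fun_prop)
  obtain ⟨h, hh⟩ := hslope.isExactOn_univ
  set G : ℂ → ℂ := fun z => expTail a 0 z + Complex.log (-Complex.I * z) - h z with hG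
  have hGderiv : ∀ z : ℂ, 0 < z.im → HasDerivAt G 0 z := by
    intro z hz
    have hz0 : z ≠ 0 := fun h => by simp [h] at hz
    refine (((hasDerivAt_expTail_zero ha hz).add (hasDerivAt_log_neg_I_mul
      (mem_cutPlane_of_im_pos hz))).sub (hh z (mem_univ z))).congr_deriv ?_
    rw [dslope_of_ne _ hz0, slope_def_field, mul_zero, zero_mul, Complex.exp_zero]
    field_simp
    ring
  have hconst : ∀ z : ℂ, 0 < z.im → G z = G Complex.I := fun z hz =>
    (isOpen_lt continuous_const Complex.continuous_im).is_const_of_deriv_eq_zero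
      (convex_halfSpace_im_gt 0).isPreconnected
      (fun w hw => (hGderiv w hw).differentiableAt.differentiableWithinAt)
      (fun w hw => (hGderiv w hw).deriv) hz (by simp)
  refine ⟨fun z => h z + G Complex.I,
    Differentiable.add_const _ fun z => (hh z (mem_univ z)).differentiableAt, fun z hz => ?_⟩
  rw [← hconst z hz, hG]
  ring

theorem exists_expTail_eq (ha : 0 < a) (m : ℕ) : ∃ h : ℂ → ℂ, Differentiable ℂ h ∧
    ∀ z : ℂ, 0 < z.im → expTail a m z =
      h z - (Complex.I * z) ^ m / (m.factorial : ℂ) * Complex.log (-Complex.I * z) := by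
  induction m with
  | zero => simpa using exists_expTail_zero_eq ha
  | succ m ih =>
    obtain ⟨h, hdiff, heq⟩ := ih
    refine ⟨fun z => (Complex.exp (Complex.I * z * a) * ((a : ℂ) ^ (m + 1))⁻¹ +
      Complex.I * z * h z) / ((m : ℂ) + 1), by fun_prop, fun z hz => ?_⟩
    have hm : (m : ℂ) + 1 ≠ 0 := Nat.cast_add_one_ne_zero m
    have hfact : (m.factorial : ℂ) ≠ 0 := Nat.cast_ne_zero.2 m.factorial_ne_zero
    rw [expTail_succ ha m hz, heq z hz, Nat.factorial_succ]
    push_cast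
    field_simp
    ring

end ExpTail

section IsometricGroup
variable {E : Type*} [NormedAddCommGroup E] [NormedSpace ℂ E]

/-- A strongly continuous one-parameter group of linear isometries. -/
structure IsIsometricGroup (U : ℝ → E →L[ℂ] E) : Prop where
  norm_apply : ∀ t f, ‖U t f‖ = ‖f‖
  zero_apply : ∀ f, U 0 f = f
  add_apply : ∀ s t f, U (s + t) f = U s (U t f)
  continuous_apply : ∀ f, Continuous fun t => U t f

namespace IsIsometricGroup
variable {U : ℝ → E →L[ℂ] E} {z : ℂ}

theorem continuous_cexp_smul (hU : IsIsometricGroup U) (z : ℂ) (f : E) :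
    Continuous fun t : ℝ => Complex.exp (Complex.I * z * t) • U t f :=
  Continuous.smul (by fun_prop) (hU.continuous_apply f)

theorem norm_cexp_smul (hU : IsIsometricGroup U) (z : ℂ) (t : ℝ) (f : E) :
    ‖Complex.exp (Complex.I * z * t) • U t f‖ = Real.exp (-z.im * t) * ‖f‖ := by
  rw [norm_smul, hU.norm_apply, norm_cexp_I_mul]

theorem integrableOn_cexp_smul (hU : IsIsometricGroup U) (hz : 0 < z.im) (f : E) (a : ℝ) :
    IntegrableOn (fun t : ℝ => Complex.exp (Complex.I * z * t) • U t f) (Ioi a) :=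
  Integrable.mono' ((integrableOn_exp_mul_Ioi (neg_lt_zero.2 hz) a).mul_const ‖f‖)
    (hU.continuous_cexp_smul z f).aestronglyMeasurable
    (Eventually.of_forall fun t => (hU.norm_cexp_smul z t f).le)

/-- The Laplace transform `f ↦ ∫₀^∞ exp(izt) U(t) f dt` of a one-parameter group, which is
`-i (A - z)⁻¹` if `U t = exp(-itA)`. -/
def laplace (hU : IsIsometricGroup U) (hz : 0 < z.im) : E →L[ℂ] E :=
  LinearMap.mkContinuousOfExistsBound
    { toFun := fun f => ∫ t in Ioi (0 : ℝ), Complex.exp (Complex.I * z * t) • U t f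
      map_add' := fun f g => by
        simp only [map_add, smul_add]
        exact integral_add (hU.integrableOn_cexp_smul hz f 0) (hU.integrableOn_cexp_smul hz g 0)
      map_smul' := fun a f => by
        simp only [map_smul, RingHom.id_apply, smul_comm _ a]
        exact integral_smul a _ }
    ⟨∫ t in Ioi (0 : ℝ), Real.exp (-z.im * t), fun f => by
      rw [← integral_mul_const]
      exact norm_integral_le_of_norm_le
        ((integrableOn_exp_mul_Ioi (neg_lt_zero.2 hz) 0).mul_const ‖f‖)
        (Eventually.of_forall fun t => (hU.norm_cexp_smul z t f).le)⟩

theorem laplace_apply (hU : IsIsometricGroup U) (hz : 0 < z.im) (f : E) :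
    hU.laplace hz f = ∫ t in Ioi (0 : ℝ), Complex.exp (Complex.I * z * t) • U t f := rfl

theorem apply_laplace [CompleteSpace E] (hU : IsIsometricGroup U) (hz : 0 < z.im) (ℓ : E →L[ℂ] ℂ)
    (f : E) : ℓ (hU.laplace hz f) =
      ∫ t in Ioi (0 : ℝ), Complex.exp (Complex.I * z * t) * ℓ (U t f) := by
  rw [laplace_apply, ← ContinuousLinearMap.integral_comp_comm ℓ (hU.integrableOn_cexp_smul hz f 0)]
  simp only [map_smul, smul_eq_mul]

theorem smul_laplace_eq_integral_exp_neg (hU : IsIsometricGroup U) {r : ℝ} (hr : 0 < r)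
    (hz : 0 < (Complex.I * (r : ℂ)).im) (f : E) :
    (r : ℂ) • hU.laplace hz f = ∫ s in Ioi (0 : ℝ), (Real.exp (-s) : ℂ) • U (r⁻¹ * s) f := by
  have hsubst := integral_comp_mul_left_Ioi'
    (fun s : ℝ => (Real.exp (-s) : ℂ) • U (r⁻¹ * s) f) 0 hr
  rw [mul_zero] at hsubst
  rw [← hsubst, laplace_apply, Complex.coe_smul]
  congr 2
  ext1 t
  rw [inv_mul_cancel_left₀ hr.ne', Complex.ofReal_exp]
  congr 2
  push_cast
  linear_combination (r * t : ℂ) * Complex.I_sq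

section CompleteSpace
variable [CompleteSpace E]

theorem tendsto_integral_exp_neg_smul (hU : IsIsometricGroup U) {ι : Type*} {l : Filter ι}
    [l.IsCountablyGenerated] {ε : ι → ℝ} (hε : Tendsto ε l (𝓝 0)) (f : E) :
    Tendsto (fun n => ∫ s in Ioi (0 : ℝ), (Real.exp (-s) : ℂ) • U (ε n * s) f) l (𝓝 f) := by
  have hlim : f = ∫ s in Ioi (0 : ℝ), (Real.exp (-s) : ℂ) • f := by
    rw [integral_smul_const, integral_complex_ofReal, integral_exp_neg_Ioi_zero,
      Complex.ofReal_one, one_smul]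
  conv in 𝓝 f => rw [hlim]
  refine tendsto_integral_filter_of_dominated_convergence (fun s => Real.exp (-s) * ‖f‖)
    (Eventually.of_forall fun n => ?_) (Eventually.of_forall fun n => ?_) ?_
    (Eventually.of_forall fun s => Tendsto.const_smul ?_ _)
  · exact (Continuous.smul (by fun_prop)
      ((hU.continuous_apply f).comp (continuous_const_mul _))).aestronglyMeasurable
  · refine Eventually.of_forall fun s => ?_
    rw [norm_smul, hU.norm_apply, Complex.norm_real, Real.norm_of_nonneg (Real.exp_nonneg _)]
  · exact (integrableOn_exp_neg_Ioi 0).mul_const _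
  · have hshift := (hU.continuous_apply f).tendsto 0
    rw [hU.zero_apply] at hshift
    exact hshift.comp (by simpa using hε.mul_const s)

theorem tendsto_smul_laplace (hU : IsIsometricGroup U) (f : E) :
    Tendsto (fun n : ℕ => ((n + 1 : ℝ) : ℂ) •
      hU.laplace (z := Complex.I * ((n + 1 : ℝ) : ℂ))
        (by simpa using n.cast_add_one_pos (α := ℝ)) f) atTop (𝓝 f) := by
  simp only [fun n : ℕ => hU.smul_laplace_eq_integral_exp_neg (n.cast_add_one_pos (α := ℝ))]
  exact hU.tendsto_integral_exp_neg_smul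
    (by simpa using tendsto_one_div_add_atTop_nhds_zero_nat (𝕜 := ℝ)) f

theorem cexp_smul_laplace (hU : IsIsometricGroup U) (hz : 0 < z.im) (f : E)
    (s : ℝ) : Complex.exp (Complex.I * z * s) • U s (hU.laplace hz f) =
      ∫ t in Ioi s, Complex.exp (Complex.I * z * t) • U t f := by
  rw [laplace_apply, ← ContinuousLinearMap.integral_comp_comm _ (hU.integrableOn_cexp_smul hz f 0),
    ← integral_smul, ← integral_indicator measurableSet_Ioi, ← integral_indicator measurableSet_Ioi,
    ← integral_add_right_eq_self ((Ioi s).indicator _) s]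
  congr 1
  ext1 t
  by_cases ht : t ∈ Ioi (0 : ℝ)
  · rw [indicator_of_mem ht, indicator_of_mem (by simpa using ht), map_smul, ← hU.add_apply,
      smul_smul, ← Complex.exp_add, add_comm s t]
    congr 2
    push_cast
    ring
  · rw [indicator_of_notMem ht, indicator_of_notMem (by simpa using ht)]

theorem hasDerivAt_cexp_smul_laplace (hU : IsIsometricGroup U) (hz : 0 < z.im)
    (f : E) : HasDerivAt (fun s : ℝ => Complex.exp (Complex.I * z * s) • U s (hU.laplace hz f))
      (-f) 0 := by
  have hcont := hU.continuous_cexp_smul z f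
  have htail : ∀ s : ℝ, Complex.exp (Complex.I * z * s) • U s (hU.laplace hz f) =
      hU.laplace hz f - ∫ t in (0 : ℝ)..s, Complex.exp (Complex.I * z * t) • U t f := by
    intro s
    rw [hU.cexp_smul_laplace hz, eq_sub_iff_add_eq', intervalIntegral.integral_interval_add_Ioi'
      (hcont.intervalIntegrable _ _) (hU.integrableOn_cexp_smul hz f s), hU.laplace_apply hz]
  have hderiv := (hcont.integral_hasStrictDerivAt 0 0).hasDerivAt.const_sub (hU.laplace hz f)
  rw [Complex.ofReal_zero, mul_zero, Complex.exp_zero, one_smul, hU.zero_apply] at hderiv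
  simpa only [htail] using hderiv

end CompleteSpace

end IsIsometricGroup

/- Differentiate `‖exp(izs) U(s) u‖² = exp(-2 s Im z) ‖u‖²` at `s = 0`. -/
theorem IsIsometricGroup.re_inner_laplace {H : Type*} [NormedAddCommGroup H]
    [InnerProductSpace ℂ H] [CompleteSpace H] {U : ℝ → H →L[ℂ] H} (hU : IsIsometricGroup U)
    {z : ℂ} (hz : 0 < z.im) (f : H) :
    (⟪f, hU.laplace hz f⟫_ℂ).re = z.im * ‖hU.laplace hz f‖ ^ 2 := by
  have horbit := (hU.hasDerivAt_cexp_smul_laplace hz f).inner ℂ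
    (hU.hasDerivAt_cexp_smul_laplace hz f)
  set u := hU.laplace hz f
  have hnorm : ∀ s : ℝ, ⟪Complex.exp (Complex.I * z * s) • U s u,
      Complex.exp (Complex.I * z * s) • U s u⟫_ℂ =
        ((Real.exp (-z.im * s) ^ 2 * ‖u‖ ^ 2 : ℝ) : ℂ) := by
    intro s
    rw [inner_self_eq_norm_sq_to_K, hU.norm_cexp_smul, ← mul_pow]
    norm_cast
  have hexp : HasDerivAt (fun s : ℝ => ((Real.exp (-z.im * s) ^ 2 * ‖u‖ ^ 2 : ℝ) : ℂ))
      ((-2 * z.im * ‖u‖ ^ 2 : ℝ) : ℂ) 0 := by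
    refine HasDerivAt.ofReal_comp ((((((hasDerivAt_id (0 : ℝ)).const_mul (-z.im)).exp).pow
      2).mul_const (‖u‖ ^ 2)).congr_deriv ?_)
    simp
  simp only [hnorm] at horbit
  have hre := congrArg Complex.re (horbit.unique hexp)
  rw [Complex.ofReal_zero, mul_zero, Complex.exp_zero, one_smul, hU.zero_apply, inner_neg_right,
    inner_neg_left, ← inner_conj_symm u f, Complex.ofReal_re] at hre
  simp only [Complex.add_re, Complex.neg_re, Complex.conj_re] at hre
  linarith

end IsometricGroup

section Shear

/-- The free transport flow `(x, μ) ↦ (x + tμ, μ)` on the phase space of the slab. -/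
def shear (t : ℝ) (p : ℝ × ℝ) : ℝ × ℝ := (p.1 + t * p.2, p.2)

theorem continuous_shear (t : ℝ) : Continuous (shear t) := by
  unfold shear
  fun_prop

theorem measurePreserving_shear (t : ℝ) :
    MeasurePreserving (shear t) phaseMeasure phaseMeasure := by
  have hskew : MeasurePreserving (fun p : ℝ × ℝ => (p.1, p.2 + t * p.1))
      (angleMeasure.prod volume) (angleMeasure.prod volume) :=
    (MeasurePreserving.id angleMeasure).skew_product (g := fun μ x => x + t * μ)
      (by fun_prop) (Eventually.of_forall fun μ => map_add_right_eq_self volume (t * μ))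
  exact Measure.measurePreserving_swap.comp (hskew.comp Measure.measurePreserving_swap)

/-- Composition with the flow `shear t`, the unitary group `exp(-itL₀)` of free streaming. -/
def shift (t : ℝ) : PhaseSpace →L[ℂ] PhaseSpace :=
  (Lp.compMeasurePreservingₗᵢ ℂ (shear t) (measurePreserving_shear t)).toContinuousLinearMap

theorem coeFn_shift (t : ℝ) (f : PhaseSpace) :
    shift t f =ᵐ[phaseMeasure] fun p => f (shear t p) :=
  Lp.coeFn_compMeasurePreserving f (measurePreserving_shear t)

theorem shift_zero (f : PhaseSpace) : shift 0 f = f := by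
  refine Lp.ext ((coeFn_shift 0 f).trans (Eventually.of_forall fun p => ?_))
  simp [shear]

theorem shift_add (s t : ℝ) (f : PhaseSpace) : shift (s + t) f = shift s (shift t f) := by
  refine Lp.ext ((coeFn_shift _ f).trans (EventuallyEq.symm ((coeFn_shift _ _).trans ?_)))
  filter_upwards [(measurePreserving_shear s).quasiMeasurePreserving.ae (coeFn_shift t f)] with p hp
  rw [hp]
  simp only [shear]
  congr 2
  ring

theorem continuous_shift (f : PhaseSpace) : Continuous fun t => shift t f := by
  have hshear : Continuous fun t : ℝ => (⟨shear t, continuous_shear t⟩ : C(ℝ × ℝ, ℝ × ℝ)) := by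
    refine ContinuousMap.continuous_of_continuous_uncurry _ ?_
    change Continuous fun q : ℝ × (ℝ × ℝ) => (q.2.1 + q.1 * q.2.2, q.2.2)
    fun_prop
  exact Continuous.compMeasurePreservingLp (continuous_const (y := f)) hshear
    measurePreserving_shear ENNReal.ofNat_ne_top

theorem isIsometricGroup_shift : IsIsometricGroup shift where
  norm_apply t f := Lp.norm_compMeasurePreserving f (measurePreserving_shear t)
  zero_apply := shift_zero
  add_apply := shift_add
  continuous_apply := continuous_shift

end Shear

section LinearODE

theorem continuous_of_absolutelyContinuousOnInterval {F : Type*}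
    [SeminormedAddCommGroup F] {f : ℝ → F}
    (hf : ∀ a b, AbsolutelyContinuousOnInterval f a b) : Continuous f := by
  rw [continuous_iff_continuousAt]
  intro x
  refine (hf (x - 1) (x + 1)).continuousOn.continuousAt ?_
  rw [uIcc_of_le (by linarith)]
  exact Icc_mem_nhds (by linarith) (by linarith)

theorem absolutelyContinuousOnInterval_integral {E : Type*} [NormedAddCommGroup E]
    [NormedSpace ℝ E] {w : ℝ → E} (hw : LocallyIntegrable w volume) (a b c : ℝ) :
    AbsolutelyContinuousOnInterval (fun x => ∫ t in c..x, w t) a b := by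
  have hint : ∀ x y, IntervalIntegrable w volume x y := fun x y =>
    intervalIntegrable_iff.2 ((hw.integrableOn_isCompact isCompact_uIcc).mono_set uIoc_subset_uIcc)
  have hnorm := (hint a b).norm.absolutelyContinuousOnInterval_intervalIntegral left_mem_uIcc
  have hdist : ∀ x y, dist (∫ t in c..x, w t) (∫ t in c..y, w t) ≤
      dist (∫ t in a..x, ‖w t‖) (∫ t in a..y, ‖w t‖) := by
    intro x y
    rw [dist_eq_norm, dist_eq_norm, Real.norm_eq_abs,
      intervalIntegral.integral_interval_sub_left (hint c x) (hint c y),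
      intervalIntegral.integral_interval_sub_left (hint a x).norm (hint a y).norm]
    exact intervalIntegral.norm_integral_le_abs_integral_norm
  rw [absolutelyContinuousOnInterval_iff] at hnorm ⊢
  intro ε hε
  obtain ⟨δ, hδ, h⟩ := hnorm ε hε
  exact ⟨δ, hδ, fun I hI hlen =>
    (Finset.sum_le_sum fun i _ => hdist _ _).trans_lt (h I hI hlen)⟩

theorem hasDerivAt_cexp_mul_ofReal (c : ℂ) (x : ℝ) :
    HasDerivAt (fun x : ℝ => Complex.exp (c * x)) (c * Complex.exp (c * x)) x := by
  simpa [mul_comm] using ((hasDerivAt_id x).ofReal_comp.const_mul c).cexp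

theorem absolutelyContinuousOnInterval_cexp_mul_ofReal (c : ℂ) (a b : ℝ) :
    AbsolutelyContinuousOnInterval (fun x : ℝ => Complex.exp (c * x)) a b :=
  (ContDiff.cexp (contDiff_const.mul
    Complex.ofRealCLM.contDiff)).contDiffOn.absolutelyContinuousOnInterval

/-- The variation of constants formula for the linear equation `u' = -c u + b g`. -/
def duhamel (c b C : ℂ) (g : ℝ → ℂ) (x : ℝ) : ℂ :=
  Complex.exp (-c * x) * (C + b * ∫ t in (0 : ℝ)..x, Complex.exp (c * t) * g t)

variable {g u : ℝ → ℂ} {c : ℂ}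

theorem locallyIntegrable_cexp_mul (c : ℂ) (hg : LocallyIntegrable g volume) :
    LocallyIntegrable (fun t : ℝ => Complex.exp (c * t) * g t) volume :=
  hg.continuous_mul (by fun_prop)

theorem absolutelyContinuousOnInterval_duhamel (c b C : ℂ) (hg : LocallyIntegrable g volume)
    (x y : ℝ) : AbsolutelyContinuousOnInterval (duhamel c b C g) x y :=
  (absolutelyContinuousOnInterval_cexp_mul_ofReal (-c) x y).smul
    (contDiff_const (n := 1).contDiffOn.absolutelyContinuousOnInterval.add
      ((absolutelyContinuousOnInterval_integral (locallyIntegrable_cexp_mul c hg) x y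
        0).const_smul b))

theorem ae_hasDerivAt_duhamel (c b C : ℂ) (hg : LocallyIntegrable g volume) :
    ∀ᵐ x : ℝ, HasDerivAt (duhamel c b C g) (-c * duhamel c b C g x + b * g x) x := by
  filter_upwards [LocallyIntegrable.ae_hasDerivAt_integral
    (locallyIntegrable_cexp_mul c hg)] with x hx
  refine ((hasDerivAt_cexp_mul_ofReal (-c) x).mul
    (((hx 0).const_mul b).const_add C)).congr_deriv ?_
  have hcancel : Complex.exp (-c * x) * Complex.exp (c * x) = 1 := by
    rw [← Complex.exp_add, neg_mul, neg_add_cancel, Complex.exp_zero]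
  rw [duhamel]
  linear_combination b * g x * hcancel

theorem eq_cexp_mul_of_ae_hasDerivAt (hu : ∀ a b, AbsolutelyContinuousOnInterval u a b)
    (hderiv : ∀ᵐ x : ℝ, HasDerivAt u (-c * u x) x) (x : ℝ) :
    u x = Complex.exp (-c * x) * u 0 := by
  have hzero : ∀ᵐ x : ℝ, HasDerivAt (fun x : ℝ => Complex.exp (c * x) • u x) 0 x := by
    filter_upwards [hderiv] with x hx
    refine ((hasDerivAt_cexp_mul_ofReal c x).mul hx).congr_deriv ?_
    ring
  obtain ⟨C, hC⟩ := ((absolutelyContinuousOnInterval_cexp_mul_ofReal c 0 x).smul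
    (hu 0 x)).const_of_ae_hasDerivAt_zero (hzero.mono fun _ h _ => h)
  have hconst : Complex.exp (c * x) * u x = u 0 := by
    simpa using (hC x right_mem_uIcc).trans (hC 0 left_mem_uIcc).symm
  rw [← hconst, ← mul_assoc, ← Complex.exp_add, neg_mul, neg_add_cancel, Complex.exp_zero, one_mul]

theorem not_memLp_cexp_mul_ofReal (hc : c.re ≠ 0) {p : ℝ≥0∞} (hp : p ≠ 0) (hp' : p ≠ ∞) :
    ¬MemLp (fun x : ℝ => Complex.exp (c * x)) p volume := by
  intro h
  have hfinite := h.meas_ge_lt_top hp hp' one_ne_zero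
  have hle : ∀ x : ℝ, 0 ≤ c.re * x → x ∈ {x : ℝ | 1 ≤ ‖Complex.exp (c * x)‖₊} := fun x hx => by
    rw [mem_ofPred_eq, ← NNReal.coe_le_coe, coe_nnnorm, Complex.norm_exp]
    simpa using hx
  rcases hc.lt_or_gt with hneg | hpos
  · have hsub : Iio (0 : ℝ) ⊆ {x : ℝ | 1 ≤ ‖Complex.exp (c * x)‖₊} := fun x hx =>
      hle x (mul_nonneg_of_nonpos_of_nonpos hneg.le (le_of_lt hx))
    exact (hfinite.trans_le' (measure_mono hsub)).ne Real.volume_Iio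
  · have hsub : Ioi (0 : ℝ) ⊆ {x : ℝ | 1 ≤ ‖Complex.exp (c * x)‖₊} := fun x hx =>
      hle x (mul_nonneg hpos.le (le_of_lt hx))
    exact (hfinite.trans_le' (measure_mono hsub)).ne Real.volume_Ioi

theorem eq_zero_of_memLp_of_ae_hasDerivAt (hc : c.re ≠ 0)
    (hu : ∀ a b, AbsolutelyContinuousOnInterval u a b)
    (hderiv : ∀ᵐ x : ℝ, HasDerivAt u (-c * u x) x) {p : ℝ≥0∞} (hp : p ≠ 0) (hp' : p ≠ ∞)
    (hLp : MemLp u p volume) : u = 0 := by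
  have hexp := eq_cexp_mul_of_ae_hasDerivAt hu hderiv
  have hu0 : u 0 = 0 := by
    by_contra hne
    refine not_memLp_cexp_mul_ofReal (c := -c) (by simpa using hc) hp hp' ?_
    refine (hLp.mul_const (u 0)⁻¹).ae_eq (Eventually.of_forall fun x => ?_)
    rw [hexp x, mul_inv_cancel_right₀ hne]
  ext1 x
  rw [hexp x, hu0, mul_zero, Pi.zero_apply]

/-- The solution `i ∫₀^∞ exp(izt) g(x + tμ) dt` of `iμu' - zu = g` on a line, for `0 < Im z`. -/
def lineSolution (z : ℂ) (μ : ℝ) (g : ℝ → ℂ) (x : ℝ) : ℂ :=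
  Complex.I * ∫ t in Ioi (0 : ℝ), Complex.exp (Complex.I * z * t) * g (x + t * μ)

variable {z : ℂ} {μ : ℝ}

theorem integrableOn_cexp_mul_comp_mul_left (hz : 0 < z.im) (hμ : μ ≠ 0)
    (hg : MemLp g 2 volume) (a : ℝ) :
    IntegrableOn (fun t : ℝ => Complex.exp (Complex.I * z * t) * g (μ * t)) (Ioi a) := by
  have hexp : MemLp (fun t : ℝ => Complex.exp (Complex.I * z * t)) 2 (volume.restrict (Ioi a)) := by
    rw [memLp_two_iff_integrable_sq_norm (by fun_prop)]
    refine (integrableOn_exp_mul_Ioi (a := 2 * -z.im) (by linarith) a).congr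
      (Eventually.of_forall fun t => ?_)
    simp only [norm_cexp_I_mul]
    rw [← Real.exp_nat_mul, Nat.cast_ofNat, mul_assoc]
  have hscaled : MemLp (fun t : ℝ => g (μ * t)) 2 volume := by
    refine (memLp_two_iff_integrable_sq_norm ?_).2
      (((memLp_two_iff_integrable_sq_norm hg.1).1 hg).comp_mul_left' hμ)
    refine AEStronglyMeasurable.comp_measurable ?_ (measurable_const_mul μ)
    rw [Real.map_volume_mul_left hμ]
    exact hg.1.smul_measure _
  exact hexp.integrable_mul (hscaled.restrict _)

theorem lineSolution_eq_integral_Ioi (z : ℂ) (hμ : μ ≠ 0) (g : ℝ → ℂ) (x : ℝ) :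
    lineSolution z μ g x = Complex.I * (Complex.exp (-(Complex.I * z / μ) * x) *
      ∫ t in Ioi (x / μ), Complex.exp (Complex.I * z * t) * g (μ * t)) := by
  have hμ' : (μ : ℂ) ≠ 0 := Complex.ofReal_ne_zero.2 hμ
  rw [lineSolution, ← integral_const_mul (Complex.exp _), ← integral_indicator measurableSet_Ioi,
    ← integral_indicator measurableSet_Ioi,
    ← integral_add_right_eq_self ((Ioi (x / μ)).indicator _) (x / μ)]
  congr 2
  ext1 t
  by_cases ht : t ∈ Ioi (0 : ℝ)
  · rw [indicator_of_mem ht, indicator_of_mem (by simpa using ht), ← mul_assoc, ← Complex.exp_add]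
    congr 2
    · push_cast
      field_simp
      ring
    · field_simp
      ring
  · rw [indicator_of_notMem ht, indicator_of_notMem (by simpa using ht)]

theorem exists_lineSolution_eq_duhamel (hz : 0 < z.im) (hμ : μ ≠ 0) (hg : MemLp g 2 volume) :
    ∃ C, lineSolution z μ g = duhamel (Complex.I * z / μ) (-Complex.I / μ) C g := by
  have hμ' : (μ : ℂ) ≠ 0 := Complex.ofReal_ne_zero.2 hμ
  have hint := integrableOn_cexp_mul_comp_mul_left hz hμ hg
  have hsubst : ∀ x : ℝ, ∫ t in (0 : ℝ)..(x / μ), Complex.exp (Complex.I * z * t) * g (μ * t) =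
      (μ : ℂ)⁻¹ * ∫ t in (0 : ℝ)..x, Complex.exp (Complex.I * z / μ * t) * g t := by
    intro x
    have hcomp := intervalIntegral.integral_comp_mul_left (a := 0) (b := x / μ)
      (fun t : ℝ => Complex.exp (Complex.I * z / μ * t) * g t) hμ
    rw [mul_zero, mul_div_cancel₀ _ hμ, Complex.real_smul, Complex.ofReal_inv] at hcomp
    rw [← hcomp]
    congr! 4 with t
    push_cast
    field_simp
  refine ⟨Complex.I * ∫ t in Ioi (0 : ℝ), Complex.exp (Complex.I * z * t) * g (μ * t), ?_⟩
  ext1 x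
  have hsplit := intervalIntegral.integral_interval_add_Ioi' (μ := volume) (a := 0) (b := x / μ)
    (intervalIntegrable_iff.2 ((hint _).mono_set Ioc_subset_Ioi_self)) (hint _)
  rw [lineSolution_eq_integral_Ioi z hμ, duhamel, ← hsplit, hsubst]
  ring

theorem absolutelyContinuousOnInterval_lineSolution (hz : 0 < z.im) (hμ : μ ≠ 0)
    (hg : MemLp g 2 volume) (a b : ℝ) :
    AbsolutelyContinuousOnInterval (lineSolution z μ g) a b := by
  obtain ⟨C, hC⟩ := exists_lineSolution_eq_duhamel hz hμ hg
  rw [hC]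
  exact absolutelyContinuousOnInterval_duhamel _ _ _ (hg.locallyIntegrable one_le_two) a b

theorem ae_hasDerivAt_lineSolution (hz : 0 < z.im) (hμ : μ ≠ 0) (hg : MemLp g 2 volume) :
    ∀ᵐ x : ℝ, HasDerivAt (lineSolution z μ g)
      ((g x + z * lineSolution z μ g x) / (Complex.I * μ)) x := by
  obtain ⟨C, hC⟩ := exists_lineSolution_eq_duhamel hz hμ hg
  rw [hC]
  filter_upwards [ae_hasDerivAt_duhamel (Complex.I * z / μ) (-Complex.I / μ) C
    (hg.locallyIntegrable one_le_two)] with x hx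
  refine hx.congr_deriv ?_
  rw [← div_div, Complex.div_I]
  ring

end LinearODE

section Slices

theorem hasDerivAt_iff_forall_rat {E : Type*} [NormedAddCommGroup E] [NormedSpace ℝ E]
    {f : ℝ → E} (hf : Continuous f) {D : E} {x : ℝ} :
    HasDerivAt f D x ↔ ∀ n : ℕ, ∃ m : ℕ, ∀ q : ℚ, |(q : ℝ)| < 1 / ((m : ℝ) + 1) →
      ‖f (x + q) - f x - (q : ℝ) • D‖ ≤ 1 / ((n : ℝ) + 1) * |(q : ℝ)| := by
  rw [hasDerivAt_iff_isLittleO_nhds_zero, Asymptotics.isLittleO_iff]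
  refine ⟨fun h n => ?_, fun h ε hε => ?_⟩
  · obtain ⟨r, hr, hbound⟩ := Metric.eventually_nhds_iff.1
      (h (show (0 : ℝ) < 1 / ((n : ℝ) + 1) by positivity))
    obtain ⟨m, hm⟩ := exists_nat_one_div_lt hr
    exact ⟨m, fun q hq => hbound (by rw [dist_zero_right]; exact hq.trans hm)⟩
  · obtain ⟨n, hn⟩ := exists_nat_one_div_lt hε
    obtain ⟨m, hm⟩ := h n
    have hclosed : IsClosed {y : ℝ | ‖f (x + y) - f x - y • D‖ ≤ 1 / ((n : ℝ) + 1) * |y|} :=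
      isClosed_le (by fun_prop) (by fun_prop)
    filter_upwards [Metric.ball_mem_nhds (0 : ℝ) (show (0 : ℝ) < 1 / ((m : ℝ) + 1) by positivity)]
      with y hy
    have hbound : ‖f (x + y) - f x - y • D‖ ≤ 1 / ((n : ℝ) + 1) * |y| := by
      refine hclosed.closure_subset_iff.2 ?_
        (Rat.denseRange_cast.open_subset_closure_inter Metric.isOpen_ball hy)
      rintro _ ⟨hq, q, rfl⟩
      exact hm q (mem_ball_zero_iff.1 hq)
    exact hbound.trans (by rw [Real.norm_eq_abs]; gcongr)

theorem ae_hasDerivAt_of_ae_ae {ν : Measure ℝ} [SFinite ν] {F D : ℝ × ℝ → ℂ} (hF : Measurable F)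
    (hD : Measurable D) (hcont : ∀ᵐ μ ∂ν, Continuous fun x => F (x, μ))
    (hderiv : ∀ᵐ μ ∂ν, ∀ᵐ x : ℝ, HasDerivAt (fun x => F (x, μ)) (D (x, μ)) x) :
    ∀ᵐ p ∂((volume : Measure ℝ).prod ν), HasDerivAt (fun x => F (x, p.2)) (D p) p.1 := by
  set E : Set (ℝ × ℝ) := {p | ∀ n : ℕ, ∃ m : ℕ, ∀ q : ℚ, |(q : ℝ)| < 1 / ((m : ℝ) + 1) →
    ‖F (p.1 + q, p.2) - F p - (q : ℝ) • D p‖ ≤ 1 / ((n : ℝ) + 1) * |(q : ℝ)|} with hE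
  have hmeas : MeasurableSet E := by
    simp only [hE, ofPred_forall, ofPred_exists]
    refine MeasurableSet.iInter fun n => MeasurableSet.iUnion fun m => MeasurableSet.iInter fun q =>
      MeasurableSet.iInter fun _ => measurableSet_le (Measurable.norm ?_) measurable_const
    exact ((hF.comp (by fun_prop)).sub hF).sub (hD.const_smul (q : ℝ))
  have hslice : ∀ᵐ μ ∂ν, ∀ᵐ x : ℝ, (x, μ) ∈ E := by
    filter_upwards [hcont, hderiv] with μ hcontμ hderivμ
    filter_upwards [hderivμ] with x hx
    exact (hasDerivAt_iff_forall_rat hcontμ).1 hx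
  have hae : ∀ᵐ p ∂((volume : Measure ℝ).prod ν), p ∈ E := by
    rw [Measure.ae_prod_mem_iff_ae_ae_mem hmeas]
    exact (Measure.ae_ae_comm (p := fun μ x => (x, μ) ∈ E) (measurable_swap hmeas)).1 hslice
  filter_upwards [hae, Measure.quasiMeasurePreserving_snd.ae hcont] with p hp hcontp
  exact (hasDerivAt_iff_forall_rat hcontp).2 hp

theorem ae_ae_swap_of_ae_phaseMeasure {P : ℝ × ℝ → Prop} (h : ∀ᵐ p ∂phaseMeasure, P p) :
    ∀ᵐ μ ∂angleMeasure, ∀ᵐ x : ℝ, P (x, μ) :=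
  Measure.ae_ae_of_ae_prod (Measure.measurePreserving_swap.quasiMeasurePreserving.ae h)

theorem measurable_coeFn (h : PhaseSpace) : Measurable (h : ℝ × ℝ → ℂ) :=
  (Lp.stronglyMeasurable h).measurable

theorem ae_memLp_slice (h : PhaseSpace) :
    ∀ᵐ μ ∂angleMeasure, MemLp (fun x => h (x, μ)) 2 volume := by
  have hsq : Integrable (fun q => ‖h q‖ ^ 2) phaseMeasure :=
    (Lp.memLp h).integrable_norm_pow two_ne_zero
  filter_upwards [hsq.prod_left_ae] with μ hμ
  refine (memLp_two_iff_integrable_sq_norm ?_).2 hμ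
  exact ((measurable_coeFn h).comp measurable_prodMk_right).aestronglyMeasurable

theorem ae_angle_ne_zero : ∀ᵐ μ ∂angleMeasure, μ ≠ 0 :=
  ae_restrict_of_ae (by simp [ae_iff])

end Slices

section StreamSolution
variable {z : ℂ}

theorem measurePreserving_prod_shear (ν : Measure ℝ) [SFinite ν] :
    MeasurePreserving (fun q : ℝ × (ℝ × ℝ) => (q.1, shear q.1 q.2)) (ν.prod phaseMeasure)
      (ν.prod phaseMeasure) := by
  refine (MeasurePreserving.id ν).skew_product (g := shear) ?_
    (Eventually.of_forall fun t => (measurePreserving_shear t).map_eq)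
  unfold shear Function.uncurry
  fun_prop

theorem measurable_cexp_mul_comp_shear (z : ℂ) (h : PhaseSpace) :
    Measurable fun q : ℝ × (ℝ × ℝ) => Complex.exp (Complex.I * z * q.1) * h (shear q.1 q.2) := by
  refine Measurable.mul (by fun_prop) ((measurable_coeFn h).comp ?_)
  unfold shear
  fun_prop

theorem integrable_cexp_mul_comp_shear (hz : 0 < z.im) (h : PhaseSpace) {s : Set (ℝ × ℝ)}
    (hs : phaseMeasure s < ∞) :
    Integrable (fun q : ℝ × (ℝ × ℝ) => Complex.exp (Complex.I * z * q.1) * h (shear q.1 q.2))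
      ((volume.restrict (Ioi (0 : ℝ))).prod (phaseMeasure.restrict s)) := by
  have hexp : Integrable (fun t : ℝ => Real.exp (-z.im * t)) (volume.restrict (Ioi (0 : ℝ))) :=
    integrableOn_exp_mul_Ioi (neg_lt_zero.2 hz) 0
  have hsq : Integrable (fun q : ℝ × (ℝ × ℝ) => Real.exp (-z.im * q.1) * ‖h (shear q.1 q.2)‖ ^ 2)
      ((volume.restrict (Ioi (0 : ℝ))).prod (phaseMeasure.restrict s)) := by
    have hcomp := (measurePreserving_prod_shear
      (volume.restrict (Ioi (0 : ℝ)))).integrable_comp_of_integrable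
        (hexp.mul_prod ((Lp.memLp h).integrable_norm_pow two_ne_zero))
    exact hcomp.mono_measure (Measure.prod_mono le_rfl Measure.restrict_le_self)
  have hone : Integrable (fun q : ℝ × (ℝ × ℝ) => Real.exp (-z.im * q.1) * 1)
      ((volume.restrict (Ioi (0 : ℝ))).prod (phaseMeasure.restrict s)) := by
    have : IsFiniteMeasure (phaseMeasure.restrict s) := ⟨by simpa using hs⟩
    exact hexp.mul_prod (integrable_const 1)
  refine (hsq.add hone).mono' (measurable_cexp_mul_comp_shear z h).aestronglyMeasurable
    (Eventually.of_forall fun q => ?_)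
  rw [norm_mul, norm_cexp_I_mul, Pi.add_apply, ← mul_add]
  gcongr
  nlinarith [sq_nonneg (‖h (shear q.1 q.2)‖ - 1), norm_nonneg (h (shear q.1 q.2))]

/-- The solution `f` of `iμ∂ₓf - zf = h` obtained by solving the equation on each line
`μ = const`, for `0 < Im z`. -/
def streamSolution (z : ℂ) (h : PhaseSpace) (p : ℝ × ℝ) : ℂ :=
  lineSolution z p.2 (fun x => h (x, p.2)) p.1

theorem streamSolution_eq (z : ℂ) (h : PhaseSpace) (p : ℝ × ℝ) : streamSolution z h p =
    Complex.I * ∫ t in Ioi (0 : ℝ), Complex.exp (Complex.I * z * t) * h (shear t p) := rfl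

theorem measurable_streamSolution (z : ℂ) (h : PhaseSpace) : Measurable (streamSolution z h) := by
  have hmeas : StronglyMeasurable (Function.uncurry fun (p : ℝ × ℝ) (t : ℝ) =>
      Complex.exp (Complex.I * z * t) * h (shear t p)) :=
    ((measurable_cexp_mul_comp_shear z h).comp measurable_swap).stronglyMeasurable
  exact (hmeas.integral_prod_right (ν := volume.restrict (Ioi 0))).measurable.const_mul Complex.I

theorem laplace_shift_ae_eq_streamSolution (hz : 0 < z.im) (h : PhaseSpace) :
    (Complex.I • isIsometricGroup_shift.laplace hz) h =ᵐ[phaseMeasure] streamSolution z h := by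
  refine ae_eq_of_forall_setIntegral_eq_of_sigmaFinite (fun s _ hμs => ?_)
    (fun s _ hμs => (integrable_cexp_mul_comp_shear hz h hμs).swap.integral_prod_left.const_mul
      Complex.I) (fun s hs hμs => ?_)
  · have : IsFiniteMeasure (phaseMeasure.restrict s) := ⟨by simpa using hμs⟩
    exact ((Lp.memLp _).restrict s).integrable one_le_two
  · rw [← L2.inner_indicatorConstLp_one (𝕜 := ℂ) hs hμs.ne, _root_.smul_apply, inner_smul_right,
      ← innerSL_apply_apply ℂ, isIsometricGroup_shift.apply_laplace hz]
    simp only [streamSolution_eq]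
    rw [integral_const_mul, ← integral_integral_swap (integrable_cexp_mul_comp_shear hz h hμs)]
    congr 2
    ext1 t
    rw [innerSL_apply_apply, L2.inner_indicatorConstLp_one, integral_const_mul,
      integral_congr_ae (ae_restrict_of_ae (coeFn_shift t h))]

theorem isStreamingPair_of_ae_eq_streamSolution (hz : 0 < z.im) {f h : PhaseSpace}
    (hf : f =ᵐ[phaseMeasure] streamSolution z h) : IsStreamingPair f (h + z • f) := by
  have hac : ∀ᵐ μ ∂angleMeasure, ∀ a b,
      AbsolutelyContinuousOnInterval (fun x => streamSolution z h (x, μ)) a b := by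
    filter_upwards [ae_memLp_slice h, ae_angle_ne_zero] with μ hLp hμ
    exact absolutelyContinuousOnInterval_lineSolution (g := fun x => h (x, μ)) hz hμ hLp
  have hslice : ∀ᵐ μ ∂angleMeasure, ∀ᵐ x : ℝ,
      HasDerivAt (fun x => streamSolution z h (x, μ))
        ((h (x, μ) + z * streamSolution z h (x, μ)) / (Complex.I * μ)) x := by
    filter_upwards [ae_memLp_slice h, ae_angle_ne_zero] with μ hLp hμ
    exact ae_hasDerivAt_lineSolution (g := fun x => h (x, μ)) hz hμ hLp
  have hmeas := measurable_streamSolution z h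
  have hderiv := ae_hasDerivAt_of_ae_ae hmeas
    (D := fun p => (h p + z * streamSolution z h p) / (Complex.I * p.2))
    (((measurable_coeFn h).add (hmeas.const_mul z)).div (by fun_prop))
    (hac.mono fun μ hμ => continuous_of_absolutelyContinuousOnInterval hμ) hslice
  refine ⟨streamSolution z h, hf, hac, ?_⟩
  filter_upwards [hderiv, Measure.quasiMeasurePreserving_snd.ae ae_angle_ne_zero, hf,
    Lp.coeFn_add h (z • f), Lp.coeFn_smul z f] with p hd hμ hfp hadd hsmul
  refine ⟨hd.differentiableAt, ?_⟩
  rw [hd.deriv, hadd, Pi.add_apply, hsmul, Pi.smul_apply, hfp, smul_eq_mul]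
  have hμ' : (p.2 : ℂ) ≠ 0 := Complex.ofReal_ne_zero.2 hμ
  field_simp

end StreamSolution

section StreamingResolvent
variable {z : ℂ}

theorem IsStreamingPair.eq_zero_of_eigen (hz : z.im ≠ 0) {f : PhaseSpace}
    (h : IsStreamingPair f (z • f)) : f = 0 := by
  obtain ⟨F, hF, hac, hderiv⟩ := h
  have hslice : ∀ᵐ μ ∂angleMeasure, (fun x => F (x, μ)) = 0 := by
    filter_upwards [hac, ae_ae_swap_of_ae_phaseMeasure hderiv, ae_ae_swap_of_ae_phaseMeasure hF,
      ae_ae_swap_of_ae_phaseMeasure (Lp.coeFn_smul z f), ae_memLp_slice f, ae_angle_ne_zero]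
      with μ hacμ hd hFμ hsmul hLp hμ
    have hμ' : (μ : ℂ) ≠ 0 := Complex.ofReal_ne_zero.2 hμ
    refine eq_zero_of_memLp_of_ae_hasDerivAt (c := Complex.I * z / μ) ?_ hacμ ?_ two_ne_zero
      ENNReal.ofNat_ne_top (hLp.ae_eq hFμ)
    · rw [Complex.div_ofReal_re, Complex.I_mul_re]
      exact div_ne_zero (neg_ne_zero.2 hz) hμ
    · filter_upwards [hd, hFμ, hsmul] with x hdx hFx hsmulx
      have heq := hdx.2
      rw [hsmulx, Pi.smul_apply, smul_eq_mul, hFx] at heq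
      refine hdx.1.hasDerivAt.congr_deriv ?_
      field_simp
      linear_combination Complex.I * heq + μ * deriv (fun x => F (x, μ)) x * Complex.I_sq
  rw [Lp.eq_zero_iff_ae_eq_zero]
  filter_upwards [Measure.quasiMeasurePreserving_snd.ae hslice, hF] with p hp hFp
  exact hFp.trans (congrFun hp p.1)

theorem isStreamingPair_iff {f g : PhaseSpace} :
    IsStreamingPair f g ↔ ∃ h : f ∈ streamingOp.domain, streamingOp ⟨f, h⟩ = g := by
  change (f, g) ∈ streamingGraph ↔ _
  rw [← streamingGraph.toLinearPMap_graph_eq streamingGraph_functional]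
  change (f, g) ∈ streamingOp.graph ↔ _
  rw [LinearPMap.mem_graph_iff]
  refine ⟨?_, fun ⟨h, hg⟩ => ⟨⟨f, h⟩, rfl, hg⟩⟩
  rintro ⟨y, rfl, rfl⟩
  exact ⟨y.2, rfl⟩

theorem isResolventAt_streamingOp (hz : 0 < z.im) :
    IsResolventAt streamingOp z (Complex.I • isIsometricGroup_shift.laplace hz) := by
  set R := Complex.I • isIsometricGroup_shift.laplace hz
  have hright : ∀ f, ∃ h : R f ∈ streamingOp.domain, streamingOp ⟨R f, h⟩ - z • R f = f := by
    intro f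
    obtain ⟨h, heq⟩ := isStreamingPair_iff.1 (isStreamingPair_of_ae_eq_streamSolution hz
      (laplace_shift_ae_eq_streamSolution hz f))
    exact ⟨h, by rw [heq, add_sub_cancel_right]⟩
  refine ⟨hright, fun u => ?_⟩
  obtain ⟨hdom, heq⟩ := hright (streamingOp u - z • (u : PhaseSpace))
  set v := R (streamingOp u - z • (u : PhaseSpace))
  have hpair : IsStreamingPair (v - u) (z • (v - u)) := by
    refine isStreamingPair_iff.2 ⟨sub_mem hdom u.2, ?_⟩
    change streamingOp (⟨v, hdom⟩ - u) = z • (v - u)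
    rwa [LinearPMap.map_sub, smul_sub, sub_eq_sub_iff_sub_eq_sub]
  exact sub_eq_zero.1 (hpair.eq_zero_of_eigen hz.ne')

theorem dense_streamingOp_domain : Dense (streamingOp.domain : Set PhaseSpace) := by
  intro f
  refine mem_closure_of_tendsto (isIsometricGroup_shift.tendsto_smul_laplace f)
    (Eventually.of_forall fun n => Submodule.smul_mem _ _ ?_)
  obtain ⟨h, -⟩ := (isResolventAt_streamingOp (z := Complex.I * ((n + 1 : ℝ) : ℂ))
    (by simpa using n.cast_add_one_pos (α := ℝ))).1 f
  have hmem := Submodule.smul_mem _ (-Complex.I) h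
  rwa [_root_.smul_apply, smul_smul, neg_mul, Complex.I_mul_I, neg_neg, one_smul] at hmem

theorem isDissipative_I_smul_resolvent (hz : 0 < z.im) :
    IsDissipative (Complex.I • (Complex.I • isIsometricGroup_shift.laplace hz)) := by
  intro f
  rw [smul_smul, Complex.I_mul_I, neg_smul, one_smul, _root_.neg_apply, inner_neg_right,
    map_neg, neg_nonpos]
  exact (isIsometricGroup_shift.re_inner_laplace hz f).ge.trans' (by positivity)

end StreamingResolvent

theorem coeFn_finsetSum_ae_eq {α ι F : Type*} [MeasurableSpace α] [NormedAddCommGroup F]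
    {p : ℝ≥0∞} {μ : Measure α} (s : Finset ι) {v : ι → Lp F p μ} {g : ι → α → F}
    (h : ∀ i, v i =ᵐ[μ] g i) : ⇑(∑ i ∈ s, v i) =ᵐ[μ] fun a => ∑ i ∈ s, g i a := by
  filter_upwards [Lp.coeFn_finsetSum s v,
    (eventually_countable_ball s.countable_toSet).2 fun i _ => h i] with a hsum hg
  rw [hsum, Finset.sum_apply]
  exact Finset.sum_congr rfl hg

theorem coeFn_smul_ae_eq {α F 𝕜 : Type*} [MeasurableSpace α] [NormedAddCommGroup F]
    [NormedRing 𝕜] [Module 𝕜 F] [IsBoundedSMul 𝕜 F] {p : ℝ≥0∞} {μ : Measure α} {v : Lp F p μ}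
    {g : α → F} (a : 𝕜) (h : v =ᵐ[μ] g) : ⇑(a • v) =ᵐ[μ] fun x => a • g x :=
  (Lp.coeFn_smul a v).trans (h.const_smul a)

theorem memLp_top_sqrt {α : Type*} [MeasurableSpace α] {μ : Measure α} {f : α → ℝ}
    (hf : MemLp f ∞ μ) : MemLp (fun x => √(f x)) ∞ μ := by
  refine ((memLp_top_const (1 : ℝ)).add hf.norm).mono
    (Real.continuous_sqrt.comp_aestronglyMeasurable hf.1) (Eventually.of_forall fun x => ?_)
  rw [Pi.add_apply, Real.norm_of_nonneg (Real.sqrt_nonneg _),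
    Real.norm_of_nonneg (by positivity), Real.sqrt_le_left (by positivity)]
  nlinarith [le_abs_self (f x), abs_nonneg (f x), Real.norm_eq_abs (f x)]

theorem memLp_mul_of_ae_bounded_support {f g : ℝ → ℝ} {R : ℝ} (p : ℝ≥0∞)
    (hf : MemLp f ∞ volume) (hR : ∀ᵐ x, R < |x| → f x = 0) (hg : Continuous g) :
    MemLp (fun x => f x * g x) p volume := by
  have hg_ind : MemLp ((Icc (-R) R).indicator g) p volume := by
    rw [memLp_indicator_iff_restrict measurableSet_Icc]
    obtain ⟨C, hC⟩ := isCompact_Icc.exists_bound_of_continuousOn (s := Icc (-R) R) hg.continuousOn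
    exact MemLp.of_bound hg.aestronglyMeasurable C (ae_restrict_of_forall_mem measurableSet_Icc hC)
  refine (hg_ind.mul' hf).ae_eq ?_
  filter_upwards [hR] with x hx
  by_cases hmem : x ∈ Icc (-R) R
  · rw [indicator_of_mem hmem]
  · rw [hx (not_le.1 fun h => hmem (abs_le.1 h)), zero_mul, zero_mul]

theorem coe_compress_apply {H : Type*} [NormedAddCommGroup H] [InnerProductSpace ℂ H]
    [CompleteSpace H] {V W : H →L[ℂ] H} (hWV : W * W = V) (hW : 0 ≤ W) (X : H →L[ℂ] H)
    (e : rangeClosure V) : (compress V X e : H) = W (X (W e)) := by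
  change CFC.sqrt V (X (CFC.sqrt V e)) = _
  rw [CFC.sqrt_unique hWV hW]

theorem integrable_angleMeasure_of_continuous {F : Type*} [NormedAddCommGroup F] {f : ℝ → F}
    (hf : Continuous f) : Integrable f angleMeasure :=
  hf.continuousOn.integrableOn_Icc

theorem memLp_tensor {φ : ℝ → ℝ} (hφ : MemLp φ 2 volume) (p : Polynomial ℝ) :
    MemLp (fun q : ℝ × ℝ => ((φ q.1 * p.eval q.2 : ℝ) : ℂ)) 2 phaseMeasure := by
  have hmeas : AEStronglyMeasurable (fun q : ℝ × ℝ => ((φ q.1 * p.eval q.2 : ℝ) : ℂ))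
      phaseMeasure :=
    Complex.continuous_ofReal.comp_aestronglyMeasurable
      (hφ.1.comp_fst.mul (p.continuous.comp continuous_snd).aestronglyMeasurable)
  rw [memLp_two_iff_integrable_sq_norm hmeas]
  refine (((memLp_two_iff_integrable_sq hφ.1).1 hφ).mul_prod
    (integrable_angleMeasure_of_continuous (p.continuous.pow 2))).congr
    (Eventually.of_forall fun q => ?_)
  simp only [Complex.norm_real, Real.norm_eq_abs, sq_abs, mul_pow, Pi.pow_apply]

/-- The vector `(x, μ) ↦ φ(x) p(μ)` of `L²(ℝ × [-1, 1])`. -/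
def tensor {φ : ℝ → ℝ} (hφ : MemLp φ 2 volume) (p : Polynomial ℝ) : PhaseSpace :=
  (memLp_tensor hφ p).toLp _

theorem coeFn_tensor {φ : ℝ → ℝ} (hφ : MemLp φ 2 volume) (p : Polynomial ℝ) :
    tensor hφ p =ᵐ[phaseMeasure] fun q : ℝ × ℝ => ((φ q.1 * p.eval q.2 : ℝ) : ℂ) :=
  (memLp_tensor hφ p).coeFn_toLp

theorem integral_inner_tensor_ae_eq {φ : ℝ → ℝ} (hφ : MemLp φ 2 volume) (p : Polynomial ℝ)
    (f : PhaseSpace) : (fun x => ∫ μ, ⟪tensor hφ p (x, μ), f (x, μ)⟫_ℂ ∂angleMeasure) =ᵐ[volume]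
      fun x => (φ x : ℂ) * angleAverage p f x := by
  filter_upwards [Measure.ae_ae_of_ae_prod (coeFn_tensor hφ p)] with x hx
  rw [angleAverage, ← integral_const_mul]
  refine integral_congr_ae ?_
  filter_upwards [hx] with μ hμ
  rw [hμ, RCLike.inner_apply, Complex.conj_ofReal]
  push_cast
  ring

theorem integrable_mul_angleAverage {φ : ℝ → ℝ} (hφ : MemLp φ 2 volume) (p : Polynomial ℝ)
    (f : PhaseSpace) : Integrable fun x => (φ x : ℂ) * angleAverage p f x :=
  (L2.integrable_inner (𝕜 := ℂ) (tensor hφ p) f).integral_prod_left.congr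
    (integral_inner_tensor_ae_eq hφ p f)

theorem inner_tensor {φ : ℝ → ℝ} (hφ : MemLp φ 2 volume) (p : Polynomial ℝ) (f : PhaseSpace) :
    ⟪tensor hφ p, f⟫_ℂ = ∫ x, (φ x : ℂ) * angleAverage p f x := by
  rw [L2.inner_def, integral_prod _ (L2.integrable_inner (𝕜 := ℂ) (tensor hφ p) f),
    integral_congr_ae (integral_inner_tensor_ae_eq hφ p f)]

namespace Medium
variable (d : Medium)

theorem V_nonneg : 0 ≤ d.V := by
  rw [ContinuousLinearMap.nonneg_iff_isPositive, ContinuousLinearMap.isPositive_iff_complex]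
  intro u
  rw [(d.inner_V_self u).2]
  refine ⟨rfl, integral_nonneg_of_ae ?_⟩
  filter_upwards [d.c_nonneg] with x hx
  exact mul_nonneg hx (Finset.sum_nonneg fun i _ => by positivity)

theorem k_sq_mul_integral {κ : ℝ} (hκ : ∀ μ ∈ Icc (-1 : ℝ) 1,
    ∑ i, d.k i ^ 2 * (∫ μ', (d.P i).eval μ' ∂angleMeasure) * (d.P i).eval μ = κ) (j : Fin d.N) :
    d.k j ^ 2 * (∫ μ, (d.P j).eval μ ∂angleMeasure) =
      κ * ∫ μ, (d.P j).eval μ ∂angleMeasure := by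
  have hpair : ∫ μ, (∑ i, d.k i ^ 2 * (∫ μ', (d.P i).eval μ' ∂angleMeasure) * (d.P i).eval μ) *
      (d.P j).eval μ ∂angleMeasure = ∫ μ, κ * (d.P j).eval μ ∂angleMeasure := by
    refine integral_congr_ae ?_
    filter_upwards [ae_restrict_mem measurableSet_Icc] with μ hμ
    rw [hκ μ hμ]
  rw [← integral_const_mul κ, ← hpair]
  simp only [Finset.sum_mul, mul_assoc]
  rw [integral_finsetSum _ fun i _ => integrable_angleMeasure_of_continuous (by fun_prop)]
  simp [integral_const_mul, d.orthonormal]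

theorem eigenvalue_pos {κ : ℝ} (hκ₀ : κ ≠ 0) (hκ : ∀ μ ∈ Icc (-1 : ℝ) 1,
    ∑ i, d.k i ^ 2 * (∫ μ', (d.P i).eval μ' ∂angleMeasure) * (d.P i).eval μ = κ) : 0 < κ := by
  obtain ⟨j, hj⟩ : ∃ j, (∫ μ, (d.P j).eval μ ∂angleMeasure) ≠ 0 := by
    by_contra! hzero
    refine hκ₀ ?_
    rw [← hκ 0 (by simp)]
    simp only [hzero, mul_zero, zero_mul, Finset.sum_const_zero]
  rw [← mul_right_cancel₀ hj (d.k_sq_mul_integral hκ j)]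
  exact pow_pos (d.k_pos j) 2

theorem sum_k_mul_integral_mul_eval {κ : ℝ} (hκ : ∀ μ ∈ Icc (-1 : ℝ) 1,
    ∑ i, d.k i ^ 2 * (∫ μ', (d.P i).eval μ' ∂angleMeasure) * (d.P i).eval μ = κ) {μ : ℝ}
    (hμ : μ ∈ Icc (-1 : ℝ) 1) :
    ∑ i, d.k i * (∫ μ', (d.P i).eval μ' ∂angleMeasure) * (d.P i).eval μ = √κ := by
  rw [← Real.div_sqrt, ← hκ μ hμ, Finset.sum_div, hκ μ hμ]
  refine Finset.sum_congr rfl fun i _ => ?_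
  by_cases hzero : (∫ μ', (d.P i).eval μ' ∂angleMeasure) = 0
  · simp [hzero]
  · have hk := (d.k_pos i).ne'
    rw [← mul_right_cancel₀ hzero (d.k_sq_mul_integral hκ i), Real.sqrt_sq (d.k_pos i).le]
    field_simp

/-- The medium with `√c` and `√kᵢ` in place of `c` and `kᵢ`. By orthonormality of the `𝒫ᵢ` the
square of its operator `√c √K` is `V`, so this operator is `√V`. -/
def root : Medium where
  c x := √(d.c x)
  memLp_c := memLp_top_sqrt d.memLp_c
  c_nonneg := Eventually.of_forall fun x => Real.sqrt_nonneg _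
  c_support := d.c_support.imp fun R hR => hR.mono fun x hx h => by rw [hx h, Real.sqrt_zero]
  N := d.N
  k i := √(d.k i)
  k_pos i := Real.sqrt_pos.2 (d.k_pos i)
  P := d.P
  orthonormal := d.orthonormal
  const_eigen := by
    obtain ⟨κ, hκ₀, hκ⟩ := d.const_eigen
    refine ⟨√κ, (Real.sqrt_pos.2 (d.eigenvalue_pos hκ₀ hκ)).ne', fun μ hμ => ?_⟩
    simpa only [Real.sq_sqrt (d.k_pos _).le] using d.sum_k_mul_integral_mul_eval hκ hμ

theorem coeFn_root_V (f : PhaseSpace) : d.root.V f =ᵐ[phaseMeasure] fun q =>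
    (√(d.c q.1) : ℂ) * ∑ i, (d.k i : ℂ) *
      (angleAverage (d.P i) f q.1 * ((d.P i).eval q.2 : ℝ)) := by
  refine (d.root.coeFn_V f).trans (Eventually.of_forall fun q => ?_)
  change (√(d.c q.1) : ℂ) * ∑ i, ((√(d.k i) ^ 2 : ℝ) : ℂ) *
      (angleAverage (d.P i) f q.1 * ((d.P i).eval q.2 : ℝ)) = _
  simp only [Real.sq_sqrt (d.k_pos _).le]

theorem integral_sum_mul_eval_mul_eval (b : Fin d.N → ℂ) (i : Fin d.N) :
    ∫ μ, (∑ j, b j * ((d.P j).eval μ : ℝ)) * ((d.P i).eval μ : ℝ) ∂angleMeasure = b i := by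
  have horth (j : Fin d.N) : ∫ μ, (((d.P j).eval μ : ℝ) : ℂ) * ((d.P i).eval μ : ℝ) ∂angleMeasure =
      ((if j = i then 1 else 0 : ℝ) : ℂ) := by
    rw [← d.orthonormal, ← integral_complex_ofReal]
    simp only [Complex.ofReal_mul]
  simp only [Finset.sum_mul, mul_assoc]
  rw [integral_finsetSum _ fun j _ => integrable_angleMeasure_of_continuous (by fun_prop)]
  simp [integral_const_mul, horth, apply_ite Complex.ofReal]

theorem angleAverage_root_V (f : PhaseSpace) (i : Fin d.N) :
    angleAverage (d.P i) (d.root.V f) =ᵐ[volume] fun x =>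
      (√(d.c x) : ℂ) * (d.k i * angleAverage (d.P i) f x) := by
  filter_upwards [Measure.ae_ae_of_ae_prod (d.coeFn_root_V f)] with x hx
  rw [← d.integral_sum_mul_eval_mul_eval (fun j => d.k j * angleAverage (d.P j) f x) i,
    ← integral_const_mul]
  refine integral_congr_ae ?_
  filter_upwards [hx] with μ hμ
  simp only [hμ, mul_assoc]

theorem root_V_mul_self : d.root.V * d.root.V = d.V := by
  ext1 f
  refine Lp.ext ?_
  filter_upwards [d.coeFn_root_V (d.root.V f), d.coeFn_V f,
    Measure.quasiMeasurePreserving_fst.ae (ae_all_iff.2 (d.angleAverage_root_V f)),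
    Measure.quasiMeasurePreserving_fst.ae d.c_nonneg] with q hroot hV haverage hc
  have hsq : (d.c q.1 : ℂ) = (√(d.c q.1) : ℂ) * (√(d.c q.1) : ℂ) := by
    rw [← Complex.ofReal_mul, Real.mul_self_sqrt hc]
  rw [mul_apply_eq_comp, hroot, hV, hsq, Finset.mul_sum, Finset.mul_sum]
  refine Finset.sum_congr rfl fun i _ => ?_
  rw [haverage i]
  push_cast
  ring

theorem coe_compress_V_apply (X : PhaseSpace →L[ℂ] PhaseSpace) (e : d.E) :
    (compress d.V X e : PhaseSpace) = d.root.V (X (d.root.V e)) :=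
  coe_compress_apply d.root_V_mul_self d.root.V_nonneg X e

end Medium

open Finset.HasAntidiagonal (antidiagonal)

theorem ofReal_eval_sub_div {p : Polynomial ℝ} {M : ℕ} (hM : p.natDegree < M) (t x τ : ℝ) :
    ((p.eval ((t - x) / τ) : ℝ) : ℂ) = ∑ m ∈ Finset.range M, ((τ : ℂ) ^ m)⁻¹ *
      ∑ q ∈ antidiagonal m,
        ((p.coeff m * (-1) ^ q.1 * m.choose q.1 : ℝ) * (x : ℂ) ^ q.1) * (t : ℂ) ^ q.2 := by
  rw [Polynomial.eval_eq_sum_range' hM, Complex.ofReal_sum]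
  refine Finset.sum_congr rfl fun m _ => ?_
  rw [div_pow, sub_eq_neg_add, (Commute.all _ _).add_pow', Finset.sum_div, Finset.mul_sum,
    Finset.mul_sum, Complex.ofReal_sum]
  refine Finset.sum_congr rfl fun q _ => ?_
  rw [neg_pow x, nsmul_eq_mul]
  push_cast
  ring

section Moments
variable {φ : ℝ → ℂ} (hφ : ∀ l : ℕ, Integrable fun t : ℝ => (t : ℂ) ^ l * φ t)
  {p : Polynomial ℝ} {M : ℕ} (hM : p.natDegree < M) (x τ : ℝ)
include hφ

theorem integrable_eval_sub_div_mul :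
    Integrable fun t : ℝ => ((p.eval ((t - x) / τ) : ℝ) : ℂ) * φ t := by
  simp only [ofReal_eval_sub_div p.natDegree.lt_succ_self, Finset.sum_mul, Finset.mul_sum,
    mul_assoc]
  refine integrable_finsetSum _ fun m _ => integrable_finsetSum _ fun q _ => ?_
  exact ((((hφ q.2).const_mul _).const_mul _).const_mul _)

include hM in
theorem integral_eval_sub_div_mul :
    ∫ t : ℝ, ((p.eval ((t - x) / τ) : ℝ) : ℂ) * φ t = ∑ m ∈ Finset.range M, ((τ : ℂ) ^ m)⁻¹ *
      ∑ q ∈ antidiagonal m, ((p.coeff m * (-1) ^ q.1 * m.choose q.1 : ℝ) * (x : ℂ) ^ q.1) *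
        ∫ t : ℝ, (t : ℂ) ^ q.2 * φ t := by
  have hint (m : ℕ) (q : ℕ × ℕ) : Integrable fun t : ℝ =>
      (p.coeff m * (-1) ^ q.1 * m.choose q.1 : ℝ) * (x : ℂ) ^ q.1 * ((t : ℂ) ^ q.2 * φ t) :=
    (hφ q.2).const_mul _
  simp only [ofReal_eval_sub_div hM, Finset.sum_mul, mul_assoc (_⁻¹ : ℂ)]
  rw [integral_finsetSum _ fun m _ => ?_]
  · refine Finset.sum_congr rfl fun m _ => ?_
    rw [integral_const_mul]
    simp only [mul_assoc _ ((_ : ℂ) ^ _) (φ _)]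
    rw [integral_finsetSum _ fun q _ => hint m q]
    simp only [integral_const_mul]
  · simp only [mul_assoc _ ((_ : ℂ) ^ _) (φ _)]
    exact (integrable_finsetSum _ fun q _ => hint m q).const_mul _

end Moments

theorem integral_comp_add_mul_angleMeasure {F : Type*} [NormedAddCommGroup F] [NormedSpace ℝ F]
    {G : ℝ → F} {x τ : ℝ} (hτ : 0 < τ) (hG : ∀ᵐ t, τ < |t - x| → G t = 0) :
    ∫ μ, G (x + τ * μ) ∂angleMeasure = τ⁻¹ • ∫ t, G t := by
  have hsub : ∫ μ, G (x + τ * μ) ∂angleMeasure = ∫ μ in (-1 : ℝ)..1, G (x + τ * μ) := by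
    rw [intervalIntegral.integral_of_le (by norm_num), ← integral_Icc_eq_integral_Ioc]
  rw [hsub, intervalIntegral.integral_comp_add_mul _ hτ.ne',
    intervalIntegral.integral_of_le (by linarith), ← integral_Icc_eq_integral_Ioc]
  congr 1
  refine setIntegral_eq_integral_of_ae_compl_eq_zero ?_
  filter_upwards [hG] with t ht hmem
  refine ht (lt_of_not_ge fun hle => hmem ?_)
  rw [abs_le] at hle
  constructor <;> linarith

namespace Medium
variable (d : Medium)

theorem memLp_sqrt_mul_pow (l : ℕ) : MemLp (fun x => √(d.c x) * x ^ l) 2 volume := by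
  obtain ⟨R, hR⟩ := d.root.c_support
  exact memLp_mul_of_ae_bounded_support 2 d.root.memLp_c hR (continuous_pow l)

/-- The vector `√c(x) x^l 𝒫ᵢ(μ)`. -/
def moment (i : Fin d.N) (l : ℕ) : PhaseSpace := tensor (d.memLp_sqrt_mul_pow l) (d.P i)

theorem coeFn_moment (i : Fin d.N) (l : ℕ) : d.moment i l =ᵐ[phaseMeasure]
    fun q : ℝ × ℝ => (√(d.c q.1) : ℂ) * (q.1 : ℂ) ^ l * ((d.P i).eval q.2 : ℝ) := by
  refine (coeFn_tensor _ _).trans (Eventually.of_forall fun q => ?_)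
  push_cast
  rfl

theorem integrable_pow_mul_angleAverage (i : Fin d.N) (f : PhaseSpace) (l : ℕ) :
    Integrable fun t : ℝ => (t : ℂ) ^ l * ((√(d.c t) : ℂ) * angleAverage (d.P i) f t) := by
  refine (integrable_mul_angleAverage (d.memLp_sqrt_mul_pow l) (d.P i) f).congr
    (Eventually.of_forall fun t => ?_)
  push_cast
  ring

theorem inner_moment (i : Fin d.N) (l : ℕ) (f : PhaseSpace) : ⟪d.moment i l, f⟫_ℂ =
    ∫ t : ℝ, (t : ℂ) ^ l * ((√(d.c t) : ℂ) * angleAverage (d.P i) f t) := by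
  refine (inner_tensor _ _ _).trans (integral_congr_ae (Eventually.of_forall fun t => ?_))
  push_cast
  ring

theorem ell_eq_sum : (d.ell : PhaseSpace) =
    ∑ i, ((d.k i * (d.P i).eval 0 : ℝ) : ℂ) • d.moment i 0 := by
  refine Lp.ext (d.memLp_ellFun.coeFn_toLp.trans ?_)
  refine ((coeFn_finsetSum_ae_eq Finset.univ fun i => coeFn_smul_ae_eq _ (d.coeFn_moment i 0)).trans
    (Eventually.of_forall fun q => ?_)).symm
  rw [ellFun]
  push_cast
  rw [Finset.mul_sum]
  refine Finset.sum_congr rfl fun i _ => ?_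
  rw [smul_eq_mul]
  ring

/-- The coefficient of `τ^(-m-1)` in `√V e^{-iτL₀} √V` for large `τ`; it is the contribution of the
monomials of degree `m` of the polynomials `𝒫ⱼ 𝒫ᵢ`. -/
def tailCoeff (m : ℕ) : PhaseSpace →L[ℂ] PhaseSpace :=
  ∑ i, ∑ j, ∑ q ∈ antidiagonal m,
    ((d.k i * d.k j * ((d.P j * d.P i).coeff m * (-1) ^ q.1 * m.choose q.1) : ℝ) : ℂ) •
      InnerProductSpace.rankOne ℂ (d.moment i q.1) (d.moment j q.2)

/-- The coefficient of `τ^(-m-1)` in the angular average of `e^{-iτL₀} √V f` against `𝒫ᵢ`, for large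
`τ` and `x` in the support of `c`. -/
def tailAverage (f : PhaseSpace) (i : Fin d.N) (m : ℕ) (x : ℝ) : ℂ :=
  ∑ j, d.k j * ∑ q ∈ antidiagonal m,
    (((d.P j * d.P i).coeff m * (-1) ^ q.1 * m.choose q.1 : ℝ) * (x : ℂ) ^ q.1) *
      ⟪d.moment j q.2, f⟫_ℂ

theorem tailCoeff_zero :
    d.tailCoeff 0 = InnerProductSpace.rankOne ℂ (d.ell : PhaseSpace) (d.ell : PhaseSpace) := by
  ext1 f
  simp only [tailCoeff, ell_eq_sum, Finset.Nat.antidiagonal_zero, Finset.sum_singleton, sum_inner,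
    _root_.sum_apply, _root_.smul_apply, InnerProductSpace.rankOne_apply, Finset.sum_smul,
    Finset.smul_sum, inner_smul_left, Complex.conj_ofReal, smul_smul,
    Polynomial.coeff_zero_eq_eval_zero, Polynomial.eval_mul, pow_zero, Nat.choose_zero_right,
    Finset.sum_mul]
  refine Finset.sum_congr rfl fun i _ => Finset.sum_congr rfl fun j _ => ?_
  push_cast
  ring_nf

theorem coeFn_tailCoeff (m : ℕ) (f : PhaseSpace) : d.tailCoeff m f =ᵐ[phaseMeasure] fun q =>
    (√(d.c q.1) : ℂ) * ∑ i, (d.k i : ℂ) * (d.tailAverage f i m q.1 * ((d.P i).eval q.2 : ℝ)) := by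
  have hsum (b : Fin d.N → Fin d.N → ℕ × ℕ → ℂ) :
      ⇑(∑ i, ∑ j, ∑ l ∈ antidiagonal m, b i j l • d.moment i l.1) =ᵐ[phaseMeasure] fun q =>
        ∑ i, ∑ j, ∑ l ∈ antidiagonal m,
          b i j l • ((√(d.c q.1) : ℂ) * (q.1 : ℂ) ^ l.1 * ((d.P i).eval q.2 : ℝ)) :=
    coeFn_finsetSum_ae_eq _ fun i => coeFn_finsetSum_ae_eq _ fun j =>
      coeFn_finsetSum_ae_eq _ fun l => coeFn_smul_ae_eq (b i j l) (d.coeFn_moment i l.1)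
  simp only [tailCoeff, _root_.sum_apply, _root_.smul_apply, InnerProductSpace.rankOne_apply,
    smul_smul]
  refine (hsum _).trans (Eventually.of_forall fun q => ?_)
  simp only [tailAverage, Finset.mul_sum, Finset.sum_mul, smul_eq_mul]
  refine Finset.sum_congr rfl fun i _ => Finset.sum_congr rfl fun j _ =>
    Finset.sum_congr rfl fun l _ => ?_
  push_cast
  ring

theorem ae_ae_shift_root_V (τ : ℝ) (f : PhaseSpace) :
    ∀ᵐ x : ℝ, ∀ᵐ μ ∂angleMeasure, shift τ (d.root.V f) (x, μ) =
      (√(d.c (x + τ * μ)) : ℂ) * ∑ j, (d.k j : ℂ) *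
        (angleAverage (d.P j) f (x + τ * μ) * ((d.P j).eval μ : ℝ)) := by
  refine Measure.ae_ae_of_ae_prod (p := fun q : ℝ × ℝ => shift τ (d.root.V f) q =
    (√(d.c (q.1 + τ * q.2)) : ℂ) * ∑ j, (d.k j : ℂ) *
        (angleAverage (d.P j) f (q.1 + τ * q.2) * ((d.P j).eval q.2 : ℝ))) ?_
  filter_upwards [coeFn_shift τ (d.root.V f),
    (measurePreserving_shear τ).quasiMeasurePreserving.ae (d.coeFn_root_V f)] with q hshift hroot
  rw [hshift, hroot]
  rfl

section LargeTime
variable {R τ : ℝ} (hR : ∀ᵐ x, R < |x| → d.c x = 0) (hτR : 2 * R < τ) (hτ : 0 < τ)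
include hR hτR hτ

-- In the variable `t = x + τμ` the range `|μ| ≤ 1` covers the whole support of `c`.
theorem angleAverage_shift_root_V_eq_integral (f : PhaseSpace) (i : Fin d.N) :
    ∀ᵐ x : ℝ, |x| ≤ R → angleAverage (d.P i) (shift τ (d.root.V f)) x =
      (τ : ℂ)⁻¹ * ∑ j, d.k j * ∫ t : ℝ, (((d.P j * d.P i).eval ((t - x) / τ) : ℝ) : ℂ) *
        ((√(d.c t) : ℂ) * angleAverage (d.P j) f t) := by
  filter_upwards [d.ae_ae_shift_root_V τ f] with x hx hxR
  set G : ℝ → ℂ := fun t => ∑ j, d.k j * ((((d.P j * d.P i).eval ((t - x) / τ) : ℝ) : ℂ) *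
    ((√(d.c t) : ℂ) * angleAverage (d.P j) f t)) with hG
  have hsubst : angleAverage (d.P i) (shift τ (d.root.V f)) x =
      ∫ μ, G (x + τ * μ) ∂angleMeasure := by
    refine integral_congr_ae ?_
    filter_upwards [hx] with μ hμ
    simp only [hμ, hG, add_sub_cancel_left, mul_div_cancel_left₀ _ hτ.ne', Polynomial.eval_mul,
      Finset.mul_sum, Finset.sum_mul]
    refine Finset.sum_congr rfl fun j _ => ?_
    push_cast
    ring
  have hsupp : ∀ᵐ t, τ < |t - x| → G t = 0 := by
    filter_upwards [hR] with t ht hfar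
    have hc : d.c t = 0 := ht (by linarith [abs_sub t x])
    simp only [hG, hc, Real.sqrt_zero, Complex.ofReal_zero, zero_mul, mul_zero,
      Finset.sum_const_zero]
  rw [hsubst, integral_comp_add_mul_angleMeasure hτ hsupp, Complex.real_smul, Complex.ofReal_inv,
    integral_finsetSum _ fun j _ => (integrable_eval_sub_div_mul
      (d.integrable_pow_mul_angleAverage j f) x τ).const_mul _]
  simp only [integral_const_mul]

variable {M : ℕ} (hM : ∀ i j, (d.P j * d.P i).natDegree < M)
include hM

theorem angleAverage_shift_root_V (f : PhaseSpace) (i : Fin d.N) :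
    ∀ᵐ x : ℝ, |x| ≤ R → angleAverage (d.P i) (shift τ (d.root.V f)) x =
      ∑ m ∈ Finset.range M, ((τ : ℂ) ^ (m + 1))⁻¹ * d.tailAverage f i m x := by
  filter_upwards [d.angleAverage_shift_root_V_eq_integral hR hτR hτ f i] with x hx hxR
  simp only [hx hxR, integral_eval_sub_div_mul (d.integrable_pow_mul_angleAverage _ f) (hM _ _),
    ← inner_moment]
  simp_rw [Finset.mul_sum (Finset.range M)]
  rw [Finset.sum_comm, Finset.mul_sum]
  refine Finset.sum_congr rfl fun m _ => ?_
  rw [tailAverage, Finset.mul_sum, Finset.mul_sum]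
  refine Finset.sum_congr rfl fun j _ => ?_
  rw [pow_succ, mul_inv]
  ring

theorem root_V_shift_root_V (f : PhaseSpace) : d.root.V (shift τ (d.root.V f)) =
    ∑ m ∈ Finset.range M, ((τ : ℂ) ^ (m + 1))⁻¹ • d.tailCoeff m f := by
  refine Lp.ext ?_
  filter_upwards [d.coeFn_root_V (shift τ (d.root.V f)),
    Measure.quasiMeasurePreserving_fst.ae
      (ae_all_iff.2 (d.angleAverage_shift_root_V hR hτR hτ hM f)),
    Measure.quasiMeasurePreserving_fst.ae hR,
    coeFn_finsetSum_ae_eq (Finset.range M) fun m =>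
      coeFn_smul_ae_eq ((τ : ℂ) ^ (m + 1))⁻¹ (d.coeFn_tailCoeff m f)]
    with q hroot haverage hsupp htail
  rw [hroot, htail]
  by_cases hq : |q.1| ≤ R
  · simp only [haverage _ hq, smul_eq_mul, Finset.mul_sum, Finset.sum_mul]
    rw [Finset.sum_comm]
    refine Finset.sum_congr rfl fun m _ => Finset.sum_congr rfl fun i _ => ?_
    ring
  · simp only [hsupp (not_le.1 hq), Real.sqrt_zero, Complex.ofReal_zero, zero_mul, smul_zero,
      Finset.sum_const_zero]

end LargeTime

theorem exists_natDegree_mul_lt : ∃ M : ℕ, ∀ i j, (d.P j * d.P i).natDegree < M + 1 := by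
  obtain ⟨M, hM⟩ := (Set.finite_range fun ij : Fin d.N × Fin d.N =>
    (d.P ij.2 * d.P ij.1).natDegree).bddAbove
  exact ⟨M, fun i j => Nat.lt_succ_of_le (hM ⟨(i, j), rfl⟩)⟩

end Medium

section TruncatedLaplace

/-- Lebesgue measure on the interval `[0, a]`, as a measure on the subtype. -/
abbrev timeMeasure (a : ℝ) : Measure (Icc (0 : ℝ) a) := Measure.comap Subtype.val volume

instance (a : ℝ) : IsFiniteMeasure (timeMeasure a) := by
  refine ⟨?_⟩
  rw [comap_subtype_coe_apply measurableSet_Icc, image_univ, Subtype.range_coe]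
  exact measure_Icc_lt_top

/-- The function `t ↦ it` on `[0, a]`. Its exponentials in the Banach algebra `C([0, a], ℂ)` are the
kernels of the truncated Laplace transform. -/
def timeFunction (a : ℝ) : C(Icc (0 : ℝ) a, ℂ) where
  toFun t := Complex.I * (t : ℝ)
  continuous_toFun := by fun_prop

theorem exp_smul_timeFunction_apply (a : ℝ) (z : ℂ) (t : Icc (0 : ℝ) a) :
    NormedSpace.exp (z • timeFunction a) t = Complex.exp (Complex.I * z * (t : ℝ)) := by
  let _ : NormedAlgebra ℚ C(Icc (0 : ℝ) a, ℂ) := NormedAlgebra.restrictScalars ℚ ℂ _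
  refine (NormedSpace.map_exp (ContinuousMap.evalAlgHom (X := Icc (0 : ℝ) a) ℂ ℂ t)
    (continuous_eval_const t) (z • timeFunction a)).trans ?_
  rw [← Complex.exp_eq_exp_ℂ, mul_comm Complex.I, mul_assoc]
  rfl

namespace IsIsometricGroup
variable {E : Type*} [NormedAddCommGroup E] [NormedSpace ℂ E] {U : ℝ → E →L[ℂ] E}

theorem norm_smul_apply_le (hU : IsIsometricGroup U) {a : ℝ} (φ : C(Icc (0 : ℝ) a, ℂ)) (f : E)
    (t : Icc (0 : ℝ) a) : ‖φ t • U t f‖ ≤ ‖φ‖ * ‖f‖ := by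
  rw [norm_smul, hU.norm_apply]
  gcongr
  exact φ.norm_coe_le_norm t

theorem integrable_smul_apply (hU : IsIsometricGroup U) {a : ℝ} (φ : C(Icc (0 : ℝ) a, ℂ)) (f : E) :
    Integrable (fun t : Icc (0 : ℝ) a => φ t • U t f) (timeMeasure a) :=
  Integrable.of_bound
    (φ.continuous.smul ((hU.continuous_apply f).comp continuous_subtype_val)).aestronglyMeasurable
    (‖φ‖ * ‖f‖) (Eventually.of_forall fun t => hU.norm_smul_apply_le φ f t)

/-- The operator-valued integral `φ ↦ ∫₀ᵃ φ(t) U(t) dt`. -/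
def kernelIntegral (hU : IsIsometricGroup U) (a : ℝ) : C(Icc (0 : ℝ) a, ℂ) →L[ℂ] E →L[ℂ] E :=
  LinearMap.mkContinuous₂
    (LinearMap.mk₂ ℂ
      (fun (φ : C(Icc (0 : ℝ) a, ℂ)) (f : E) => ∫ t, φ t • U t f ∂timeMeasure a)
      (fun φ ψ f => by
        simp only [ContinuousMap.add_apply, add_smul]
        exact integral_add (hU.integrable_smul_apply φ f) (hU.integrable_smul_apply ψ f))
      (fun b φ f => by
        simp only [ContinuousMap.smul_apply, smul_assoc]
        exact integral_smul b _)
      (fun φ f g => by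
        simp only [map_add, smul_add]
        exact integral_add (hU.integrable_smul_apply φ f) (hU.integrable_smul_apply φ g))
      (fun b φ f => by
        simp only [map_smul, smul_comm _ b]
        exact integral_smul b _))
    ((timeMeasure a).real univ)
    (fun φ f => by
      rw [mul_assoc, mul_comm]
      exact norm_integral_le_of_norm_le_const
        (Eventually.of_forall fun t => hU.norm_smul_apply_le φ f t))

/-- The truncated Laplace transform `∫₀ᵃ exp(izt) U(t) dt`, an entire function of `z`. -/
def truncatedLaplace (hU : IsIsometricGroup U) (a : ℝ) (z : ℂ) : E →L[ℂ] E :=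
  hU.kernelIntegral a (NormedSpace.exp (z • timeFunction a))

theorem truncatedLaplace_apply (hU : IsIsometricGroup U) (a : ℝ) (z : ℂ) (f : E) :
    hU.truncatedLaplace a z f =
      ∫ t in Icc (0 : ℝ) a, Complex.exp (Complex.I * z * t) • U t f := by
  rw [← integral_subtype_comap measurableSet_Icc]
  refine integral_congr_ae (Eventually.of_forall fun t => ?_)
  simp only [exp_smul_timeFunction_apply]

theorem differentiable_truncatedLaplace (hU : IsIsometricGroup U) (a : ℝ) :
    Differentiable ℂ (hU.truncatedLaplace a) := fun z =>
  (hU.kernelIntegral a).differentiableAt.comp z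
    (hasDerivAt_exp_smul_const (timeFunction a) z).differentiableAt

theorem laplace_sub_truncatedLaplace_apply (hU : IsIsometricGroup U) {a : ℝ} (ha : 0 ≤ a) {z : ℂ}
    (hz : 0 < z.im) (f : E) : (hU.laplace hz - hU.truncatedLaplace a z) f =
      ∫ t in Ioi a, Complex.exp (Complex.I * z * t) • U t f := by
  have hint := hU.integrableOn_cexp_smul hz f 0
  rw [_root_.sub_apply, sub_eq_iff_eq_add', truncatedLaplace_apply, integral_Icc_eq_integral_Ioc,
    laplace_apply, ← Ioc_union_Ioi_eq_Ioi ha, setIntegral_union (Ioc_disjoint_Ioi le_rfl)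
      measurableSet_Ioi (hint.mono_set Ioc_subset_Ioi_self) (hint.mono_set (Ioi_subset_Ioi ha))]

end IsIsometricGroup

end TruncatedLaplace

section OrthogonalCompression
variable {H : Type*} [NormedAddCommGroup H] [InnerProductSpace ℂ H] (K : Submodule ℂ H)
  [K.HasOrthogonalProjection]

/-- The compression `P_K X|_K` of an operator to a closed subspace. -/
def orthogonalCompression : (H →L[ℂ] H) →ₗ[ℂ] K →L[ℂ] K where
  toFun X := K.orthogonalProjectionOnto ∘L X ∘L K.subtypeL
  map_add' X Y := by rw [ContinuousLinearMap.add_comp, ContinuousLinearMap.comp_add]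
  map_smul' a X := by
    rw [ContinuousLinearMap.smul_comp, ContinuousLinearMap.comp_smul, RingHom.id_apply]

theorem orthogonalCompression_apply (X : H →L[ℂ] H) (e : K) :
    orthogonalCompression K X e = K.orthogonalProjectionOnto (X e) := rfl

theorem orthogonalCompression_rankOne (x y : K) :
    orthogonalCompression K (InnerProductSpace.rankOne ℂ (x : H) (y : H)) =
      InnerProductSpace.rankOne ℂ x y := by
  ext1 e
  rw [orthogonalCompression_apply, InnerProductSpace.rankOne_apply, map_smul,
    Submodule.orthogonalProjectionOnto_mem_subspace_eq_self, InnerProductSpace.rankOne_apply,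
    Submodule.coe_inner]

end OrthogonalCompression

theorem differentiable_compress {H : Type*} [NormedAddCommGroup H] [InnerProductSpace ℂ H]
    [CompleteSpace H] (V : H →L[ℂ] H) {X : ℂ → H →L[ℂ] H} (hX : Differentiable ℂ X) :
    Differentiable ℂ fun z => compress V (X z) :=
  (differentiable_const (sqrtTo V)).clm_comp (hX.clm_comp (differentiable_const (sqrtFrom V)))

theorem differentiable_neg_sub_sum_smul {W : Type*} [NormedAddCommGroup W] [NormedSpace ℂ W]
    {G : ℂ → W} (hG : Differentiable ℂ G) {ι : Type*} (s : Finset ι) {h : ι → ℂ → ℂ}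
    (hh : ∀ i, Differentiable ℂ (h i)) (C : ι → W) :
    Differentiable ℂ fun z => -G z - ∑ i ∈ s, h i z • C i :=
  hG.fun_neg.fun_sub (Differentiable.fun_sum fun i _ => (hh i).smul_const (C i))

namespace Medium
variable (d : Medium)

theorem compress_V_eq_orthogonalCompression (X : PhaseSpace →L[ℂ] PhaseSpace) :
    compress d.V X = orthogonalCompression d.E (d.root.V ∘L X ∘L d.root.V) := by
  ext1 e
  rw [orthogonalCompression_apply, ContinuousLinearMap.comp_apply, ContinuousLinearMap.comp_apply,
    ← coe_compress_V_apply, Submodule.orthogonalProjectionOnto_mem_subspace_eq_self]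

section Tail
variable {R a : ℝ} (hR : ∀ᵐ x, R < |x| → d.c x = 0) (haR : 2 * R ≤ a) (ha : 0 < a) {M : ℕ}
  (hM : ∀ i j, (d.P j * d.P i).natDegree < M) {z : ℂ} (hz : 0 < z.im)
include hR haR ha hM hz

theorem root_V_integral_Ioi (f : PhaseSpace) :
    d.root.V (∫ t in Ioi a, Complex.exp (Complex.I * z * t) • shift t (d.root.V f)) =
      ∑ m ∈ Finset.range M, expTail a m z • d.tailCoeff m f := by
  have hlarge : ∀ t ∈ Ioi a,
      d.root.V (Complex.exp (Complex.I * z * t) • shift t (d.root.V f)) =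
        ∑ m ∈ Finset.range M,
          (Complex.exp (Complex.I * z * t) * ((t : ℂ) ^ (m + 1))⁻¹) • d.tailCoeff m f := by
    intro t ht
    rw [map_smul, d.root_V_shift_root_V hR (haR.trans_lt ht) (ha.trans ht) hM, Finset.smul_sum]
    simp only [smul_smul]
  rw [← ContinuousLinearMap.integral_comp_comm _
      (isIsometricGroup_shift.integrableOn_cexp_smul hz _ a),
    setIntegral_congr_fun measurableSet_Ioi hlarge, integral_finsetSum _ fun m _ =>
      (integrableOn_cexp_mul_inv_pow ha (m + 1) hz).smul_const _]
  simp only [integral_smul_const]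
  rfl

theorem compress_laplace_sub_truncatedLaplace :
    compress d.V (isIsometricGroup_shift.laplace hz -
      isIsometricGroup_shift.truncatedLaplace a z) =
      ∑ m ∈ Finset.range M, expTail a m z • orthogonalCompression d.E (d.tailCoeff m) := by
  rw [compress_V_eq_orthogonalCompression]
  simp only [← map_smul, ← map_sum]
  congr 1
  ext1 f
  rw [ContinuousLinearMap.comp_apply, ContinuousLinearMap.comp_apply,
    isIsometricGroup_shift.laplace_sub_truncatedLaplace_apply ha.le]
  refine (d.root_V_integral_Ioi hR haR ha hM hz f).trans ?_
  simp only [_root_.sum_apply, _root_.smul_apply]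

end Tail

theorem Q_eq_neg_compress_laplace {z : ℂ} (hz : 0 < z.im) :
    d.Q z = -compress d.V (isIsometricGroup_shift.laplace hz) := by
  rw [Q, (isResolventAt_streamingOp hz).borderedResolvent_eq d.V, smul_smul, Complex.I_mul_I,
    neg_one_smul, map_neg]

theorem exists_Q_expansion : ∃ (M : ℕ) (A : ℕ → d.E →L[ℂ] d.E) (F : ℂ → d.E →L[ℂ] d.E),
    Differentiable ℂ F ∧ A 0 = InnerProductSpace.rankOne ℂ d.ell d.ell ∧
    ∀ z : ℂ, 0 < z.im → d.Q z =
      ∑ m ∈ Finset.range (M + 1), (z ^ m * Complex.log (-Complex.I * z)) • A m + F z := by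
  obtain ⟨R, hR⟩ := d.c_support
  obtain ⟨M, hM⟩ := d.exists_natDegree_mul_lt
  have ha : 0 < 2 * |R| + 1 := by positivity
  have haR : 2 * R ≤ 2 * |R| + 1 := by linarith [le_abs_self R]
  generalize 2 * |R| + 1 = a at ha haR
  choose h h_diff h_tail using fun m => exists_expTail_eq ha m
  let C (m : ℕ) : d.E →L[ℂ] d.E := orthogonalCompression d.E (d.tailCoeff m)
  refine ⟨M, fun m => (Complex.I ^ m / (m.factorial : ℂ)) • C m,
    fun z => -compress d.V (isIsometricGroup_shift.truncatedLaplace a z) -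
      ∑ m ∈ Finset.range (M + 1), h m z • C m, ?_, ?_, fun z hz => ?_⟩
  · exact differentiable_neg_sub_sum_smul (W := d.E →L[ℂ] d.E) (differentiable_compress d.V
      (isIsometricGroup_shift.differentiable_truncatedLaplace a)) _ h_diff C
  · simp only [pow_zero, Nat.factorial_zero, Nat.cast_one, div_one, one_smul]
    exact (congrArg _ d.tailCoeff_zero).trans (orthogonalCompression_rankOne _ _ _)
  · have htail := d.compress_laplace_sub_truncatedLaplace hR haR ha hM hz
    rw [map_sub, sub_eq_iff_eq_add'] at htail
    have hlog (m : ℕ) : z ^ m * Complex.log (-Complex.I * z) *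
        (Complex.I ^ m / (m.factorial : ℂ)) = h m z - expTail a m z := by
      rw [h_tail m z hz, mul_pow]
      ring
    rw [d.Q_eq_neg_compress_laplace hz, htail]
    ext1 e
    simp only [_root_.add_apply, _root_.sub_apply, _root_.neg_apply, _root_.sum_apply,
      _root_.smul_apply, smul_smul, hlog, sub_smul, Finset.sum_sub_distrib]
    abel

end Medium

namespace Medium
variable (d : Medium)

theorem integral_sum_mul_eval (a : Fin d.N → ℝ) (j : Fin d.N) :
    ∫ μ, (∑ i, a i * (d.P i).eval μ) * (d.P j).eval μ ∂angleMeasure = a j := by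
  simp only [Finset.sum_mul, mul_assoc]
  rw [integral_finsetSum _ fun i _ => integrable_angleMeasure_of_continuous (by fun_prop)]
  simp only [integral_const_mul, d.orthonormal, mul_ite, mul_one, mul_zero,
    Finset.sum_ite_eq', Finset.mem_univ, if_true]

theorem exists_eval_zero_ne_zero : ∃ i, (d.P i).eval 0 ≠ 0 := by
  obtain ⟨κ, hκ, heigen⟩ := d.const_eigen
  by_contra! hP
  refine hκ ?_
  rw [← heigen 0 (by simp)]
  simp [hP]

theorem ell_ne_zero (hc : ¬ d.c =ᵐ[volume] 0) : d.ell ≠ 0 := by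
  intro hell
  have hzero : d.ellFun =ᵐ[phaseMeasure] 0 :=
    d.memLp_ellFun.coeFn_toLp.symm.trans
      (Lp.eq_zero_iff_ae_eq_zero.1 (congrArg Subtype.val hell))
  obtain ⟨j, hj⟩ := d.exists_eval_zero_ne_zero
  refine hc ?_
  filter_upwards [Measure.ae_ae_of_ae_prod hzero, d.c_nonneg] with x hx hcx
  by_contra hne
  have hsqrt : √(d.c x) ≠ 0 := (Real.sqrt_pos.2 (lt_of_le_of_ne hcx (Ne.symm hne))).ne'
  have hsum : ∀ᵐ μ ∂angleMeasure, ∑ i, d.k i * (d.P i).eval 0 * (d.P i).eval μ = 0 := by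
    filter_upwards [hx] with μ hμ
    exact (mul_eq_zero.1 (Complex.ofReal_eq_zero.1 hμ)).resolve_left hsqrt
  have hcoeff := d.integral_sum_mul_eval (fun i => d.k i * (d.P i).eval 0) j
  rw [integral_eq_zero_of_ae (by filter_upwards [hsum] with μ hμ; simp [hμ])] at hcoeff
  exact mul_ne_zero (d.k_pos j).ne' hj hcoeff.symm

theorem isDissipative_Q {z : ℂ} (hz : 0 < z.im) : IsDissipative (d.Q z) := by
  rw [Q, (isResolventAt_streamingOp hz).borderedResolvent_eq d.V]
  exact (isDissipative_I_smul_resolvent hz).compress d.V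

theorem S_eq_cayleyTransform {z : ℂ} (hz : 0 < z.im) : d.S z = cayleyTransform (d.Q z) :=
  characteristicFunction_eq_cayleyTransform dense_streamingOp_domain (isResolventAt_streamingOp hz)
    (isDissipative_I_smul_resolvent hz) d.V_nonneg

theorem exists_isLogDissipative (hc : ¬ d.c =ᵐ[volume] 0) : ∃ Θ : ℂ → d.E →L[ℂ] d.E,
    IsLogDissipative d.ell d.B Θ ∧ ∀ z : ℂ, 0 < z.im → d.Q z = d.Qtilde z + Θ z := by
  obtain ⟨M, A, F, hF, hA, hQ⟩ := d.exists_Q_expansion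
  exact exists_isLogDissipative_of_expansion (d.ell_ne_zero hc) hF hA hQ fun z => d.isDissipative_Q

theorem rankOneTerm_eq (δ : ℝ) : d.rankOneTerm δ = leadingRankOne d.ell d.B δ :=
  (leadingRankOne_eq ..).symm

end Medium

end
end SlabTransport

theorem mainTheorem5 (d : SlabTransport.Medium) (hc : ¬ d.c =ᵐ[volume] 0) :
    (∃ Θ : ℂ → d.E →L[ℂ] d.E,
      AnalyticOnNhd ℂ Θ SlabTransport.cutPlane ∧
      (∃ C : ℝ, ∀ z ∈ SlabTransport.cutPlane, ‖z‖ ≤ 1 / 2 → ‖Θ z‖ ≤ C * ‖z * Complex.log z‖) ∧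
      ∀ z : ℂ, 0 < z.im → d.Q z = d.Qtilde z + Θ z) ∧
    (∃ δ : ℝ, 0 < δ ∧ IsUnit (1 - d.Qtilde (Complex.I * δ))) ∧
    ∃ (δ₀ : ℝ) (S' : ℂ → d.E →L[ℂ] d.E), 0 < δ₀ ∧
      (∀ z : ℂ, 0 < z.im → S' z = d.S z) ∧
      AnalyticOnNhd ℂ S'
        ({z | 0 < z.im} ∪ {z | z.im = 0 ∧ z ≠ 0} ∪ SlabTransport.slitDisc δ₀) ∧
      ContinuousOn S' {z | 0 ≤ z.im} ∧
      ∀ δ : ℝ, 0 < δ → IsUnit (1 - d.Qtilde (Complex.I * δ)) →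
        d.theta δ ≠ 0 ∧
        S' 0 = (1 + d.Qtilde (Complex.I * δ)) * d.qInv δ - (2 / d.theta δ) • d.rankOneTerm δ ∧
        (fun z => S' z - (S' 0 +
            (2 / (d.theta δ * (1 + SlabTransport.alpha δ z * d.theta δ))) • d.rankOneTerm δ))
          =O[𝓝[SlabTransport.slitDisc δ₀] 0] fun z => z * Complex.log z := by
  obtain ⟨Θ, h, hQ⟩ := d.exists_isLogDissipative hc
  obtain ⟨δ₀, hδ₀, h_analytic⟩ := h.exists_analyticOnNhd_cayleyExtension
  refine ⟨⟨Θ, h.analyticOnNhd, h.norm_le, hQ⟩, h.exists_isUnit, δ₀,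
    SlabTransport.cayleyExtension d.ell d.B Θ, hδ₀, fun z hz => ?_, h_analytic,
    h.continuousOn_cayleyExtension, fun δ hδ hu => ⟨h.leadingTheta_ne_zero hu, ?_, ?_⟩⟩
  · rw [d.S_eq_cayleyTransform hz, hQ z hz]
    exact SlabTransport.cayleyExtension_of_ne_zero (SlabTransport.mem_cutPlane_of_im_pos hz).1
  · rw [h.cayleyExtension_zero hδ hu, d.rankOneTerm_eq]
    rfl
  · rw [d.rankOneTerm_eq]
    exact (h.isBigO_cayleyExtension_sub hδ hu).mono (nhdsWithin_mono _ fun z hz => hz.1)
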